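/- Let $\mathbf k$ be a perfect field and let $S$ be a non-trivial Severi–Brauer surface over $\mathbf k$, i.e. a smooth projective surface over $\mathbf k$ with $S_{\bar{\mathbf k}}\cong\mathbb P^2_{\bar{\mathbf k}}$ but $S\not\cong\mathbb P^2_{\mathbf k}$ over $\mathbf k$. For a finite Galois extension $\mathbf L/\mathbf k$, an $\mathbf L$-isomorphism $\varphi\colon S_{\mathbf L}\to\mathbb P^2_{\mathbf L}$ and matrices $A_g\in\mathrm{GL}_3(\mathbf L)$ with $\varphi\circ g\circ\varphi^{-1}=[A_g]\circ g$ for all $g\in\mathrm{Gal}(\mathbf L/\mathbf k)$, an affine representative of $\alpha\in\mathrm{Aut}_{\mathbf k}(S)$ is a matrix $A\in\mathrm{GL}_3(\mathbf L)$ such that $[A]=\varphi\circ\alpha\circ\varphi^{-1}$ and $A^g=A_g^{-1}AA_g$ for all $g\in\mathrm{Gal}(\mathbf L/\mathbf k)$, where $A^g$ is obtained by applying $g$ to the entries of $A$. Then there is a (unique) group homomorphism $$\det\colon \mathrm{Aut}_{\mathbf k}(S)\to \mathbf k^*/(\mathbf k^*)^3$$ such that, for all $\alpha\in\mathrm{Aut}_{\mathbf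 k}(S)$ and $c\in\mathbf k^*/(\mathbf k^*)^3$, one has $\det(\alpha)=c$ if and only if, for some choice of $\mathbf L$, $\varphi$, $(A_g)_g$ as above, $\alpha$ has an affine representative $A$ whose determinant lies in $\mathbf k^*$ and has class $c$. This determinant map, regarded as a map onto its image, is the abelianization of $\mathrm{Aut}_{\mathbf k}(S)$: the induced homomorphism $$\mathrm{Aut}_{\mathbf k}(S)/[\mathrm{Aut}_{\mathbf k}(S),\mathrm{Aut}_{\mathbf k}(S)]\longrightarrow \det(\mathrm{Aut}_{\mathbf k}(S))\subseteq \mathbf k^*/(\mathbf k^*)^3$$ is an isomorphism. -/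

import Mathlib

open CategoryTheory AlgebraicGeometry MvPolynomial

universe u

attribute [local instance] MvPolynomial.gradedAlgebra

namespace SeveriBrauer

noncomputable section

/-! ### Projective spaces, base change -/

section Spaces

variable (R : Type u) [CommRing R]

/-- The degree grading on the polynomial ring `R[x_i | i ∈ ι]`. -/
abbrev polyGrading (ι : Type) : ℕ → Submodule R (MvPolynomial ι R) :=
  homogeneousSubmodule ι R

/-- The spectrum of a commutative ring, as a scheme. -/
abbrev SpecOf : Scheme.{u} := Spec (CommRingCat.of R)

/-- The projective space `Proj R[x_i | i ∈ ι]` over `R`, with its structure morphism to `Spec R`.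
For `ι = Fin (n + 1)` this is `ℙⁿ` over `R`. -/
def projSpace (ι : Type) : Over (SpecOf R) :=
  Over.mk (Proj.toSpecZero (polyGrading R ι) ≫
    Spec.map (CommRingCat.ofHom (algebraMap R (polyGrading R ι 0))))

/-- The projective plane over `R`. -/
abbrev projPlane : Over (SpecOf R) := projSpace R (Fin 3)

end Spaces

/-- The morphism `Spec L ⟶ Spec k` of a `k`-algebra `L`. -/
abbrev specMap (k L : Type u) [CommRing k] [CommRing L] [Algebra k L] : SpecOf L ⟶ SpecOf k :=
  Spec.map (CommRingCat.ofHom (algebraMap k L))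

/-- The base change functor `X ↦ X_L` from schemes over `k` to schemes over `L`. -/
abbrev baseChange (k L : Type u) [CommRing k] [CommRing L] [Algebra k L] :
    Over (SpecOf k) ⥤ Over (SpecOf L) :=
  Over.pullback (specMap k L)

/-! ### Severi-Brauer surfaces -/

section Surfaces

variable {k : Type u} [Field k]

/-- `X` is projective over `k`: it is isomorphic over `k` to a closed subscheme of some `ℙⁿ`. -/
def IsProjective (X : Over (SpecOf k)) : Prop :=
  ∃ (n : ℕ) (i : X ⟶ projSpace k (Fin (n + 1))), IsClosedImmersion i.left

/-- A Severi-Brauer surface over `k`: a smooth projective surface that becomes isomorphic to the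
projective plane over an algebraic closure of `k`. -/
structure IsSeveriBrauerSurface (S : Over (SpecOf k)) : Prop where
  smooth : SmoothOfRelativeDimension 2 S.hom
  projective : IsProjective S
  geometrically_plane :
    Nonempty ((baseChange k (AlgebraicClosure k)).obj S ≅ projPlane (AlgebraicClosure k))

/-- `S` is trivial if it is isomorphic to the projective plane over `k` itself. -/
def IsTrivial (S : Over (SpecOf k)) : Prop := Nonempty (S ≅ projPlane k)

end Surfaces

/-! ### Matrices and the Galois group acting on projective spaces -/

section Actions

variable {ι : Type}

/-- A surjective graded ring homomorphism is surjective on irrelevant ideals. -/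
theorem irrelevant_le_map {R : Type u} [CommRing R]
    (f f' : polyGrading R ι →+*ᵍ polyGrading R ι) (h : ∀ p, f (f' p) = p) :
    HomogeneousIdeal.irrelevant (polyGrading R ι) ≤
      (HomogeneousIdeal.irrelevant (polyGrading R ι)).map f := by
  change (HomogeneousIdeal.irrelevant (polyGrading R ι)).toIdeal ≤
    ((HomogeneousIdeal.irrelevant (polyGrading R ι)).map f).toIdeal
  rw [HomogeneousIdeal.toIdeal_irrelevant_le]
  intro i hi x hx
  have h1 : f' x ∈ (HomogeneousIdeal.irrelevant (polyGrading R ι)).toIdeal :=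
    HomogeneousIdeal.mem_irrelevant_of_mem _ hi (f'.2 hx)
  have h2 := Ideal.mem_map_of_mem f h1
  rw [h x] at h2
  exact h2

variable {L : Type u} [Field L] [Fintype ι]

/-- The substitution `x_i ↦ ∑ j, A i j * x_j` (with coefficients fixed). -/
def linearSubst (A : Matrix ι ι L) : polyGrading L ι →+*ᵍ polyGrading L ι where
  toRingHom := (aeval (fun i => ∑ j, C (A i j) * X j) :
    MvPolynomial ι L →ₐ[L] MvPolynomial ι L).toRingHom
  map_mem := by
    intro n p hp
    rw [mem_homogeneousSubmodule] at hp ⊢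
    have := hp.aeval (fun i => ∑ j, C (A i j) * X j) (n := 1) (fun i =>
      IsHomogeneous.sum _ _ _ fun j _ => by
        simpa using (isHomogeneous_C ι (A i j)).mul (isHomogeneous_X L j))
    simpa using this

theorem linearSubst_apply (A : Matrix ι ι L) (p : MvPolynomial ι L) :
    linearSubst A p = aeval (fun i => ∑ j, C (A i j) * X j) p := rfl

theorem linearSubst_linearSubst [DecidableEq ι] (A B : Matrix ι ι L) (h : B * A = 1)
    (p : MvPolynomial ι L) : linearSubst A (linearSubst B p) = p := by
  simp only [linearSubst_apply]
  induction p using MvPolynomial.induction_on with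
  | C a => simp
  | add p q hp hq => rw [map_add, map_add, hp, hq]
  | mul_X p i hp =>
    simp only [map_mul, hp, aeval_X, map_sum]
    congr 1
    have h1 : ∀ l, ∑ j, B i j * A j l = if i = l then 1 else 0 := fun l => by
      rw [← Matrix.mul_apply, h, Matrix.one_apply]
    have h2 : ∀ a : L, aeval (fun i => ∑ j, C (A i j) * X j) (C a : MvPolynomial ι L) = C a :=
      fun a => by simp
    simp only [h2, Finset.mul_sum, ← mul_assoc, ← C_mul]
    rw [Finset.sum_comm]
    simp only [← Finset.sum_mul, ← map_sum, h1]
    simp [apply_ite C]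

/-- The automorphism `[v] ↦ [A v]` of projective space over `L` given by `A ∈ GL(L)`, as a morphism
of schemes: it pulls the coordinate `x_i` back to `∑ j, A i j * x_j`. -/
def matrixMap [DecidableEq ι] (A : GL ι L) : (projSpace L ι).left ⟶ (projSpace L ι).left :=
  Proj.map (linearSubst (A : Matrix ι ι L))
    (irrelevant_le_map _ (linearSubst ((A⁻¹ : GL ι L) : Matrix ι ι L)) fun p =>
      linearSubst_linearSubst _ _ (by rw [← Units.val_mul, inv_mul_cancel]; rfl) p)

/-- The action of a ring homomorphism on the coefficients of polynomials. -/
def coeffMap (ι : Type) (σ : L →+* L) : polyGrading L ι →+*ᵍ polyGrading L ι where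
  toRingHom := MvPolynomial.map σ
  map_mem := fun hp => IsHomogeneous.map hp σ

variable {k : Type u} [Field k] [Algebra k L]

/-- The action `[x_i] ↦ [g x_i]` of `g ∈ Gal(L/k)` on projective space over `L`, as a morphism of
schemes. It lies over `Spec(g⁻¹) : Spec L ⟶ Spec L`. -/
def galoisProj (ι : Type) (g : Gal(L/k)) : (projSpace L ι).left ⟶ (projSpace L ι).left :=
  Proj.map (coeffMap ι ((g⁻¹ : Gal(L/k)) : L →+* L))
    (irrelevant_le_map _ (coeffMap ι (g : L →+* L)) fun p => by
      change MvPolynomial.map _ (MvPolynomial.map _ p) = p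
      rw [MvPolynomial.map_map]
      convert MvPolynomial.map_id p
      ext x
      exact g.symm_apply_apply x)

/-- The action of `g ∈ Gal(L/k)` on `X_L = X ×_k L` through the second factor, on which it acts by
`Spec(g⁻¹)`. -/
def galoisAct (X : Over (SpecOf k)) (g : Gal(L/k)) :
    ((baseChange k L).obj X).left ⟶ ((baseChange k L).obj X).left :=
  Limits.pullback.lift
    (Limits.pullback.fst X.hom (specMap k L))
    (Limits.pullback.snd X.hom (specMap k L) ≫
      Spec.map (CommRingCat.ofHom ((g⁻¹ : Gal(L/k)) : L →+* L)))
    (by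
      rw [Category.assoc, ← Spec.map_comp, Limits.pullback.condition]
      refine congrArg (_ ≫ ·) (congrArg Spec.map (CommRingCat.hom_ext (RingHom.ext fun x => ?_)))
      exact ((g⁻¹ : Gal(L/k)).commutes x).symm)

end Actions

/-! ### The determinant -/

section Determinant

variable {k : Type u} [Field k]

/-- A splitting of `S` over `L`: an isomorphism `φ : S_L ≅ ℙ²_L` over `L`, together with matrices
`A_g ∈ GL₃(L)` such that `φ ∘ g ∘ φ⁻¹ = [A_g] ∘ g` for all `g ∈ Gal(L/k)`. -/
structure Splitting (S : Over (SpecOf k)) (L : Type u) [Field L] [Algebra k L] where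
  φ : (baseChange k L).obj S ≅ projPlane L
  mat : Gal(L/k) → GL (Fin 3) L
  mat_spec : ∀ g : Gal(L/k),
    φ.inv.left ≫ galoisAct S g ≫ φ.hom.left = galoisProj (Fin 3) g ≫ matrixMap (mat g)

/-- `A` is an affine representative of `α ∈ Aut_k(S)` for the given splitting: the matrix `A`
represents `φ ∘ α ∘ φ⁻¹` and `A^g = A_g⁻¹ A A_g` for all `g ∈ Gal(L/k)`, where `A^g` is `A` with
`g` applied to all entries. -/
def Splitting.IsAffineRep {S : Over (SpecOf k)} {L : Type u} [Field L] [Algebra k L]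
    (s : Splitting S L) (α : Aut S) (A : GL (Fin 3) L) : Prop :=
  s.φ.inv.left ≫ ((baseChange k L).map α.hom).left ≫ s.φ.hom.left = matrixMap A ∧
  ∀ g : Gal(L/k),
    Matrix.GeneralLinearGroup.map (g : L →+* L) A = (s.mat g)⁻¹ * A * s.mat g

variable (k) in
/-- The group `k* / (k*)³`. -/
abbrev UnitsModCubes : Type u := kˣ ⧸ (powMonoidHom 3 : kˣ →* kˣ).range

/-- `c ∈ k* / (k*)³` is a determinant of `α`: for some finite Galois extension `L/k` splitting `S`,
some splitting over `L` and some affine representative `A` of `α`, the determinant of `A` is an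
element of `k*` with class `c`. -/
def IsDetClass (S : Over (SpecOf k)) (α : Aut S) (c : UnitsModCubes k) : Prop :=
  ∃ (L : Type u) (_ : Field L) (_ : Algebra k L) (_ : FiniteDimensional k L) (_ : IsGalois k L)
    (s : Splitting S L) (A : GL (Fin 3) L) (d : kˣ),
    s.IsAffineRep α A ∧ algebraMap k L (d : k) = (A : Matrix (Fin 3) (Fin 3) L).det ∧
      c = QuotientGroup.mk d

end Determinant

/-- A homomorphism `f` from a group `G` to a commutative group `H` is the abelianization of `G` if
the homomorphism `G / [G, G] → H` that it induces is an isomorphism. -/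
def IsAbelianization {G H : Type*} [Group G] [CommGroup H] (f : G →* H) : Prop :=
  Function.Bijective (Abelianization.lift f)

end

end SeveriBrauer

/-! A splitting of `S` over a finite Galois extension `L` transports the Galois action on `S_L` to
an action on the projective plane twisted by matrices `A_g`, which form a cocycle up to scalars. The
matrices invariant under the twisted action form a `k`-algebra `D` (`twistedAlgebra`) whose `L`-span
is the full matrix algebra. Automorphisms of the plane are linear (`exists_eq_projLin`), so by
Galois descent `Aut S` is `D^*` modulo scalars (`Splitting.exists_isAffineRep`,
`Splitting.exists_aut_isAffineRep`). The determinant on `D` is the reduced norm; it takes values in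
`k`, and rescaling a representative by an element of `k` changes it by a cube.

The heart of the matter is the kernel. If the determinant of `α` is a cube, some representative has
reduced norm one. Since `S` is non-trivial, `D` is a division algebra (`Splitting.det_ne_zero`): the
kernel or the image of a nonzero singular invariant matrix would be an invariant line, and an
invariant line trivializes the cocycle. In a division algebra of degree three, a non-central element
of reduced norm one is a commutator (`exists_eq_commutator`, a case of Wang's theorem), while a
scalar represents the identity of `S`. So the kernel lies in the commutator subgroup; the converse
inclusion is automatic, the target being commutative.

Two further points use that `k` is perfect, so that its algebraic closure is Galois. The determinant
class does not depend on the splitting, because any two splittings can be compared over the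
algebraic closure (`IsDetClass.unique`). A splitting over a finite Galois extension exists, because
an isomorphism over the closure is already defined at a finite stage (`exists_baseChange_iso`). -/

namespace SeveriBrauer

noncomputable section


/-! ### Chart rings of projective space and their homomorphisms -/

section AwayEval

open HomogeneousLocalization

variable {R : Type u} [CommRing R] {ι : Type} {T : Type u} [CommRing T]

theorem eval₂_smul_of_isHomogeneous {p : MvPolynomial ι R} {n : ℕ} (hp : p.IsHomogeneous n)
    (w : R →+* T) (c : T) (v : ι → T) : eval₂ w (c • v) p = c ^ n * eval₂ w v p := by
  rw [eval₂_eq, eval₂_eq, Finset.mul_sum]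
  refine Finset.sum_congr rfl fun d hd => ?_
  have h1 : ∑ i ∈ d.support, d i = n := by
    have := hp (mem_support_iff.mp hd)
    rw [Finsupp.weight_apply, Finsupp.sum] at this
    rw [← this]
    exact Finset.sum_congr rfl fun i _ => by simp
  simp only [Pi.smul_apply, smul_eq_mul, mul_pow, Finset.prod_mul_distrib,
    Finset.prod_pow_eq_pow_sum, h1]
  ring

theorem X_mem_polyGrading (i : ι) : (X i : MvPolynomial ι R) ∈ polyGrading R ι 1 :=
  isHomogeneous_X R i

theorem X_mem_polyGrading' (i : ι) : (X i : MvPolynomial ι R) ∈ polyGrading R ι (1 • 1) :=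
  isHomogeneous_X R i

theorem isUnit_eval₂Hom {w : R →+* T} {v : ι → T} {h : MvPolynomial ι R}
    (hh : IsUnit (eval₂ w v h)) : IsUnit (eval₂Hom w v h) := hh

/-- Evaluation of homogeneous fractions `a / h ^ n` at a vector `v` with `h(v)` invertible. -/
def awayEval (w : R →+* T) (v : ι → T) (h : MvPolynomial ι R) (hh : IsUnit (eval₂ w v h)) :
    Away (polyGrading R ι) h →+* T :=
  (IsLocalization.Away.lift (S := Localization.Away h) h (g := eval₂Hom w v) (isUnit_eval₂Hom hh)).comp
    (algebraMap _ _)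

/-- This form, with the denominator cleared, is how identities about `awayEval` get checked: write
an element as a fraction and cancel the unit `h(v) ^ n`. -/
theorem awayEval_mk (w : R →+* T) (v : ι → T) {h : MvPolynomial ι R}
    (hh : IsUnit (eval₂ w v h)) {d : ℕ} (hd : h ∈ polyGrading R ι d) (n : ℕ)
    (a : MvPolynomial ι R) (ha : a ∈ polyGrading R ι (n • d)) :
    eval₂ w v h ^ n * awayEval w v h hh (Away.mk (polyGrading R ι) hd n a ha) = eval₂ w v a := by
  have h1 : algebraMap (MvPolynomial ι R) (Localization.Away h) (h ^ n) *
      (Away.mk (polyGrading R ι) hd n a ha).val = algebraMap _ _ a := by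
    rw [Away.val_mk, ← Localization.mk_one_eq_algebraMap, ← Localization.mk_one_eq_algebraMap,
      Localization.mk_mul, Localization.mk_eq_mk_iff, Localization.r_iff_exists]
    exact ⟨1, by simp⟩
  have h2 := congrArg (IsLocalization.Away.lift (S := Localization.Away h) h
    (g := eval₂Hom w v) (isUnit_eval₂Hom hh)) h1
  rw [map_mul, IsLocalization.Away.lift_eq, IsLocalization.Away.lift_eq, map_pow] at h2
  exact h2

theorem awayEval_awayMap (w : R →+* T) (v : ι → T) {f g x : MvPolynomial ι R} {e : ℕ}
    (hg : g ∈ polyGrading R ι e) (hx : x = f * g) (hf : IsUnit (eval₂ w v f))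
    (hx' : IsUnit (eval₂ w v x)) {d : ℕ} (hd : f ∈ polyGrading R ι d) :
    (awayEval w v x hx').comp (awayMap (polyGrading R ι) hg hx) = awayEval w v f hf := by
  ext a
  obtain ⟨n, a, ha, rfl⟩ := Away.mk_surjective _ hd a
  rw [RingHom.comp_apply, awayMap_mk (hf := hd)]
  apply (hx'.pow n).mul_left_cancel
  rw [awayEval_mk, eval₂_mul, ← awayEval_mk w v hf hd n a ha, hx, eval₂_mul, eval₂_pow]
  ring

/-- Constants in the degree zero localization. -/
def awayC (h : MvPolynomial ι R) : R →+* Away (polyGrading R ι) h :=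
  (fromZeroRingHom (polyGrading R ι) _).comp (algebraMap R (polyGrading R ι 0))

/-- The fraction `x_j / x_i`. -/
def awayX (i j : ι) : Away (polyGrading R ι) (X i) :=
  Away.mk (polyGrading R ι) (X_mem_polyGrading i) 1 (X j) (X_mem_polyGrading' j)

theorem val_awayC (h : MvPolynomial ι R) (r : R) :
    (awayC h r).val = algebraMap (MvPolynomial ι R) (Localization.Away h) (C r) := by
  rw [← Localization.mk_one_eq_algebraMap]
  rfl

theorem awayX_self (i : ι) : awayX (R := R) i i = 1 := by
  apply HomogeneousLocalization.val_injective
  rw [awayX, Away.val_mk, val_one]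
  simp only [pow_one]
  exact Localization.mk_self (⟨X i, _⟩ : Submonoid.powers (X i : MvPolynomial ι R))

theorem awayEval_awayC (w : R →+* T) (v : ι → T) (h : MvPolynomial ι R)
    (hh : IsUnit (eval₂ w v h)) : (awayEval w v h hh).comp (awayC h) = w := by
  ext r
  rw [RingHom.comp_apply, awayEval, RingHom.comp_apply, HomogeneousLocalization.algebraMap_apply, val_awayC,
    IsLocalization.Away.lift_eq]
  simp

theorem mul_awayEval_awayX (w : R →+* T) (v : ι → T) (i j : ι)
    (hh : IsUnit (eval₂ w v (X i))) : v i * awayEval w v (X i) hh (awayX i j) = v j := by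
  have := awayEval_mk w v hh (X_mem_polyGrading i) 1 (X j) (X_mem_polyGrading' j)
  rw [eval₂_X, eval₂_X, pow_one] at this
  exact this

/-- Dehomogenization, verified in the full localization, where one may multiply by `x_i ^ n` and use
homogeneity. It shows that the ratios `x_j / x_i` generate the chart ring over the constants. -/
theorem eval₂_awayX {i : ι} {n : ℕ} (a : MvPolynomial ι R)
    (ha : a ∈ polyGrading R ι (n • 1)) :
    eval₂ (awayC (X i)) (awayX i) a =
      Away.mk (polyGrading R ι) (X_mem_polyGrading i) n a ha := by
  apply HomogeneousLocalization.val_injective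
  rw [← HomogeneousLocalization.algebraMap_apply, ← HomogeneousLocalization.algebraMap_apply]
  have hu : IsUnit (algebraMap (MvPolynomial ι R) (Localization.Away (X i : MvPolynomial ι R))
      (X i)) := IsLocalization.Away.algebraMap_isUnit _
  apply (hu.pow n).mul_left_cancel
  rw [← coe_eval₂Hom, ← RingHom.comp_apply, comp_eval₂Hom, coe_eval₂Hom]
  have hn : a.IsHomogeneous n := by simpa using ha
  rw [← eval₂_smul_of_isHomogeneous hn]
  have hX : (algebraMap (MvPolynomial ι R) (Localization.Away (X i : MvPolynomial ι R)) (X i)) •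
      (fun j => algebraMap _ (Localization.Away (X i : MvPolynomial ι R)) (awayX (R := R) i j)) =
      fun j => algebraMap (MvPolynomial ι R) _ (X j) := by
    funext j
    rw [Pi.smul_apply, smul_eq_mul, HomogeneousLocalization.algebraMap_apply, awayX, Away.val_mk,
      ← Localization.mk_one_eq_algebraMap, ← Localization.mk_one_eq_algebraMap,
      Localization.mk_mul, Localization.mk_eq_mk_iff, Localization.r_iff_exists]
    exact ⟨1, by simp⟩
  have hC : (algebraMap (Away (polyGrading R ι) (X i)) (Localization.Away (X i))).comp
      (awayC (X i)) = (algebraMap (MvPolynomial ι R)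
        (Localization.Away (X i : MvPolynomial ι R))).comp C := by
    ext r
    exact val_awayC _ r
  refine Eq.trans (congrArg₂ (fun w v => eval₂ w v a) hC hX) ?_
  rw [← coe_eval₂Hom, ← comp_eval₂Hom, RingHom.comp_apply, eval₂Hom_C_eq_bind₁,
    HomogeneousLocalization.algebraMap_apply, Away.val_mk]
  simp only [bind₁_X_left]
  rw [← map_pow,
      ← Localization.mk_one_eq_algebraMap, ← Localization.mk_one_eq_algebraMap,
      Localization.mk_mul, Localization.mk_eq_mk_iff, Localization.r_iff_exists]
  exact ⟨1, by simp⟩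

/-- Since constants and ratios generate, a homomorphism is determined by the vector of images of
`x_j / x_i`, whose `i`-th coordinate is 1. -/
theorem eq_awayEval {i : ι} (ρ : Away (polyGrading R ι) (X i) →+* T) (w : R →+* T)
    (hw : ρ.comp (awayC (X i)) = w) :
    ∃ hh : IsUnit (eval₂ w (fun j => ρ (awayX i j)) (X i)),
      ρ = awayEval w (fun j => ρ (awayX i j)) (X i) hh := by
  have h1 : eval₂ w (fun j => ρ (awayX i j)) (X i) = 1 := by
    rw [eval₂_X, awayX_self, map_one]
  have hh : IsUnit (eval₂ w (fun j => ρ (awayX i j)) (X i)) := by rw [h1]; exact isUnit_one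
  refine ⟨hh, ?_⟩
  ext a
  obtain ⟨n, a, ha, rfl⟩ := Away.mk_surjective _ (X_mem_polyGrading i) a
  have h2 := awayEval_mk w (fun j => ρ (awayX i j)) hh (X_mem_polyGrading i) n a ha
  rw [h1, one_pow, one_mul] at h2
  rw [h2, ← eval₂_awayX a ha, ← coe_eval₂Hom, ← RingHom.comp_apply, comp_eval₂Hom, hw]
  rfl

theorem away_ringHom_ext {i : ι} {ρ ρ' : Away (polyGrading R ι) (X i) →+* T}
    (hC : ρ.comp (awayC (X i)) = ρ'.comp (awayC (X i)))
    (hX : ∀ j, ρ (awayX i j) = ρ' (awayX i j)) : ρ = ρ' := by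
  obtain ⟨h1, h2⟩ := eq_awayEval ρ _ rfl
  obtain ⟨h3, h4⟩ := eq_awayEval ρ' _ rfl
  rw [h2, h4]
  congr 1
  funext j
  exact hX j

end AwayEval


/-! ### Points of projective space given by vectors -/

section Points

open HomogeneousLocalization

variable {R : Type u} [CommRing R] {ι : Type} {T : Type u} [CommRing T]

/-- The structure morphism of projective space. -/
abbrev projStr (R : Type u) [CommRing R] (ι : Type) : Proj (polyGrading R ι) ⟶ SpecOf R :=
  Proj.toSpecZero (polyGrading R ι) ≫
    Spec.map (CommRingCat.ofHom (algebraMap R (polyGrading R ι 0)))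

theorem awayι_projStr {h : MvPolynomial ι R} {d : ℕ} (hd : h ∈ polyGrading R ι d) (h0 : 0 < d) :
    Proj.awayι (polyGrading R ι) h hd h0 ≫ projStr R ι =
      Spec.map (CommRingCat.ofHom (awayC h)) := by
  rw [projStr, Proj.awayι_toSpecZero_assoc, ← Spec.map_comp]
  rfl

/-- The point of projective space with coordinates `v`, in the chart where `h` is invertible. -/
def awayPoint (w : R →+* T) (v : ι → T) {h : MvPolynomial ι R} {d : ℕ}
    (hd : h ∈ polyGrading R ι d) (h0 : 0 < d) (hh : IsUnit (eval₂ w v h)) :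
    Spec (CommRingCat.of T) ⟶ Proj (polyGrading R ι) :=
  Spec.map (CommRingCat.ofHom (awayEval w v h hh)) ≫ Proj.awayι (polyGrading R ι) h hd h0

theorem awayPoint_mul (w : R →+* T) (v : ι → T) {f g x : MvPolynomial ι R} {d e : ℕ}
    (hd : f ∈ polyGrading R ι d) (h0 : 0 < d) (hf : IsUnit (eval₂ w v f))
    (hg : g ∈ polyGrading R ι e) (hx : x = f * g) (hx' : IsUnit (eval₂ w v x)) {n : ℕ}
    (hn : x ∈ polyGrading R ι n) (hn0 : 0 < n) :
    awayPoint w v hn hn0 hx' = awayPoint w v hd h0 hf := by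
  have h1 := Proj.SpecMap_awayMap_awayι (polyGrading R ι) hd h0 hg hx
  rw [awayPoint, awayPoint, ← awayEval_awayMap w v hg hx hf hx' hd, CommRingCat.ofHom_comp,
    Spec.map_comp, Category.assoc, h1]
  rfl

/-- Both sides agree with the point in the smaller chart where `f * g` is invertible. Hence the
arbitrary nonvanishing coordinate chosen in `point` does not matter. -/
theorem awayPoint_eq_awayPoint (w : R →+* T) (v : ι → T) {f g : MvPolynomial ι R} {d e : ℕ}
    (hd : f ∈ polyGrading R ι d) (h0 : 0 < d) (hf : IsUnit (eval₂ w v f))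
    (he : g ∈ polyGrading R ι e) (h0' : 0 < e) (hg : IsUnit (eval₂ w v g)) :
    awayPoint w v hd h0 hf = awayPoint w v he h0' hg := by
  have hm : f * g ∈ polyGrading R ι (d + e) := SetLike.mul_mem_graded hd he
  have hu : IsUnit (eval₂ w v (f * g)) := by rw [eval₂_mul]; exact hf.mul hg
  rw [← awayPoint_mul w v hd h0 hf he rfl hu hm (Nat.add_pos_left h0 e),
    ← awayPoint_mul w v he h0' hg hd (mul_comm f g) hu hm (Nat.add_pos_left h0 e)]

theorem awayPoint_projStr (w : R →+* T) (v : ι → T) {h : MvPolynomial ι R} {d : ℕ}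
    (hd : h ∈ polyGrading R ι d) (h0 : 0 < d) (hh : IsUnit (eval₂ w v h)) :
    awayPoint w v hd h0 hh ≫ projStr R ι = Spec.map (CommRingCat.ofHom w) := by
  rw [awayPoint, Category.assoc, awayι_projStr, ← Spec.map_comp, ← CommRingCat.ofHom_comp,
    awayEval_awayC]

theorem awayEval_smul (w : R →+* T) (c : T) (v : ι → T) {h : MvPolynomial ι R} {d : ℕ}
    (hd : h ∈ polyGrading R ι d) (hh : IsUnit (eval₂ w v h))
    (hh' : IsUnit (eval₂ w (c • v) h)) : awayEval w (c • v) h hh' = awayEval w v h hh := by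
  ext a
  obtain ⟨n, a, ha, rfl⟩ := Away.mk_surjective _ hd a
  apply (hh'.pow n).mul_left_cancel
  have ha' : a.IsHomogeneous (n * d) := ha
  rw [awayEval_mk, eval₂_smul_of_isHomogeneous ha', ← awayEval_mk w v hh hd n a ha,
    eval₂_smul_of_isHomogeneous hd]
  ring

theorem awayEval_map {R' : Type u} [CommRing R'] {κ : Type}
    (f : polyGrading R ι →+*ᵍ polyGrading R' κ) (w : R →+* T) (v : ι → T) (w' : R' →+* T)
    (v' : κ → T) (hf : ∀ p, eval₂ w' v' (f p) = eval₂ w v p) {h : MvPolynomial ι R} {d : ℕ}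
    (hd : h ∈ polyGrading R ι d) (hh : IsUnit (eval₂ w v h)) (hh' : IsUnit (eval₂ w' v' (f h))) :
    (awayEval w' v' (f h) hh').comp (Away.map f h) = awayEval w v h hh := by
  ext a
  obtain ⟨n, a, ha, rfl⟩ := Away.mk_surjective _ hd a
  apply (hh'.pow n).mul_left_cancel
  rw [RingHom.comp_apply, Away.map_mk, awayEval_mk, hf, hf, awayEval_mk]

/-- Only compatibility with evaluation is asked of `f`, so linear substitutions and changes of
coefficients are both covered. -/
theorem awayPoint_comp_map {R' : Type u} [CommRing R'] {κ : Type}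
    (f : polyGrading R ι →+*ᵍ polyGrading R' κ)
    (hf' : HomogeneousIdeal.irrelevant (polyGrading R' κ) ≤
      (HomogeneousIdeal.irrelevant (polyGrading R ι)).map f)
    (w : R →+* T) (v : ι → T) (w' : R' →+* T)
    (v' : κ → T) (hf : ∀ p, eval₂ w' v' (f p) = eval₂ w v p) {h : MvPolynomial ι R} {d : ℕ}
    (hd : h ∈ polyGrading R ι d) (h0 : 0 < d) (hh : IsUnit (eval₂ w v h))
    (hh' : IsUnit (eval₂ w' v' (f h))) :
    awayPoint w' v' (h := f h) (f.2 hd) h0 hh' ≫ Proj.map f hf' = awayPoint w v hd h0 hh := by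
  rw [awayPoint, awayPoint, Category.assoc, Proj.awayι_comp_map _ _ h0 _ hd, ← Category.assoc,
    ← Spec.map_comp, ← CommRingCat.ofHom_comp, awayEval_map f w v w' v' hf hd hh hh']

variable {K : Type u} [Field K]

theorem exists_isUnit_eval₂_X (w : R →+* K) {v : ι → K} (hv : v ≠ 0) :
    ∃ i, IsUnit (eval₂ w v (X i)) := by
  obtain ⟨i, hi⟩ := Function.ne_iff.mp hv
  exact ⟨i, by rw [eval₂_X]; exact isUnit_iff_ne_zero.mpr hi⟩

/-- The point of projective space with values in a field `K` given by a nonzero vector. -/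
def point (w : R →+* K) (v : ι → K) (hv : v ≠ 0) :
    Spec (CommRingCat.of K) ⟶ Proj (polyGrading R ι) :=
  awayPoint w v (X_mem_polyGrading _) one_pos (exists_isUnit_eval₂_X w hv).choose_spec

theorem point_eq_awayPoint (w : R →+* K) (v : ι → K) (hv : v ≠ 0) {h : MvPolynomial ι R} {d : ℕ}
    (hd : h ∈ polyGrading R ι d) (h0 : 0 < d) (hh : IsUnit (eval₂ w v h)) :
    point w v hv = awayPoint w v hd h0 hh :=
  awayPoint_eq_awayPoint ..

theorem point_projStr (w : R →+* K) (v : ι → K) (hv : v ≠ 0) :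
    point w v hv ≫ projStr R ι = Spec.map (CommRingCat.ofHom w) :=
  awayPoint_projStr ..

theorem point_smul (w : R →+* K) (v : ι → K) (hv : v ≠ 0) (c : K) (hc : c • v ≠ 0) :
    point w (c • v) hc = point w v hv := by
  obtain ⟨i, hi⟩ := exists_isUnit_eval₂_X w hc
  have hi' : IsUnit (eval₂ w v (X i)) := by
    rw [eval₂_X, isUnit_iff_ne_zero] at hi ⊢
    exact right_ne_zero_of_mul hi
  rw [point_eq_awayPoint w _ hc (X_mem_polyGrading i) one_pos hi,
    point_eq_awayPoint w _ hv (X_mem_polyGrading i) one_pos hi', awayPoint, awayPoint,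
    awayEval_smul w c v (X_mem_polyGrading i) hi' hi]

theorem range_awayPoint_subset (w : R →+* T) (v : ι → T) {h : MvPolynomial ι R} {d : ℕ}
    (hd : h ∈ polyGrading R ι d) (h0 : 0 < d) (hh : IsUnit (eval₂ w v h)) :
    Set.range (awayPoint w v hd h0 hh) ⊆ Proj.basicOpen (polyGrading R ι) h := by
  rintro _ ⟨x, rfl⟩
  rw [← Proj.opensRange_awayι _ h hd h0, awayPoint, Scheme.Hom.comp_apply]
  exact ⟨_, rfl⟩

theorem point_mem_basicOpen (w : R →+* K) (v : ι → K) (hv : v ≠ 0) {h : MvPolynomial ι R} {d : ℕ}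
    (hd : h ∈ polyGrading R ι d) (h0 : 0 < d) (x : Spec (CommRingCat.of K)) :
    point w v hv x ∈ Proj.basicOpen (polyGrading R ι) h ↔ eval₂ w v h ≠ 0 := by
  refine ⟨fun hx => ?_, fun hx => ?_⟩
  · obtain ⟨i, hi⟩ := exists_isUnit_eval₂_X w hv
    rw [point_eq_awayPoint w v hv (X_mem_polyGrading i) one_pos hi, awayPoint,
      Scheme.Hom.comp_apply] at hx
    rw [← Scheme.Hom.mem_preimage,
      Proj.awayι_preimage_basicOpen _ (X_mem_polyGrading i) one_pos hd h0] at hx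
    intro h1
    -- In the chart of `x_i`, the basic open set of `h` is cut out by `h / x_i ^ d`; the exponent in
    -- `h ^ 1` is the degree of `x_i`.
    have h2 := awayEval_mk w v hi (X_mem_polyGrading i) d (h ^ 1)
      (by convert! SetLike.pow_mem_graded 1 hd using 2; exact mul_comm _ _)
    rw [eval₂_pow, h1, zero_pow one_ne_zero, mul_eq_zero] at h2
    have h3 := h2.resolve_left (hi.pow d).ne_zero
    have h4 : awayEval w v (X i) hi (Away.isLocalizationElem (X_mem_polyGrading i) hd) = 0 := h3
    apply hx
    change awayEval w v (X i) hi (Away.isLocalizationElem (X_mem_polyGrading i) hd) ∈ x.asIdeal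
    rw [h4]
    exact zero_mem _
  · rw [point_eq_awayPoint w v hv hd h0 (isUnit_iff_ne_zero.mpr hx)]
    exact range_awayPoint_subset _ _ _ _ _ ⟨x, rfl⟩

/-- In a common chart the two points have the same ratios `x_j / x_i`, and these recover each vector
up to its `i`-th coordinate. -/
theorem exists_smul_eq_of_point_eq (w : R →+* K) {v v' : ι → K} (hv : v ≠ 0) (hv' : v' ≠ 0)
    (h : point w v hv = point w v' hv') : ∃ c : K, v' = c • v := by
  obtain ⟨i, hi⟩ := exists_isUnit_eval₂_X w hv
  let x : Spec (CommRingCat.of K) := (⊥ : PrimeSpectrum K)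
  have hi' : IsUnit (eval₂ w v' (X i)) := by
    rw [isUnit_iff_ne_zero] at hi ⊢
    rw [← point_mem_basicOpen w v hv (X_mem_polyGrading i) one_pos x, h] at hi
    exact (point_mem_basicOpen w v' hv' (X_mem_polyGrading i) one_pos x).mp hi
  rw [point_eq_awayPoint w v hv (X_mem_polyGrading i) one_pos hi,
    point_eq_awayPoint w v' hv' (X_mem_polyGrading i) one_pos hi', awayPoint, awayPoint,
    cancel_mono] at h
  have h1 : awayEval w v (X i) hi = awayEval w v' (X i) hi' :=
    congrArg CommRingCat.Hom.hom (Spec.map_injective h)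
  refine ⟨v' i / v i, funext fun j => ?_⟩
  have hj := mul_awayEval_awayX w v i j hi
  have hj' := mul_awayEval_awayX w v' i j hi'
  rw [← h1] at hj'
  have h0 : v i ≠ 0 := by simpa using hi.ne_zero
  rw [Pi.smul_apply, smul_eq_mul, ← hj, ← hj']
  field_simp

end Points


/-! ### Morphisms are locally given by homogeneous polynomials -/

section LocalForm

open HomogeneousLocalization

variable {R : Type u} [CommRing R] {ι κ : Type}

theorem adjoin_range_X_polyGrading_zero :
    Algebra.adjoin (polyGrading R ι 0) (Set.range (X : ι → MvPolynomial ι R)) = ⊤ := by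
  rw [eq_top_iff]
  rintro p -
  induction p using MvPolynomial.induction_on with
  | C a => exact Subalgebra.algebraMap_mem _ (⟨C a, isHomogeneous_C ι a⟩ : polyGrading R ι 0)
  | add p q hp hq => exact add_mem hp hq
  | mul_X p i hp => exact mul_mem hp (Algebra.subset_adjoin ⟨i, rfl⟩)

theorem iSup_basicOpen_X : ⨆ i, Proj.basicOpen (polyGrading R ι) (X i) = ⊤ :=
  Proj.iSup_basicOpen_eq_top' _ _ (fun i => ⟨1, X_mem_polyGrading i⟩)
    adjoin_range_X_polyGrading_zero

theorem exists_mem_basicOpen_X (p : Proj (polyGrading R ι)) :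
    ∃ i, p ∈ Proj.basicOpen (polyGrading R ι) (X i) := by
  have : p ∈ ⨆ i, Proj.basicOpen (polyGrading R ι) (X i) := by
    rw [iSup_basicOpen_X]; trivial
  exact TopologicalSpace.Opens.mem_iSup.mp this

theorem exists_homogeneous_basicOpen_le (U : (Proj (polyGrading R ι)).Opens)
    (p : Proj (polyGrading R ι)) (hp : p ∈ U) :
    ∃ (h : MvPolynomial ι R) (d : ℕ), h ∈ polyGrading R ι d ∧ 0 < d ∧
      p ∈ Proj.basicOpen (polyGrading R ι) h ∧ Proj.basicOpen (polyGrading R ι) h ≤ U := by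
  obtain ⟨_, ⟨r, rfl⟩, hr, hrU⟩ :=
    TopologicalSpace.Opens.isBasis_iff_nbhd.mp (Proj.isBasis_basicOpen (polyGrading R ι)) hp
  obtain ⟨i, hi⟩ := exists_mem_basicOpen_X p
  rw [Proj.basicOpen_eq_iSup_proj] at hr
  obtain ⟨d, hd⟩ := TopologicalSpace.Opens.mem_iSup.mp hr
  -- The factor `X i` makes the degree positive even when the homogeneous component is a constant.
  refine ⟨GradedRing.proj (polyGrading R ι) d r * X i, d + 1,
    SetLike.mul_mem_graded (SetLike.coe_mem _) (X_mem_polyGrading i), d.succ_pos, ?_, ?_⟩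
  · rw [Proj.basicOpen_mul]
    exact ⟨hd, hi⟩
  · rw [Proj.basicOpen_mul]
    refine inf_le_left.trans (le_trans ?_ hrU)
    conv_rhs => rw [Proj.basicOpen_eq_iSup_proj]
    exact le_iSup (fun d => Proj.basicOpen (polyGrading R ι) (GradedRing.proj _ d r)) d

/-- A morphism from an affine scheme into a standard chart. -/
theorem exists_eq_specMap_comp_awayι {A : Type u} [CommRing A]
    (q : Spec (CommRingCat.of A) ⟶ Proj (polyGrading R ι)) (w : R →+* A)
    (hq : q ≫ projStr R ι = Spec.map (CommRingCat.ofHom w)) (i : ι)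
    (hi : Set.range q ⊆ Proj.basicOpen (polyGrading R ι) (X i)) :
    ∃ ρ : Away (polyGrading R ι) (X i) →+* A, ρ.comp (awayC (X i)) = w ∧
      q = Spec.map (CommRingCat.ofHom ρ) ≫
        Proj.awayι (polyGrading R ι) (X i) (X_mem_polyGrading i) one_pos := by
  have hi' : Set.range q ⊆
      Set.range (Proj.awayι (polyGrading R ι) (X i) (X_mem_polyGrading i) one_pos) := by
    rw [← Scheme.Hom.coe_opensRange (Proj.awayι _ _ _ _), Proj.opensRange_awayι]
    exact hi
  refine ⟨(Spec.preimage (IsOpenImmersion.lift _ q hi')).hom, ?_, ?_⟩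
  · have h1 := congrArg (· ≫ projStr R ι) (IsOpenImmersion.lift_fac _ q hi')
    simp only [Category.assoc, awayι_projStr, hq] at h1
    rw [← Spec.map_preimage (IsOpenImmersion.lift _ q hi'), ← Spec.map_comp] at h1
    exact congrArg CommRingCat.Hom.hom (Spec.map_injective h1)
  · rw [CommRingCat.ofHom_hom, Spec.map_preimage, IsOpenImmersion.lift_fac]

/-- Near `p` the map lands in one chart and is a ring homomorphism into the degree-zero localization
at some `h`; the images of the ratios, over a common power of `h`, have homogeneous numerators `N`.
The conclusion allows points over every field, so that it can later be used at generic points of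
subvarieties. -/
theorem exists_local_form [Fintype κ] (f : Proj (polyGrading R ι) ⟶ Proj (polyGrading R κ))
    (hf : f ≫ projStr R κ = projStr R ι) (p : Proj (polyGrading R ι)) :
    ∃ (N : κ → MvPolynomial ι R) (e : ℕ) (h : MvPolynomial ι R) (d : ℕ),
      h ∈ polyGrading R ι d ∧ 0 < d ∧ p ∈ Proj.basicOpen (polyGrading R ι) h ∧
      (∀ j, (N j).IsHomogeneous e) ∧
      ∀ (K : Type u) [Field K] (w : R →+* K) (v : ι → K) (hv : v ≠ 0), eval₂ w v h ≠ 0 →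
        ∃ hN : (fun j => eval₂ w v (N j)) ≠ 0, point w v hv ≫ f = point w _ hN := by
  classical
  obtain ⟨i, hi⟩ := exists_mem_basicOpen_X (f p)
  obtain ⟨h, d, hd, h0, hp, hle⟩ := exists_homogeneous_basicOpen_le
    (f ⁻¹ᵁ Proj.basicOpen (polyGrading R κ) (X i)) p hi
  obtain ⟨ψ, hψ, hfψ⟩ := exists_eq_specMap_comp_awayι
    (Proj.awayι (polyGrading R ι) h hd h0 ≫ f) (awayC h)
    (by rw [Category.assoc, hf, awayι_projStr]) i (by
      rintro _ ⟨y, rfl⟩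
      rw [Scheme.Hom.comp_apply]
      apply hle
      rw [← Proj.opensRange_awayι _ h hd h0]
      exact ⟨y, rfl⟩)
  choose m n hn hmn using fun j => Away.mk_surjective _ hd (ψ (awayX i j))
  -- The common denominator is `h ^ ∑ l, m l`; the natural subtraction is exact because `m j` is one
  -- of the summands.
  refine ⟨fun j => h ^ (∑ l, m l - m j) * n j, (∑ l, m l) * d, h, d, hd, h0, hp, fun j => ?_, ?_⟩
  · have h1 : ∑ l, m l - m j + m j = ∑ l, m l :=
      Nat.sub_add_cancel (Finset.single_le_sum (fun _ _ => Nat.zero_le _) (Finset.mem_univ j))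
    have h2 : (h ^ (∑ l, m l - m j)).IsHomogeneous (d * (∑ l, m l - m j)) :=
      IsHomogeneous.pow hd _
    have h3 : (n j).IsHomogeneous (m j * d) := hn j
    have h4 := h2.mul h3
    rwa [mul_comm d, ← add_mul, h1] at h4
  · intro K _ w v hv hhv
    have hu : IsUnit (eval₂ w v h) := isUnit_iff_ne_zero.mpr hhv
    have key : ∀ j, eval₂ w v (h ^ (∑ l, m l - m j) * n j) =
        eval₂ w v h ^ (∑ l, m l) * awayEval w v h hu (ψ (awayX i j)) := by
      intro j
      rw [← hmn j, eval₂_mul, eval₂_pow, ← awayEval_mk w v hu hd (m j) (n j) (hn j), ← mul_assoc,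
        ← pow_add, Nat.sub_add_cancel
          (Finset.single_le_sum (fun _ _ => Nat.zero_le _) (Finset.mem_univ j))]
    have key' : (fun j => eval₂ w v (h ^ (∑ l, m l - m j) * n j)) =
        eval₂ w v h ^ (∑ l, m l) • fun j => awayEval w v h hu (ψ (awayX i j)) :=
      funext key
    have hN : (fun j => eval₂ w v (h ^ (∑ l, m l - m j) * n j)) ≠ 0 := by
      intro h1
      have h2 := congrFun h1 i
      simp only [key, awayX_self, map_one, mul_one, Pi.zero_apply] at h2
      exact pow_ne_zero _ hhv h2
    refine ⟨hN, ?_⟩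
    obtain ⟨hh, h3⟩ := eq_awayEval ((awayEval w v h hu).comp ψ) w (by
      rw [RingHom.comp_assoc, hψ, awayEval_awayC])
    have hN' : eval₂ w v h ^ (∑ l, m l) • (fun j => awayEval w v h hu (ψ (awayX i j))) ≠ 0 := by
      rwa [← key']
    have hv' : (fun j => awayEval w v h hu (ψ (awayX i j))) ≠ 0 := by
      intro h1
      rw [h1, smul_zero] at hN'
      exact hN' rfl
    have e1 : point w _ hN = point w _ hN' := by congr 1
    rw [e1, point_smul w _ hv', point_eq_awayPoint w v hv hd h0 hu, awayPoint, Category.assoc, hfψ,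
      point_eq_awayPoint w _ hv' (X_mem_polyGrading i) one_pos hh, awayPoint, ← Category.assoc,
      ← Spec.map_comp, ← CommRingCat.ofHom_comp, h3]

theorem eval₂_algebraMap_X {B : Type*} [CommRing B] (φ : MvPolynomial ι R →+* B)
    (p : MvPolynomial ι R) : eval₂ (φ.comp C) (fun i => φ (X i)) p = φ p := by
  rw [← coe_eval₂Hom, ← comp_eval₂Hom, RingHom.comp_apply]
  exact congrArg φ (eval₂_eta p)

end LocalForm

/-! ### The generic point detects equality of morphisms -/

section Generic

open HomogeneousLocalization

variable {R : Type u} [CommRing R] [IsDomain R] {ι : Type}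

theorem X_ne_zero_vec [Nonempty ι] : (fun i : ι => algebraMap (MvPolynomial ι R)
    (FractionRing (MvPolynomial ι R)) (X i)) ≠ 0 := by
  intro h
  have := congrFun h (Classical.arbitrary ι)
  simp only [Pi.zero_apply, FaithfulSMul.algebraMap_eq_zero_iff] at this
  exact X_ne_zero _ this

/-- The generic point of projective space, with coordinates `(x_i)`. -/
def genericPoint (R : Type u) [CommRing R] [IsDomain R] (ι : Type) [Nonempty ι] :
    Spec (CommRingCat.of (FractionRing (MvPolynomial ι R))) ⟶ Proj (polyGrading R ι) :=
  point ((algebraMap (MvPolynomial ι R) (FractionRing (MvPolynomial ι R))).comp C)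
    (fun i => algebraMap (MvPolynomial ι R) (FractionRing (MvPolynomial ι R)) (X i))
    X_ne_zero_vec

theorem away_isDomain (i : ι) : IsDomain (Away (polyGrading R ι) (X i)) := by
  have : IsDomain (Localization.Away (X i : MvPolynomial ι R)) :=
    IsLocalization.isDomain_localization (powers_le_nonZeroDivisors_of_noZeroDivisors (X_ne_zero i))
  exact (HomogeneousLocalization.val_injective _).isDomain
    (algebraMap (Away (polyGrading R ι) (X i)) (Localization.Away (X i : MvPolynomial ι R)))

/-- A degree-zero fraction that vanishes at the tautological vector `(x_i)` has zero numerator. The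
target is the fraction field of the whole polynomial ring, so the coordinates of the generic point
are simply the variables. -/
theorem awayEval_generic_injective (i : ι) (hh) :
    Function.Injective (awayEval
      ((algebraMap (MvPolynomial ι R) (FractionRing (MvPolynomial ι R))).comp C)
      (fun i => algebraMap (MvPolynomial ι R) (FractionRing (MvPolynomial ι R)) (X i))
      (X i : MvPolynomial ι R) hh) := by
  rw [injective_iff_map_eq_zero]
  intro a ha
  obtain ⟨n, a, han, rfl⟩ := Away.mk_surjective _ (X_mem_polyGrading i) a
  have := awayEval_mk _ _ hh (X_mem_polyGrading i) n a han
  rw [ha, mul_zero, eval₂_algebraMap_X, eq_comm, FaithfulSMul.algebraMap_eq_zero_iff] at this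
  apply HomogeneousLocalization.val_injective
  rw [Away.val_mk, val_zero, this, Localization.mk_zero]

theorem isDominant_specMap {A B : Type u} [CommRing A] [CommRing B] {f : A →+* B}
    (hf : Function.Injective f) : IsDominant (Spec.map (CommRingCat.ofHom f)) := by
  refine ⟨?_⟩
  have := (PrimeSpectrum.denseRange_comap_iff_ker_le_nilRadical f).mpr (by
    rw [(RingHom.injective_iff_ker_eq_bot f).mp hf]; exact bot_le)
  exact this

theorem proj_hom_ext_X {R : Type u} [CommRing R] {Y : Scheme.{u}}
    {f g : Proj (polyGrading R ι) ⟶ Y}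
    (h : ∀ i, Proj.awayι (polyGrading R ι) (X i) (X_mem_polyGrading i) one_pos ≫ f =
      Proj.awayι (polyGrading R ι) (X i) (X_mem_polyGrading i) one_pos ≫ g) : f = g := by
  let 𝒰 := Scheme.openCoverOfIsOpenCover _ (fun i => Proj.basicOpen (polyGrading R ι) (X i))
    iSup_basicOpen_X
  refine 𝒰.hom_ext _ _ fun i => ?_
  have := h i
  rw [← Proj.basicOpenIsoSpec_inv_ι, Category.assoc, Category.assoc, cancel_epi] at this
  exact this

/-- Each chart is integral and the generic point is dominant in it, so separatedness of `Y`
suffices. Identities between morphisms thereby become identities between vectors. -/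
theorem proj_hom_ext_generic [Nonempty ι] {Y : Scheme.{u}} [Y.IsSeparated]
    {f g : Proj (polyGrading R ι) ⟶ Y}
    (h : genericPoint R ι ≫ f = genericPoint R ι ≫ g) : f = g := by
  refine proj_hom_ext_X fun i => ?_
  have hh : IsUnit (eval₂ ((algebraMap (MvPolynomial ι R) (FractionRing (MvPolynomial ι R))).comp C)
      (fun i => algebraMap (MvPolynomial ι R) (FractionRing (MvPolynomial ι R)) (X i))
      (X i : MvPolynomial ι R)) := by
    rw [eval₂_X, isUnit_iff_ne_zero]
    simp [X_ne_zero]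
  rw [genericPoint, point_eq_awayPoint _ _ _ (X_mem_polyGrading i) one_pos hh, awayPoint,
    Category.assoc, Category.assoc] at h
  have := isDominant_specMap (awayEval_generic_injective i hh)
  have := away_isDomain (R := R) i
  exact ext_of_isDominant _ h

end Generic


/-! ### Factors of homogeneous polynomials -/

section Homogeneous

variable {R : Type*} [CommRing R] {ι : Type*}

/-- The substitution `x_i ↦ t x_i`. -/
def scaleVars (R : Type*) [CommRing R] (ι : Type*) :
    MvPolynomial ι R →+* Polynomial (MvPolynomial ι R) :=
  eval₂Hom (Polynomial.C.comp C) (fun i => Polynomial.C (X i) * Polynomial.X)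

theorem scaleVars_of_isHomogeneous {p : MvPolynomial ι R} {n : ℕ} (hp : p.IsHomogeneous n) :
    scaleVars R ι p = Polynomial.C p * Polynomial.X ^ n := by
  conv_lhs => rw [p.as_sum]
  conv_rhs => rw [p.as_sum]
  rw [map_sum, map_sum, Finset.sum_mul]
  refine Finset.sum_congr rfl fun d hd => ?_
  have h1 : ∑ i ∈ d.support, d i = n := by
    have := hp (mem_support_iff.mp hd)
    rw [Finsupp.weight_apply, Finsupp.sum] at this
    rw [← this]
    exact Finset.sum_congr rfl fun i _ => by simp
  rw [scaleVars, coe_eval₂Hom, eval₂_monomial, monomial_eq, Finsupp.prod, Finsupp.prod]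
  simp only [mul_pow, Finset.prod_mul_distrib, Finset.prod_pow_eq_pow_sum, h1, map_mul, map_prod,
    map_pow, RingHom.comp_apply, mul_assoc]

theorem coeff_scaleVars (p : MvPolynomial ι R) (n : ℕ) :
    (scaleVars R ι p).coeff n = homogeneousComponent n p := by
  conv_lhs => rw [← sum_homogeneousComponent p]
  rw [map_sum, Polynomial.finsetSum_coeff]
  have : ∀ i, (scaleVars R ι (homogeneousComponent i p)).coeff n =
      if n = i then homogeneousComponent i p else 0 := fun i => by
    rw [scaleVars_of_isHomogeneous (homogeneousComponent_isHomogeneous i p),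
      Polynomial.coeff_C_mul_X_pow]
  simp only [this, Finset.sum_ite_eq, Finset.mem_range]
  split_ifs with h
  · rfl
  · exact (homogeneousComponent_eq_zero _ _ (by omega)).symm

theorem scaleVars_ne_zero {p : MvPolynomial ι R} (hp : p ≠ 0) : scaleVars R ι p ≠ 0 := by
  intro h
  apply hp
  rw [← sum_homogeneousComponent p]
  refine Finset.sum_eq_zero fun i _ => ?_
  rw [← coeff_scaleVars, h, Polynomial.coeff_zero]

/-- Substituting `x ↦ t x` turns homogeneity into being a monomial in `t`. Over a domain the top and
bottom degrees in `t` add under products, so the factors of a monomial are monomials. -/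
theorem exists_isHomogeneous_of_mul [IsDomain R] {p q : MvPolynomial ι R} {n : ℕ}
    (h : (p * q).IsHomogeneous n) (h0 : p * q ≠ 0) : ∃ a, p.IsHomogeneous a := by
  have hp := scaleVars_ne_zero (left_ne_zero_of_mul h0)
  have hq := scaleVars_ne_zero (right_ne_zero_of_mul h0)
  have h1 := scaleVars_of_isHomogeneous h
  rw [map_mul] at h1
  have h2 := congrArg Polynomial.natDegree h1
  have h3 := congrArg Polynomial.natTrailingDegree h1
  rw [Polynomial.natDegree_mul hp hq, Polynomial.natDegree_C_mul_X_pow _ _ h0] at h2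
  rw [Polynomial.natTrailingDegree_mul hp hq, Polynomial.C_mul_X_pow_eq_monomial,
    Polynomial.natTrailingDegree_monomial h0] at h3
  have h4 := (scaleVars R ι p).natTrailingDegree_le_natDegree
  have h5 := (scaleVars R ι q).natTrailingDegree_le_natDegree
  have h6 : (scaleVars R ι p).natTrailingDegree = (scaleVars R ι p).natDegree := by omega
  obtain ⟨m, hm⟩ : ∃ m, m = (scaleVars R ι p).natDegree := ⟨_, rfl⟩
  refine ⟨m, ?_⟩
  rw [← sum_homogeneousComponent p]
  refine IsHomogeneous.sum _ _ _ fun i _ => ?_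
  rcases eq_or_ne i m with rfl | hi
  · exact homogeneousComponent_isHomogeneous _ p
  · rw [← coeff_scaleVars]
    have : (scaleVars R ι p).coeff i = 0 := by
      rcases lt_or_gt_of_ne hi with h | h
      · exact Polynomial.coeff_eq_zero_of_lt_natTrailingDegree (by omega)
      · exact Polynomial.coeff_eq_zero_of_natDegree_lt (by omega)
    rw [this]
    exact isHomogeneous_zero _ _ _

theorem eq_sum_of_isHomogeneous_one [Fintype ι] {p : MvPolynomial ι R} (hp : p.IsHomogeneous 1) :
    p = ∑ j, C (coeff (Finsupp.single j 1) p) * X j := by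
  classical
  ext d
  rw [coeff_sum]
  simp only [coeff_C_mul, coeff_X]
  by_cases hd : ∃ j, Finsupp.single j 1 = d
  · obtain ⟨j, rfl⟩ := hd
    rw [Finset.sum_eq_single j]
    · simp
    · intro l _ hl
      rw [if_neg, mul_zero]
      intro h
      exact hl ((Finsupp.single_left_inj one_ne_zero).mp h)
    · simp
  · rw [Finset.sum_eq_zero]
    · by_contra h
      have h1 := hp h
      rw [Finsupp.weight_apply, Finsupp.sum] at h1
      apply hd
      have h2 : d.degree = 1 := by
        rw [← h1, Finsupp.degree]
        exact Finset.sum_congr rfl fun i _ => by simp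
      have h3 : d ≠ 0 := by
        rintro rfl
        simp at h2
      obtain ⟨j, hj⟩ := Finsupp.ne_iff.mp h3
      obtain ⟨e, he⟩ := exists_add_of_le (Finsupp.single_le_iff.mpr (Nat.one_le_iff_ne_zero.mpr hj))
      rw [he, map_add, Finsupp.degree_single, Nat.add_eq_left, Finsupp.degree_eq_zero_iff] at h2
      exact ⟨j, by rw [he, h2, add_zero]⟩
    · intro j _
      rw [if_neg fun h => hd ⟨j, h⟩, mul_zero]

end Homogeneous

/-! ### Coprime tuples in a factorial ring -/

section Coprime

variable {A : Type*} [CommRing A] [IsDomain A] [UniqueFactorizationMonoid A] {ι : Type*}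
  [Fintype ι]

theorem exists_coprime_tuple (N : ι → A) (hN : N ≠ 0) :
    ∃ (g : A) (F : ι → A), (∀ j, N j = g * F j) ∧ ∀ q, (∀ j, q ∣ F j) → IsUnit q := by
  obtain ⟨_⟩ : Nonempty (NormalizedGCDMonoid A) := inferInstance
  obtain ⟨i, hi⟩ := Function.ne_iff.mp hN
  obtain ⟨F, h1, h2⟩ := Finset.extract_gcd (s := Finset.univ) N ⟨i, Finset.mem_univ i⟩
  refine ⟨_, F, fun j => h1 j (Finset.mem_univ j), fun q hq => ?_⟩
  rw [isUnit_iff_dvd_one, ← h2]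
  exact Finset.dvd_gcd fun j _ => hq j

/-- `F i` divides every `F j * N i = N j * F i`, hence their gcd, which is `N i` up to a unit. The
proportionality factor is thus a ring element and not just a fraction. -/
theorem exists_eq_mul_of_coprime_tuple {F N : ι → A} (hF : ∀ q, (∀ j, q ∣ F j) → IsUnit q)
    (h : ∀ i j, N i * F j = N j * F i) : ∃ u, ∀ j, N j = u * F j := by
  obtain ⟨_⟩ : Nonempty (NormalizedGCDMonoid A) := inferInstance
  have h0 : ∃ i, F i ≠ 0 := by
    by_contra! h0
    exact not_isUnit_zero (hF 0 fun j => by rw [h0 j])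
  obtain ⟨i, hi⟩ := h0
  have h1 : F i ∣ Finset.univ.gcd (fun j => F j * N i) :=
    Finset.dvd_gcd fun j _ => ⟨N j, by rw [mul_comm, h, mul_comm]⟩
  rw [(Finset.gcd_mul_right' _ F (N i)).dvd_iff_dvd_right] at h1
  have h2 : IsUnit (Finset.univ.gcd F) := hF _ fun j => Finset.gcd_dvd (Finset.mem_univ j)
  rw [h2.dvd_mul_left] at h1
  obtain ⟨u, hu⟩ := h1
  refine ⟨u, fun j => mul_right_cancel₀ hi ?_⟩
  rw [h, hu]
  ring

theorem isUnit_of_dvd_X {L : Type*} [Field L] {ι : Type*} [Nontrivial ι] (q : MvPolynomial ι L)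
    (hq : ∀ j, q ∣ X j) : IsUnit q := by
  obtain ⟨i, j, hij⟩ := exists_pair_ne ι
  by_contra hu
  have h1 := ((X_prime (R := L) (i := i)).irreducible.dvd_iff.mp (hq i)).resolve_left hu
    |>.dvd.trans (hq j)
  rw [X_dvd_X] at h1
  exact hij h1

end Coprime


/-! ### Automorphisms of projective space are linear -/

section Endomorphisms

variable {L : Type u} [Field L] {ι : Type}

theorem genericPoint_mem_basicOpen [Nonempty ι] {h : MvPolynomial ι L} {d : ℕ}
    (hd : h ∈ polyGrading L ι d) (h0 : 0 < d) (x)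
    (hx : genericPoint L ι x ∈ Proj.basicOpen (polyGrading L ι) h) : h ≠ 0 := by
  rw [genericPoint, point_mem_basicOpen _ _ _ hd h0, eval₂_algebraMap_X] at hx
  rintro rfl
  exact hx (map_zero _)

theorem eval₂_comp_bind₁ {B : Type*} [CommRing B] (φ : MvPolynomial ι L →+* B)
    (F : ι → MvPolynomial ι L) (G : MvPolynomial ι L) :
    eval₂ (φ.comp C) (fun j => φ (F j)) G = φ (bind₁ F G) := by
  have : φ.comp (bind₁ F : MvPolynomial ι L →ₐ[L] MvPolynomial ι L).toRingHom =
      eval₂Hom (φ.comp C) (fun j => φ (F j)) := by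
    apply MvPolynomial.ringHom_ext <;> simp
  exact (congrArg (fun ψ => ψ G) this).symm

variable [Fintype ι]

/-- At the generic point the map is given by a tuple `N`; dividing out the gcd leaves `F`. Any other
local tuple `N'` is generically proportional to `F`, hence `u * F` with `u` a polynomial. Where `N'`
does not vanish, neither does `F`, so `F` describes the map at every point. -/
theorem exists_global_form [Nonempty ι] (f : Proj (polyGrading L ι) ⟶ Proj (polyGrading L ι))
    (hf : f ≫ projStr L ι = projStr L ι) :
    ∃ (F : ι → MvPolynomial ι L) (e : ℕ), (∀ j, (F j).IsHomogeneous e) ∧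
      ∀ (K : Type u) [Field K] (w : L →+* K) (v : ι → K) (hv : v ≠ 0),
        ∃ hF : (fun j => eval₂ w v (F j)) ≠ 0, point w v hv ≫ f = point w _ hF := by
  have generic : ∀ p : Proj (polyGrading L ι),
      ∃ (N : ι → MvPolynomial ι L) (e : ℕ) (h : MvPolynomial ι L) (d : ℕ),
      h ∈ polyGrading L ι d ∧ 0 < d ∧ p ∈ Proj.basicOpen (polyGrading L ι) h ∧
      (∀ j, (N j).IsHomogeneous e) ∧ (h ≠ 0 → ∃ hN, genericPoint L ι ≫ f =
        point ((algebraMap (MvPolynomial ι L) (FractionRing (MvPolynomial ι L))).comp C)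
          (fun j => algebraMap (MvPolynomial ι L) (FractionRing (MvPolynomial ι L)) (N j)) hN) ∧
      ∀ (K : Type u) [Field K] (w : L →+* K) (v : ι → K) (hv : v ≠ 0), eval₂ w v h ≠ 0 →
        ∃ hN : (fun j => eval₂ w v (N j)) ≠ 0, point w v hv ≫ f = point w _ hN := by
    intro p
    obtain ⟨N, e, h, d, hd, h0, hp, hN, H⟩ := exists_local_form f hf p
    refine ⟨N, e, h, d, hd, h0, hp, hN, fun hh => ?_, H⟩
    have := H _ ((algebraMap (MvPolynomial ι L) (FractionRing (MvPolynomial ι L))).comp C)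
      (fun i => algebraMap (MvPolynomial ι L) (FractionRing (MvPolynomial ι L)) (X i))
      X_ne_zero_vec (by
        rw [eval₂_algebraMap_X]
        exact (FaithfulSMul.algebraMap_eq_zero_iff _ _).not.mpr hh)
    simp only [eval₂_algebraMap_X] at this
    exact this
  let x₀ : Spec (CommRingCat.of (FractionRing (MvPolynomial ι L))) :=
    (⊥ : PrimeSpectrum (FractionRing (MvPolynomial ι L)))
  obtain ⟨N, e, h, d, hd, h0, hp, hN, H, -⟩ := generic (genericPoint L ι x₀)
  obtain ⟨hN0, HN⟩ := H (genericPoint_mem_basicOpen hd h0 _ hp)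
  obtain ⟨i, hi⟩ := Function.ne_iff.mp hN0
  have hNi : N i ≠ 0 := fun h => hi (by simp [h])
  obtain ⟨g, F, hgF, hF⟩ := exists_coprime_tuple N fun h => hNi (congrFun h i)
  have hg0 : g ≠ 0 := by
    rintro rfl
    exact hNi (by rw [hgF, zero_mul])
  obtain ⟨a, ha⟩ := exists_isHomogeneous_of_mul (hgF i ▸ hN i) (hgF i ▸ hNi)
  have hFh : ∀ j, (F j).IsHomogeneous (e - a) := by
    intro j
    rcases eq_or_ne (F j) 0 with h1 | h1
    · rw [h1]
      exact isHomogeneous_zero _ _ _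
    · have h2 : (F j * g).IsHomogeneous e := by
        rw [mul_comm]
        exact hgF j ▸ hN j
      obtain ⟨b, hb⟩ := exists_isHomogeneous_of_mul h2 (mul_ne_zero h1 hg0)
      have h3 := (hb.mul ha).inj_right h2 (mul_ne_zero h1 hg0)
      rwa [← h3, Nat.add_sub_cancel]
  refine ⟨F, e - a, hFh, fun K _ w v hv => ?_⟩
  let x : Spec (CommRingCat.of K) := (⊥ : PrimeSpectrum K)
  obtain ⟨N', e', h', d', hd', h0', hp', hN', H', HK⟩ := generic (point w v hv x)
  rw [point_mem_basicOpen w v hv hd' h0'] at hp'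
  obtain ⟨hN1, HN1⟩ := H' (by rintro rfl; exact hp' (eval₂_zero _ _))
  obtain ⟨c, hc⟩ := exists_smul_eq_of_point_eq _ _ _ (HN.symm.trans HN1)
  obtain ⟨u, hu⟩ := exists_eq_mul_of_coprime_tuple (N := N') hF fun i j => by
    apply mul_left_cancel₀ hg0
    apply IsFractionRing.injective (MvPolynomial ι L) (FractionRing (MvPolynomial ι L))
    have h1 := congrFun hc i
    have h2 := congrFun hc j
    simp only [Pi.smul_apply, smul_eq_mul, hgF, map_mul] at h1 h2
    rw [map_mul, map_mul, map_mul, map_mul, h1, h2]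
    ring
  obtain ⟨hN2, HN2⟩ := HK K w v hv hp'
  have h3 : (fun j => eval₂ w v (N' j)) = eval₂ w v u • fun j => eval₂ w v (F j) := by
    funext j
    rw [hu, eval₂_mul]
    rfl
  have hF0 : (fun j => eval₂ w v (F j)) ≠ 0 := by
    intro h4
    rw [h3, h4, smul_zero] at hN2
    exact hN2 rfl
  have h5 : eval₂ w v u • (fun j => eval₂ w v (F j)) ≠ 0 := h3 ▸ hN2
  refine ⟨hF0, HN2.trans ?_⟩
  rw [← point_smul w _ hF0 (eval₂ w v u) h5]
  congr 1

/-- Generically `G ∘ F` is proportional to the tuple of variables, so it is `H` times that tuple for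
a polynomial `H`. Were `H` not constant, it would have an irreducible factor `q`, and `G ∘ F` would
vanish at the vector of variables over the fraction field of the quotient by `q`, although it
vanishes at no nonzero vector. -/
theorem exists_eq_mul_X_of_comp_eq_id [Nontrivial ι]
    {f g : Proj (polyGrading L ι) ⟶ Proj (polyGrading L ι)} (hfg : f ≫ g = 𝟙 _)
    {F G : ι → MvPolynomial ι L}
    (hF : ∀ (K : Type u) [Field K] (w : L →+* K) (v : ι → K) (hv : v ≠ 0),
        ∃ hF : (fun j => eval₂ w v (F j)) ≠ 0, point w v hv ≫ f = point w _ hF)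
    (hG : ∀ (K : Type u) [Field K] (w : L →+* K) (v : ι → K) (hv : v ≠ 0),
        ∃ hG : (fun j => eval₂ w v (G j)) ≠ 0, point w v hv ≫ g = point w _ hG) :
    ∃ c : L, c ≠ 0 ∧ ∀ j, bind₁ F (G j) = C c * X j := by
  obtain ⟨hF0, HF⟩ := hF _
    ((algebraMap (MvPolynomial ι L) (FractionRing (MvPolynomial ι L))).comp C) _ X_ne_zero_vec
  obtain ⟨hG0, HG⟩ := hG _ _ _ hF0
  have h1 := (congrArg (· ≫ g) HF).trans HG
  simp only [Category.assoc, hfg, Category.comp_id] at h1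
  obtain ⟨c, hc⟩ := exists_smul_eq_of_point_eq _ _ _ h1
  simp only [eval₂_algebraMap_X, eval₂_comp_bind₁] at hc
  obtain ⟨H, hH⟩ := exists_eq_mul_of_coprime_tuple (N := fun j => bind₁ F (G j))
    (isUnit_of_dvd_X (L := L)) fun i j => by
      apply IsFractionRing.injective (MvPolynomial ι L) (FractionRing (MvPolynomial ι L))
      have h2 := congrFun hc i
      have h3 := congrFun hc j
      simp only [Pi.smul_apply, smul_eq_mul] at h2 h3
      rw [map_mul, map_mul, h2, h3]
      ring
  have hu : IsUnit H := by
    by_contra hu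
    have hH0 : H ≠ 0 := by
      rintro rfl
      apply hG0
      funext j
      simp only [eval₂_algebraMap_X, eval₂_comp_bind₁, hH, zero_mul, map_zero, Pi.zero_apply]
    obtain ⟨q, hq, hqH⟩ := WfDvdMonoid.exists_irreducible_factor hu hH0
    have hprime : (Ideal.span {q}).IsPrime :=
      (Ideal.span_singleton_prime hq.ne_zero).mpr hq.prime
    let φ : MvPolynomial ι L →+* FractionRing (MvPolynomial ι L ⧸ Ideal.span {q}) :=
      (algebraMap _ _).comp (Ideal.Quotient.mk (Ideal.span {q}))
    have hφ : ∀ p, φ p = 0 ↔ q ∣ p := fun p => by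
      rw [RingHom.comp_apply, FaithfulSMul.algebraMap_eq_zero_iff, Ideal.Quotient.eq_zero_iff_mem,
        Ideal.mem_span_singleton]
    have hX : (fun i => φ (X i)) ≠ 0 := fun h =>
      hq.not_isUnit (isUnit_of_dvd_X q fun j => (hφ _).mp (congrFun h j))
    obtain ⟨hF1, -⟩ := hF _ (φ.comp C) _ hX
    obtain ⟨hG1, -⟩ := hG _ (φ.comp C) _ hF1
    apply hG1
    funext j
    simp only [eval₂_algebraMap_X, eval₂_comp_bind₁, hH, map_mul, (hφ H).mpr hqH, zero_mul,
      Pi.zero_apply]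
  rw [isUnit_iff_eq_C_of_isReduced] at hu
  obtain ⟨c, hc, rfl⟩ := hu
  exact ⟨c, hc.ne_zero, hH⟩

theorem eval₂_linearSubst {K : Type*} [Field K] (w : L →+* K) (v : ι → K) (A : Matrix ι ι L)
    (p : MvPolynomial ι L) :
    eval₂ w v (linearSubst A p) = eval₂ w ((A.map w).mulVec v) p := by
  have : (eval₂Hom w v).comp (linearSubst A).toRingHom = eval₂Hom w ((A.map w).mulVec v) := by
    apply MvPolynomial.ringHom_ext
    · intro r
      simp [linearSubst]
    · intro i
      simp [linearSubst, Matrix.mulVec, dotProduct]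
  exact congrArg (fun ψ => ψ p) this

variable [DecidableEq ι]

theorem mulVec_map_ne_zero {K : Type*} [Field K] (w : L →+* K) {v : ι → K} (hv : v ≠ 0)
    (A : GL ι L) : ((A : Matrix ι ι L).map w).mulVec v ≠ 0 := by
  intro h
  apply hv
  have h1 : ((A⁻¹ : GL ι L) : Matrix ι ι L).map w * (A : Matrix ι ι L).map w = 1 := by
    rw [← Matrix.map_mul, ← Units.val_mul, inv_mul_cancel]
    simp
  rw [← Matrix.one_mulVec v, ← h1, ← Matrix.mulVec_mulVec, h, Matrix.mulVec_zero]

/-- The linear automorphism `[v] ↦ [A v]` as an endomorphism of `Proj`. -/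
def projLin (A : GL ι L) : Proj (polyGrading L ι) ⟶ Proj (polyGrading L ι) := matrixMap A

theorem point_projLin {K : Type u} [Field K] (w : L →+* K) (v : ι → K) (hv : v ≠ 0)
    (A : GL ι L) : point w v hv ≫ projLin A = point w _ (mulVec_map_ne_zero w hv A) := by
  obtain ⟨i, hi⟩ := exists_isUnit_eval₂_X w (mulVec_map_ne_zero w hv A)
  have hi' : IsUnit (eval₂ w v (linearSubst (A : Matrix ι ι L) (X i))) := by
    rwa [eval₂_linearSubst]
  rw [point_eq_awayPoint w _ (mulVec_map_ne_zero w hv A) (X_mem_polyGrading i) one_pos hi,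
    ← awayPoint_comp_map (linearSubst (A : Matrix ι ι L)) _ w _ w v
      (eval₂_linearSubst w v _) (X_mem_polyGrading i) one_pos hi hi',
    point_eq_awayPoint w v hv (h := linearSubst (A : Matrix ι ι L) (X i))
      ((linearSubst (A : Matrix ι ι L)).2 (X_mem_polyGrading i)) one_pos hi']
  rfl

/-- Every automorphism of projective space over a field is linear. -/
theorem exists_eq_projLin [Nontrivial ι]
    (f g : Proj (polyGrading L ι) ⟶ Proj (polyGrading L ι)) (hfg : f ≫ g = 𝟙 _)
    (hf : f ≫ projStr L ι = projStr L ι) (hg : g ≫ projStr L ι = projStr L ι) :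
    ∃ A : GL ι L, f = projLin A := by
  obtain ⟨F, e, he, hF⟩ := exists_global_form f hf
  obtain ⟨G, e', he', hG⟩ := exists_global_form g hg
  obtain ⟨c, hc, hFG⟩ := exists_eq_mul_X_of_comp_eq_id hfg hF hG
  -- `G ∘ F` has degree `e * e'` and equals `c` times the variables, so `e * e' = 1`.
  obtain rfl : e = 1 := by
    have i : ι := Classical.arbitrary ι
    have h1 : (bind₁ F (G i)).IsHomogeneous (e * e') := (he' i).aeval F he
    rw [hFG] at h1
    have h2 : (C c * X i : MvPolynomial ι L).IsHomogeneous (0 + 1) :=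
      (isHomogeneous_C ι c).mul (isHomogeneous_X L i)
    exact Nat.eq_one_of_mul_eq_one_right
      (h1.inj_right h2 (mul_ne_zero (C_ne_zero.mpr hc) (X_ne_zero i)))
  let A : Matrix ι ι L := fun i j => coeff (Finsupp.single j 1) (F i)
  have hA : ∀ i, F i = linearSubst A (X i) := fun i => by
    rw [linearSubst_apply, aeval_X]
    exact eq_sum_of_isHomogeneous_one (he i)
  have hAF : ∀ {K : Type u} [Field K] (w : L →+* K) (v : ι → K),
      (fun j => eval₂ w v (F j)) = (A.map w).mulVec v := fun w v => by
    funext i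
    rw [hA, eval₂_linearSubst, eval₂_X]
  -- A nonzero kernel vector would be a point at which all the `F j` vanish.
  have hAu : IsUnit A := by
    rw [← Matrix.mulVec_injective_iff_isUnit]
    refine (injective_iff_map_eq_zero A.mulVecLin).mpr fun v hv => ?_
    by_contra hv0
    obtain ⟨h, -⟩ := hF L (RingHom.id L) v hv0
    rw [hAF] at h
    apply h
    simpa using hv
  refine ⟨hAu.unit, proj_hom_ext_generic ?_⟩
  obtain ⟨h1, h2⟩ := hF _
    ((algebraMap (MvPolynomial ι L) (FractionRing (MvPolynomial ι L))).comp C) _ X_ne_zero_vec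
  rw [genericPoint, point_projLin]
  refine h2.trans ?_
  congr 1
  exact hAF _ _

theorem projLin_comp [Nonempty ι] (A B : GL ι L) :
    projLin A ≫ projLin B = projLin (B * A) := by
  refine proj_hom_ext_generic ?_
  rw [genericPoint]
  refine (Category.assoc _ _ _).symm.trans ?_
  rw [point_projLin, point_projLin, point_projLin]
  congr 1
  rw [Matrix.mulVec_mulVec, Units.val_mul, Matrix.map_mul]

theorem projLin_one [Nonempty ι] : projLin (1 : GL ι L) = 𝟙 _ := by
  refine proj_hom_ext_generic ?_
  rw [genericPoint, point_projLin]
  refine Eq.trans ?_ (Category.comp_id _).symm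
  congr 1
  simp

theorem projLin_projStr [Nonempty ι] (A : GL ι L) : projLin A ≫ projStr L ι = projStr L ι := by
  refine proj_hom_ext_generic ?_
  rw [genericPoint, ← Category.assoc, point_projLin, point_projStr, point_projStr]

theorem projLin_eq_of_eq_smul [Nonempty ι] {A B : GL ι L} {c : L}
    (h : (B : Matrix ι ι L) = c • (A : Matrix ι ι L)) : projLin B = projLin A := by
  refine proj_hom_ext_generic ?_
  rw [genericPoint, point_projLin, point_projLin]
  have h1 : ∀ {K : Type u} [Field K] (w : L →+* K) (v : ι → K),
      ((B : Matrix ι ι L).map w).mulVec v = w c • ((A : Matrix ι ι L).map w).mulVec v :=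
    fun w v => by
      rw [h, Matrix.map_smul' _ _ _ (map_mul w), Matrix.smul_mulVec]
  have h2 := mulVec_map_ne_zero
    ((algebraMap (MvPolynomial ι L) (FractionRing (MvPolynomial ι L))).comp C) X_ne_zero_vec B
  rw [h1] at h2
  rw [← point_smul _ _ (mulVec_map_ne_zero _ X_ne_zero_vec A) _ h2]
  congr 1
  exact h1 _ _

/-- Evaluated at `L`-points, the equality makes every nonzero vector an eigenvector of `B * A⁻¹`,
and such a matrix is scalar. -/
theorem exists_eq_smul_of_projLin_eq [Nonempty ι] {A B : GL ι L}
    (h : projLin A = projLin B) : ∃ c : L, (B : Matrix ι ι L) = c • (A : Matrix ι ι L) := by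
  have key : ∀ v : ι → L, ∃ c : L, ((B * A⁻¹ : GL ι L) : Matrix ι ι L).mulVec v = c • v := by
    intro v
    rcases eq_or_ne v 0 with rfl | hv
    · exact ⟨0, by simp⟩
    have h1 := mulVec_map_ne_zero (RingHom.id L) hv A⁻¹
    have h2 := congrArg (point (RingHom.id L) _ h1 ≫ ·) h
    simp only [point_projLin] at h2
    obtain ⟨c, hc⟩ := exists_smul_eq_of_point_eq _ _ _ h2
    refine ⟨c, ?_⟩
    simp only [RingHom.coe_id, Matrix.map_id] at hc
    rw [Matrix.mulVec_mulVec, Matrix.mulVec_mulVec, ← Units.val_mul, ← Units.val_mul,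
      mul_inv_cancel, Units.val_one, Matrix.one_mulVec] at hc
    exact hc
  obtain ⟨c, hc⟩ := (Matrix.mulVecLin
      ((B * A⁻¹ : GL ι L) : Matrix ι ι L)).exists_eq_smul_id_of_forall_notLinearIndependent
    fun v => by
      obtain ⟨c, hc⟩ := key v
      rcases eq_or_ne v 0 with rfl | hv
      · simp [linearIndependent_fin2]
      · rw [LinearIndependent.pair_iff' hv]
        exact fun h => h c hc.symm
  refine ⟨c, ?_⟩
  have h1 : ((B * A⁻¹ : GL ι L) : Matrix ι ι L) = c • 1 := by
    apply Matrix.ext_of_mulVec_single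
    intro i
    rw [Matrix.smul_mulVec, Matrix.one_mulVec]
    exact congrArg (fun f => f (Pi.single i 1)) hc
  calc (B : Matrix ι ι L) = ((B * A⁻¹ * A : GL ι L) : Matrix ι ι L) := by
        rw [inv_mul_cancel_right]
    _ = _ := by rw [Units.val_mul, h1, smul_mul_assoc, one_mul]

end Endomorphisms

/-! ### Change of coefficients on projective space -/

section CoeffMap

variable {R S : Type u} [CommRing R] [CommRing S] {ι : Type}

/-- The action of a ring homomorphism on the coefficients of polynomials. -/
def coeffHom (ι : Type) (σ : R →+* S) : polyGrading R ι →+*ᵍ polyGrading S ι where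
  toRingHom := MvPolynomial.map σ
  map_mem := fun hp => IsHomogeneous.map hp σ

theorem irrelevant_le_span_X : (HomogeneousIdeal.irrelevant (polyGrading R ι)).toIdeal ≤
    Ideal.span (Set.range X) := by
  rw [HomogeneousIdeal.toIdeal_irrelevant_le]
  intro i hi x hx
  change x ∈ Ideal.span (Set.range X)
  rw [← Set.image_univ, mem_ideal_span_X_image]
  intro m hm
  by_contra! h
  have h1 : m = 0 := by
    ext j
    exact h j (Set.mem_univ j)
  have h2 := IsHomogeneous.coeff_eq_zero hx (d := m) (by
    rw [h1]
    simpa using hi.ne)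
  exact (mem_support_iff.mp hm) h2

theorem irrelevant_le_map_coeffHom (σ : R →+* S) :
    HomogeneousIdeal.irrelevant (polyGrading S ι) ≤
      (HomogeneousIdeal.irrelevant (polyGrading R ι)).map (coeffHom ι σ) := by
  change (HomogeneousIdeal.irrelevant (polyGrading S ι)).toIdeal ≤
    Ideal.map (coeffHom ι σ) (HomogeneousIdeal.irrelevant (polyGrading R ι)).toIdeal
  refine irrelevant_le_span_X.trans (Ideal.span_le.mpr ?_)
  rintro _ ⟨i, rfl⟩
  have h1 : (X i : MvPolynomial ι R) ∈ (HomogeneousIdeal.irrelevant (polyGrading R ι)).toIdeal :=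
    HomogeneousIdeal.mem_irrelevant_of_mem _ one_pos (X_mem_polyGrading i)
  have h2 := Ideal.mem_map_of_mem (coeffHom ι σ) h1
  have h3 : coeffHom ι σ (X i) = X i := map_X σ i
  rwa [h3] at h2

/-- The morphism of projective spaces induced by a homomorphism of the base rings. -/
def projBase (ι : Type) (σ : R →+* S) : Proj (polyGrading S ι) ⟶ Proj (polyGrading R ι) :=
  Proj.map (coeffHom ι σ) (irrelevant_le_map_coeffHom σ)

theorem point_projBase {K : Type u} [Field K] (σ : R →+* S) (w : S →+* K) (v : ι → K)
    (hv : v ≠ 0) : point w v hv ≫ projBase ι σ = point (w.comp σ) v hv := by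
  obtain ⟨i, hi⟩ := exists_isUnit_eval₂_X (w.comp σ) hv
  have h : ∀ p, eval₂ w v (coeffHom ι σ p) = eval₂ (w.comp σ) v p := fun p => eval₂_map σ v w p
  have hi' : IsUnit (eval₂ w v (coeffHom ι σ (X i))) := by rwa [h]
  rw [point_eq_awayPoint w v hv (h := coeffHom ι σ (X i))
      ((coeffHom ι σ).2 (X_mem_polyGrading i)) one_pos hi', projBase,
    awayPoint_comp_map (coeffHom ι σ) _ (w.comp σ) v w v h (X_mem_polyGrading i) one_pos hi hi']
  exact (point_eq_awayPoint ..).symm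

end CoeffMap


/-! ### Projective space commutes with base change -/

section BaseChange

open HomogeneousLocalization Limits

variable {R S : Type u} [CommRing R] [CommRing S] {ι : Type}

theorem isUnit_eval₂_awayX {T : Type u} [CommRing T] (w : R →+* T) {v : ι → T} {i : ι}
    (h : v i = 1) : IsUnit (eval₂ w v (X i)) := by
  rw [eval₂_X, h]
  exact isUnit_one

/-- Extension of scalars for the coordinate ring of a standard chart. -/
def awayBase (σ : R →+* S) (i : ι) :
    Away (polyGrading R ι) (X i) →+* Away (polyGrading S ι) (X i) :=
  awayEval ((awayC (X i)).comp σ) (awayX i) (X i) (isUnit_eval₂_awayX _ (awayX_self i))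

theorem awayBase_comp_awayC (σ : R →+* S) (i : ι) :
    (awayBase σ i).comp (awayC (X i)) = (awayC (X i)).comp σ :=
  awayEval_awayC ..

theorem awayEval_X_awayX {T : Type u} [CommRing T] (w : R →+* T) (v : ι → T) {i : ι}
    (h : v i = 1) (hh) (j : ι) : awayEval w v (X i) hh (awayX i j) = v j := by
  have := mul_awayEval_awayX w v i j hh
  rwa [h, one_mul] at this

theorem awayBase_awayX (σ : R →+* S) (i j : ι) : awayBase σ i (awayX i j) = awayX i j :=
  awayEval_X_awayX _ _ (awayX_self i) _ j

/-- A homomorphism out of a chart ring amounts to its restriction to the constants and the values of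
the ratios `x_j / x_i`. Extending the constants leaves the ratios untouched, which is the universal
property. -/
theorem isPushout_awayBase (σ : R →+* S) (i : ι) :
    IsPushout (CommRingCat.ofHom (awayC (X i : MvPolynomial ι R))) (CommRingCat.ofHom σ)
      (CommRingCat.ofHom (awayBase σ i)) (CommRingCat.ofHom (awayC (X i))) := by
  have w : CommRingCat.ofHom (awayC (X i : MvPolynomial ι R)) ≫ CommRingCat.ofHom (awayBase σ i) =
      CommRingCat.ofHom σ ≫ CommRingCat.ofHom (awayC (X i)) := by
    rw [← CommRingCat.ofHom_comp, ← CommRingCat.ofHom_comp, awayBase_comp_awayC]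
  have h1 : ∀ s : PushoutCocone (CommRingCat.ofHom (awayC (X i : MvPolynomial ι R)))
      (CommRingCat.ofHom σ), s.inl.hom (awayX i i) = 1 := fun s => by
    rw [awayX_self]
    exact map_one s.inl.hom
  refine ⟨⟨w⟩, ⟨PushoutCocone.IsColimit.mk w
    (fun s => CommRingCat.ofHom (awayEval s.inr.hom (fun j => s.inl.hom (awayX i j)) (X i)
      (isUnit_eval₂_awayX _ (h1 s)))) (fun s => ?_) (fun s => ?_) (fun s m hm hm' => ?_)⟩⟩
  · rw [← CommRingCat.ofHom_comp]
    ext1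
    apply away_ringHom_ext
    · rw [CommRingCat.hom_ofHom, RingHom.comp_assoc, awayBase_comp_awayC, ← RingHom.comp_assoc,
        awayEval_awayC]
      exact (congrArg CommRingCat.Hom.hom s.condition).symm
    · intro j
      rw [CommRingCat.hom_ofHom, RingHom.comp_apply, awayBase_awayX,
        awayEval_X_awayX _ _ (h1 s)]
  · rw [← CommRingCat.ofHom_comp, awayEval_awayC]
    rfl
  · ext1
    apply away_ringHom_ext
    · rw [CommRingCat.hom_ofHom, awayEval_awayC, ← hm']
      rfl
    · intro j
      rw [CommRingCat.hom_ofHom, awayEval_X_awayX _ _ (h1 s), ← hm]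
      exact congrArg m.hom (awayBase_awayX σ i j).symm

theorem awayι_eq_awayPoint (i : ι) :
    Proj.awayι (polyGrading R ι) (X i) (X_mem_polyGrading i) one_pos =
      awayPoint (awayC (X i)) (awayX i) (X_mem_polyGrading i) one_pos
        (isUnit_eval₂_awayX _ (awayX_self i)) := by
  obtain ⟨hh, h⟩ := eq_awayEval (RingHom.id (Away (polyGrading R ι) (X i))) (awayC (X i)) rfl
  have h' : awayEval (awayC (X i)) (awayX i) (X i) hh = RingHom.id _ := h.symm
  rw [awayPoint, h']
  exact (Category.id_comp _).symm.trans (congrArg (· ≫ _) (Spec.map_id _).symm)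

theorem awayι_projBase (σ : R →+* S) (i : ι) :
    Proj.awayι (polyGrading S ι) (X i) (X_mem_polyGrading i) one_pos ≫ projBase ι σ =
      Spec.map (CommRingCat.ofHom (awayBase σ i)) ≫
        Proj.awayι (polyGrading R ι) (X i) (X_mem_polyGrading i) one_pos := by
  have h : ∀ p, eval₂ (awayC (X i : MvPolynomial ι S)) (awayX i) (coeffHom ι σ p) =
      eval₂ ((awayC (X i : MvPolynomial ι S)).comp σ) (awayX i) p := fun p => eval₂_map σ _ _ p
  have hi := isUnit_eval₂_awayX ((awayC (X i : MvPolynomial ι S)).comp σ) (awayX_self i)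
  have hi' : IsUnit (eval₂ (awayC (X i : MvPolynomial ι S)) (awayX i) (coeffHom ι σ (X i))) := by
    rwa [h]
  rw [awayι_eq_awayPoint, awayPoint_eq_awayPoint _ _ _ _ _ (g := coeffHom ι σ (X i))
    ((coeffHom ι σ).2 (X_mem_polyGrading i)) one_pos hi', projBase,
    awayPoint_comp_map (coeffHom ι σ) _ _ _ _ _ h (X_mem_polyGrading i) one_pos hi hi']
  rfl

theorem projBase_projStr (σ : R →+* S) :
    projBase ι σ ≫ projStr R ι = projStr S ι ≫ Spec.map (CommRingCat.ofHom σ) := by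
  refine proj_hom_ext_X fun i => ?_
  rw [← Category.assoc, awayι_projBase, Category.assoc, awayι_projStr, ← Category.assoc,
    awayι_projStr, ← Spec.map_comp, ← Spec.map_comp, ← CommRingCat.ofHom_comp,
    ← CommRingCat.ofHom_comp, awayBase_comp_awayC]

/-- The standard affine cover of projective space. -/
def chartCover (R : Type u) [CommRing R] (ι : Type) : (Proj (polyGrading R ι)).OpenCover :=
  (Proj.affineOpenCoverOfIrrelevantLESpan (polyGrading R ι) X X_mem_polyGrading
    (fun _ => one_pos) irrelevant_le_span_X).openCover

/-- This is local on the target: the preimage of a standard chart is the chart with the same index,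
and there the square is the spectrum of a pushout of rings. -/
theorem isPullback_projBase (σ : R →+* S) :
    IsPullback (projBase ι σ) (projStr S ι) (projStr R ι) (Spec.map (CommRingCat.ofHom σ)) := by
  refine Scheme.isPullback_of_openCover _ _ _ _ (chartCover R ι) fun (i : ι) => ?_
  have h1 : IsPullback (Spec.map (CommRingCat.ofHom (awayBase σ i)))
      (Proj.awayι (polyGrading S ι) (X i) (X_mem_polyGrading i) one_pos)
      (Proj.awayι (polyGrading R ι) (X i) (X_mem_polyGrading i) one_pos) (projBase ι σ) := by
    refine IsOpenImmersion.isPullback _ _ _ _ (awayι_projBase σ i) ?_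
    rw [Proj.opensRange_awayι, Proj.opensRange_awayι, projBase, Proj.map_preimage_basicOpen]
    congr 1
    exact map_X σ i
  have h2 := isPullback_SpecMap_of_isPushout _ _ _ _ (isPushout_awayBase σ i)
  rw [← awayι_projStr (X_mem_polyGrading i) one_pos,
    ← awayι_projStr (X_mem_polyGrading i) one_pos] at h2
  refine h2.of_iso h1.flip.isoPullback (Iso.refl _) (Iso.refl _) (Iso.refl _) ?_ ?_ ?_ ?_
  · exact (Category.comp_id _).trans h1.flip.isoPullback_hom_snd.symm
  · refine (Category.comp_id _).trans ?_
    refine Eq.trans ?_ (Category.assoc _ _ _)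
    exact congrArg (· ≫ _) h1.flip.isoPullback_hom_fst.symm
  · exact (Category.comp_id _).trans (Category.id_comp _).symm
  · exact (Category.comp_id _).trans (Category.id_comp _).symm

end BaseChange


/-! ### Linear maps and the Galois action on projective space -/

section Relations

open Limits

variable {ι : Type} [Nonempty ι]

theorem projBase_comp {R S T : Type u} [CommRing R] [CommRing S] [CommRing T] [IsDomain T]
    (σ : R →+* S) (τ : S →+* T) : projBase ι τ ≫ projBase ι σ = projBase ι (τ.comp σ) := by
  refine proj_hom_ext_generic ?_
  rw [genericPoint, ← Category.assoc, point_projBase, point_projBase, point_projBase]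
  rfl

variable {k L M : Type u} [Field k] [Field L] [Field M] [Algebra k L]

theorem galoisProj_mul (g h : Gal(L/k)) :
    galoisProj ι (g * h) = galoisProj ι h ≫ galoisProj ι g := by
  refine Eq.trans ?_ (projBase_comp ((g⁻¹ : Gal(L/k)) : L →+* L)
    ((h⁻¹ : Gal(L/k)) : L →+* L)).symm
  refine congrArg (projBase ι) (RingHom.ext fun x => ?_)
  change (g * h)⁻¹ x = h⁻¹ (g⁻¹ x)
  rw [mul_inv_rev]
  rfl

theorem galoisProj_hom (g : Gal(L/k)) :
    galoisProj ι g ≫ (projSpace L ι).hom = (projSpace L ι).hom ≫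
      Spec.map (CommRingCat.ofHom ((g⁻¹ : Gal(L/k)) : L →+* L)) :=
  projBase_projStr _

variable [Fintype ι] [DecidableEq ι]

theorem projLin_projBase (σ : L →+* M) (A : GL ι L) :
    projLin (Matrix.GeneralLinearGroup.map σ A) ≫ projBase ι σ = projBase ι σ ≫ projLin A := by
  refine proj_hom_ext_generic ?_
  rw [genericPoint, ← Category.assoc, ← Category.assoc, point_projBase, point_projLin,
    point_projBase, point_projLin]
  rfl

theorem map_map_symm (g : Gal(L/k)) (A : GL ι L) :
    Matrix.GeneralLinearGroup.map ((g⁻¹ : Gal(L/k)) : L →+* L)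
      (Matrix.GeneralLinearGroup.map (g : L →+* L) A) = A := by
  ext i j
  exact g.symm_apply_apply _

/-- As `galoisProj` acts on coefficients by `g⁻¹`, the general relation is applied to `g⁻¹` and the
matrix `A^g`. The resulting rule `g ∘ [A] = [A^g] ∘ g` drives all the cocycle computations. -/
theorem matrixMap_galoisProj (g : Gal(L/k)) (A : GL ι L) :
    matrixMap A ≫ galoisProj ι g =
      galoisProj ι g ≫ matrixMap (Matrix.GeneralLinearGroup.map (g : L →+* L) A) := by
  have h := projLin_projBase ((g⁻¹ : Gal(L/k)) : L →+* L)
    (Matrix.GeneralLinearGroup.map (g : L →+* L) A)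
  rw [map_map_symm] at h
  exact h

theorem matrixMap_mul (A B : GL ι L) : matrixMap B ≫ matrixMap A = matrixMap (A * B) :=
  projLin_comp B A

theorem matrixMap_one : matrixMap (1 : GL ι L) = 𝟙 _ := projLin_one

theorem matrixMap_hom (A : GL ι L) : matrixMap A ≫ (projSpace L ι).hom = (projSpace L ι).hom :=
  projLin_projStr A

theorem matrixMap_eq_iff {A B : GL ι L} :
    matrixMap A = matrixMap B ↔ ∃ c : L, (B : Matrix ι ι L) = c • (A : Matrix ι ι L) :=
  ⟨exists_eq_smul_of_projLin_eq, fun ⟨_, h⟩ => (projLin_eq_of_eq_smul h).symm⟩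

theorem exists_eq_matrixMap [Nontrivial ι] (f g : (projSpace L ι).left ⟶ (projSpace L ι).left)
    (hfg : f ≫ g = 𝟙 _) (hf : f ≫ (projSpace L ι).hom = (projSpace L ι).hom)
    (hg : g ≫ (projSpace L ι).hom = (projSpace L ι).hom) : ∃ A, f = matrixMap A :=
  exists_eq_projLin f g hfg hf hg

end Relations

/-! ### The Galois action on a base change -/

section GaloisAct

open Limits

variable {k L : Type u} [Field k] [Field L] [Algebra k L]

theorem galoisAct_fst (X : Over (SpecOf k)) (g : Gal(L/k)) :
    galoisAct X g ≫ pullback.fst X.hom (specMap k L) = pullback.fst X.hom (specMap k L) :=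
  pullback.lift_fst ..

theorem galoisAct_snd (X : Over (SpecOf k)) (g : Gal(L/k)) :
    galoisAct X g ≫ pullback.snd X.hom (specMap k L) = pullback.snd X.hom (specMap k L) ≫
      Spec.map (CommRingCat.ofHom ((g⁻¹ : Gal(L/k)) : L →+* L)) :=
  pullback.lift_snd ..

theorem galoisAct_mul (X : Over (SpecOf k)) (g h : Gal(L/k)) :
    galoisAct X (g * h) = galoisAct X h ≫ galoisAct X g := by
  apply pullback.hom_ext
  · refine (galoisAct_fst X _).trans ?_
    refine Eq.trans ?_ (Category.assoc _ _ _).symm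
    rw [galoisAct_fst]
    exact (galoisAct_fst X _).symm
  · refine (galoisAct_snd X _).trans ?_
    refine Eq.trans ?_ (Category.assoc _ _ _).symm
    rw [galoisAct_snd]
    refine Eq.trans ?_ (Category.assoc _ _ _)
    refine Eq.trans ?_ (congrArg (· ≫ _) (galoisAct_snd X h).symm)
    refine Eq.trans ?_ (Category.assoc _ _ _).symm
    rw [← Spec.map_comp, ← CommRingCat.ofHom_comp, mul_inv_rev]
    rfl

theorem galoisAct_one (X : Over (SpecOf k)) : galoisAct X (1 : Gal(L/k)) = 𝟙 _ := by
  apply pullback.hom_ext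
  · exact (galoisAct_fst X _).trans (Category.id_comp _).symm
  · refine (galoisAct_snd X _).trans (Eq.trans ?_ (Category.id_comp _).symm)
    refine Eq.trans ?_ (Category.comp_id _)
    congr 1
    rw [inv_one]
    exact Spec.map_id _

theorem baseChange_map_fst {X Y : Over (SpecOf k)} (f : X ⟶ Y) :
    ((baseChange k L).map f).left ≫ pullback.fst Y.hom (specMap k L) =
      pullback.fst X.hom (specMap k L) ≫ f.left :=
  pullback.lift_fst ..

theorem baseChange_map_galoisAct {X Y : Over (SpecOf k)} (f : X ⟶ Y) (g : Gal(L/k)) :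
    ((baseChange k L).map f).left ≫ galoisAct Y g =
      galoisAct X g ≫ ((baseChange k L).map f).left := by
  apply pullback.hom_ext
  · refine (Category.assoc _ _ _).trans ?_
    rw [galoisAct_fst]
    refine (baseChange_map_fst f).trans (Eq.trans ?_ (Category.assoc _ _ _).symm)
    rw [baseChange_map_fst, ← Category.assoc, galoisAct_fst]
  · refine (Category.assoc _ _ _).trans ?_
    rw [galoisAct_snd]
    have h : ((baseChange k L).map f).left ≫ pullback.snd Y.hom (specMap k L) =
      pullback.snd X.hom (specMap k L) := Over.w ((baseChange k L).map f)
    refine Eq.trans ?_ (Category.assoc _ _ _).symm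
    rw [h, galoisAct_snd, ← Category.assoc, h]

end GaloisAct


/-! ### Galois descent for morphisms -/

section Descent

open Limits TensorProduct

variable {k L : Type u} [Field k] [Field L] [Algebra k L]

variable (k L) in
/-- The homomorphism `x ⊗ y ↦ (x * g y)_g` from `L ⊗ L` to a product of copies of `L`. -/
def tensorToPi : L ⊗[k] L →ₐ[L] (Gal(L/k) → L) :=
  Algebra.TensorProduct.lift (Algebra.ofId L _)
    (AlgHom.pi fun g : Gal(L/k) => (g : L →ₐ[k] L)) fun _ _ => mul_comm _ _

theorem tensorToPi_tmul (x y : L) (g : Gal(L/k)) : tensorToPi k L (x ⊗ₜ y) g = x * g y := rfl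

/-- A functional that kills the image is a linear relation between the elements of the Galois group,
hence zero by independence of characters. Injectivity follows by comparing dimensions. -/
theorem bijective_tensorToPi [FiniteDimensional k L] [IsGalois k L] :
    Function.Bijective (tensorToPi k L) := by
  classical
  have hs : Function.Surjective (tensorToPi k L).toLinearMap := by
    rw [← LinearMap.range_eq_top]
    by_contra h
    obtain ⟨f, hf', hf⟩ := Submodule.exists_le_ker_of_lt_top _ (lt_top_iff_ne_top.mpr h)
    have h1 : ∀ v, f v = ∑ g, v g * f (Pi.single g 1) := fun v => by
      conv_lhs => rw [← Finset.univ_sum_single v, map_sum]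
      refine Finset.sum_congr rfl fun g _ => ?_
      rw [← smul_eq_mul, ← map_smul, ← Pi.single_smul, smul_eq_mul, mul_one]
    have h2 : ∑ g, f (Pi.single g 1) • (fun y : L => g y) = 0 := by
      ext y
      have h3 : f (tensorToPi k L (1 ⊗ₜ y)) = 0 := hf ⟨1 ⊗ₜ y, rfl⟩
      rw [h1] at h3
      simp only [Finset.sum_apply, Pi.smul_apply, Pi.zero_apply]
      rw [← h3]
      refine Finset.sum_congr rfl fun g _ => ?_
      rw [tensorToPi_tmul, one_mul, smul_eq_mul, mul_comm]
    have h4 := (linearIndependent_monoidHom L L).comp (fun g : Gal(L/k) => ((g : L ≃* L) : L →* L))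
      fun g h e => AlgEquiv.ext fun x => DFunLike.congr_fun e x
    have h5 := Fintype.linearIndependent_iff.mp h4 _ h2
    exact hf' (LinearMap.ext fun v => by simp [h1 v, h5])
  refine ⟨?_, hs⟩
  have h : Module.finrank L (L ⊗[k] L) = Module.finrank L (Gal(L/k) → L) := by
    rw [Module.finrank_baseChange, Module.finrank_pi, ← Nat.card_eq_fintype_card,
      IsGalois.card_aut_eq_finrank]
  exact (LinearMap.injective_iff_surjective_of_finrank_eq_finrank h).mpr hs

/-- Two morphisms to `Spec L` over `Spec k` differ locally by elements of the Galois group. -/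
theorem exists_cover_of_comp_specMap_eq [FiniteDimensional k L] [IsGalois k L] {Z : Scheme.{u}}
    (a b : Z ⟶ SpecOf L) (h : a ≫ specMap k L = b ≫ specMap k L) :
    ∃ 𝒰 : Scheme.OpenCover.{u} Z, ∀ i, ∃ g : Gal(L/k),
      𝒰.f i ≫ b = 𝒰.f i ≫ a ≫ Spec.map (CommRingCat.ofHom (g : L →+* L)) := by
  let e : L ⊗[k] L ≃+* (Gal(L/k) → L) := RingEquiv.ofBijective _ (bijective_tensorToPi (k := k) (L := L))
  let q : Z ⟶ Spec (CommRingCat.of (L ⊗[k] L)) :=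
    pullback.lift a b h ≫ (pullbackSpecIso k L L).hom
  have hq1 : q ≫ Spec.map (CommRingCat.ofHom (algebraMap L (L ⊗[k] L))) = a := by
    rw [Category.assoc, pullbackSpecIso_hom_fst', pullback.lift_fst]
  have hq2 : q ≫ Spec.map (CommRingCat.ofHom
      ((Algebra.TensorProduct.includeRight : L →ₐ[k] L ⊗[k] L) : L →+* L ⊗[k] L)) = b := by
    rw [Category.assoc, pullbackSpecIso_hom_snd, pullback.lift_snd]
  -- Through `e` the pair `(a, b)` becomes a map to a disjoint union of copies of `Spec L` indexed
  -- by the Galois group; the preimages of the copies form the cover.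
  let q' : Z ⟶ ∐ fun _ : Gal(L/k) => Spec (CommRingCat.of L) :=
    q ≫ Spec.map (CommRingCat.ofHom e.symm.toRingHom) ≫ inv (sigmaSpec fun _ => CommRingCat.of L)
  refine ⟨(sigmaOpenCover fun _ : Gal(L/k) => Spec (CommRingCat.of L)).pullback₁ q',
    fun (g : Gal(L/k)) => ⟨g, ?_⟩⟩
  let p : pullback q' (Sigma.ι (fun _ : Gal(L/k) => Spec (CommRingCat.of L)) g) ⟶ Z :=
    pullback.fst _ _
  let r : pullback q' (Sigma.ι (fun _ : Gal(L/k) => Spec (CommRingCat.of L)) g) ⟶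
    Spec (CommRingCat.of L) := pullback.snd _ _
  have hpr : p ≫ q' = r ≫ Sigma.ι (fun _ : Gal(L/k) => Spec (CommRingCat.of L)) g := pullback.condition
  have h1 : p ≫ q = r ≫ Spec.map (CommRingCat.ofHom
      ((Pi.evalRingHom (fun _ : Gal(L/k) => L) g).comp e.toRingHom)) := by
    have h2 := congrArg (· ≫ sigmaSpec (fun _ : Gal(L/k) => CommRingCat.of L) ≫
      Spec.map (CommRingCat.ofHom e.toRingHom)) hpr
    simp only [q', Category.assoc, IsIso.inv_hom_id_assoc, ι_sigmaSpec_assoc, ← Spec.map_comp,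
      ← CommRingCat.ofHom_comp] at h2
    have h3 : e.symm.toRingHom.comp e.toRingHom = RingHom.id _ :=
      RingHom.ext fun x => e.symm_apply_apply x
    rw [h3] at h2
    refine Eq.trans ?_ h2
    exact congrArg (p ≫ ·) ((Category.comp_id _).symm.trans
      (congrArg (q ≫ ·) (Spec.map_id _).symm))
  change p ≫ b = p ≫ a ≫ _
  have h4 := fun {M : Type u} [CommRing M] (f : M →+* L ⊗[k] L) =>
    congrArg (· ≫ Spec.map (CommRingCat.ofHom f)) h1
  simp only [Category.assoc, ← Spec.map_comp, ← CommRingCat.ofHom_comp] at h4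
  rw [← hq1, ← hq2, h4, Category.assoc, ← Spec.map_comp, ← CommRingCat.ofHom_comp, h4]
  congr 2
  ext x
  change tensorToPi k L (1 ⊗ₜ x) g = tensorToPi k L (g x ⊗ₜ 1) g
  rw [tensorToPi_tmul, tensorToPi_tmul, map_one, one_mul, mul_one]

theorem flat_and_surjective_specMap : Flat (specMap k L) ∧ Surjective (specMap k L) := by
  rw [flat_and_surjective_SpecMap_iff]
  exact (RingHom.faithfullyFlat_algebraMap_iff).mpr inferInstance

instance (X : Over (SpecOf k)) : Flat (pullback.fst X.hom (specMap k L)) := by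
  have := (flat_and_surjective_specMap (k := k) (L := L)).1
  infer_instance

instance (X : Over (SpecOf k)) : Surjective (pullback.fst X.hom (specMap k L)) := by
  have := (flat_and_surjective_specMap (k := k) (L := L)).2
  infer_instance

instance (X : Over (SpecOf k)) : QuasiCompact (pullback.fst X.hom (specMap k L)) := inferInstance

instance (X : Over (SpecOf k)) : Epi (pullback.fst X.hom (specMap k L)) := inferInstance

/-- Galois descent for morphisms of schemes. -/
theorem exists_fst_comp_eq [FiniteDimensional k L] [IsGalois k L] (X : Over (SpecOf k))
    {Y : Scheme.{u}} (m : pullback X.hom (specMap k L) ⟶ Y)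
    (hm : ∀ g : Gal(L/k), galoisAct X g ≫ m = m) :
    ∃ f : X.left ⟶ Y, pullback.fst X.hom (specMap k L) ≫ f = m := by
  -- The projection `X_L ⟶ X` is flat, surjective and quasi-compact, hence an effective epimorphism.
  -- Two maps to `X_L` with the same projection to `X` differ locally by Galois elements, under
  -- which `m` is invariant.
  refine ⟨EffectiveEpi.desc (pullback.fst X.hom (specMap k L)) m fun {Z} g₁ g₂ h => ?_,
    EffectiveEpi.fac ..⟩
  obtain ⟨𝒰, h𝒰⟩ := exists_cover_of_comp_specMap_eq (g₁ ≫ pullback.snd X.hom (specMap k L))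
    (g₂ ≫ pullback.snd X.hom (specMap k L)) (by
      rw [Category.assoc, Category.assoc, ← pullback.condition, ← Category.assoc, h,
        Category.assoc])
  refine 𝒰.hom_ext _ _ fun i => ?_
  obtain ⟨g, hg⟩ := h𝒰 i
  -- The inverse appears because `galoisAct` acts on `Spec L` through `g⁻¹`.
  have h1 : 𝒰.f i ≫ g₂ = 𝒰.f i ≫ g₁ ≫ galoisAct X g⁻¹ := by
    apply pullback.hom_ext
    · rw [Category.assoc, Category.assoc, Category.assoc, ← h]
      exact congrArg (fun t => 𝒰.f i ≫ g₁ ≫ t) (galoisAct_fst X _).symm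
    · rw [Category.assoc, Category.assoc, Category.assoc, hg, Category.assoc]
      refine congrArg (fun t => 𝒰.f i ≫ g₁ ≫ t) (Eq.trans ?_ (galoisAct_snd X _).symm)
      rw [inv_inv]
  have h2 := congrArg (· ≫ m) h1
  simp only [Category.assoc] at h2
  rw [h2]
  exact congrArg (fun t => 𝒰.f i ≫ g₁ ≫ t) (hm g⁻¹).symm

/-- Galois descent for morphisms over a field. -/
theorem exists_baseChange_map_eq [FiniteDimensional k L] [IsGalois k L] {X Y : Over (SpecOf k)}
    (m : (baseChange k L).obj X ⟶ (baseChange k L).obj Y)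
    (hm : ∀ g : Gal(L/k), galoisAct X g ≫ m.left = m.left ≫ galoisAct Y g) :
    ∃ f : X ⟶ Y, (baseChange k L).map f = m := by
  obtain ⟨f, hf⟩ := exists_fst_comp_eq X (m.left ≫ pullback.fst Y.hom (specMap k L)) fun g => by
    refine (Category.assoc _ _ _).symm.trans ?_
    rw [hm]
    refine (Category.assoc _ _ _).trans ?_
    exact congrArg (_ ≫ ·) (galoisAct_fst Y g)
  have hw : m.left ≫ pullback.snd Y.hom (specMap k L) = pullback.snd X.hom (specMap k L) := Over.w m
  have hf' : f ≫ Y.hom = X.hom := by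
    rw [← cancel_epi (pullback.fst X.hom (specMap k L)), ← Category.assoc, hf,
      pullback.condition, ← hw]
    refine (Category.assoc _ _ _).trans (Eq.trans ?_ (Category.assoc _ _ _).symm)
    exact congrArg (_ ≫ ·) pullback.condition
  refine ⟨Over.homMk f hf', Over.OverMorphism.ext (pullback.hom_ext ?_ ?_)⟩
  · exact (baseChange_map_fst _).trans hf
  · exact (Over.w ((baseChange k L).map (Over.homMk f hf'))).trans hw.symm

theorem baseChange_map_injective {X Y : Over (SpecOf k)} :
    Function.Injective (fun f : X ⟶ Y => (baseChange k L).map f) := by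
  intro f g h
  ext1
  rw [← cancel_epi (pullback.fst X.hom (specMap k L)), ← baseChange_map_fst, ← baseChange_map_fst]
  exact congrArg (fun t => t.left ≫ _) h

/-- Galois descent for isomorphisms over a field. -/
theorem exists_iso_baseChange_map_eq [FiniteDimensional k L] [IsGalois k L]
    {X Y : Over (SpecOf k)} (e : (baseChange k L).obj X ≅ (baseChange k L).obj Y)
    (he : ∀ g : Gal(L/k), galoisAct X g ≫ e.hom.left = e.hom.left ≫ galoisAct Y g) :
    ∃ f : X ≅ Y, (baseChange k L).map f.hom = e.hom := by
  have h1 : e.hom.left ≫ e.inv.left = 𝟙 _ := by rw [← Over.comp_left, e.hom_inv_id, Over.id_left]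
  have h2 : e.inv.left ≫ e.hom.left = 𝟙 _ := by rw [← Over.comp_left, e.inv_hom_id, Over.id_left]
  have he' : ∀ g : Gal(L/k), galoisAct Y g ≫ e.inv.left = e.inv.left ≫ galoisAct X g := fun g => by
    have h3 := congrArg (fun t => e.inv.left ≫ t ≫ e.inv.left) (he g)
    simp only [Category.assoc] at h3
    rw [h1, Category.comp_id, ← Category.assoc e.inv.left, h2, Category.id_comp] at h3
    exact h3.symm
  obtain ⟨f, hf⟩ := exists_baseChange_map_eq e.hom he
  obtain ⟨f', hf'⟩ := exists_baseChange_map_eq e.inv he'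
  refine ⟨⟨f, f', ?_, ?_⟩, hf⟩
  · refine baseChange_map_injective (L := L) ?_
    simp only [CategoryTheory.Functor.map_comp, hf, hf', e.hom_inv_id, CategoryTheory.Functor.map_id]
  · refine baseChange_map_injective (L := L) ?_
    simp only [CategoryTheory.Functor.map_comp, hf, hf', e.inv_hom_id, CategoryTheory.Functor.map_id]

end Descent


/-! ### Elements of reduced norm one are commutators -/

section Commutators

variable {L : Type*} [Field L]

/-- The Cayley-Hamilton theorem in rank three. -/
theorem pow_three_eq (y : Matrix (Fin 3) (Fin 3) L) :
    y * y * y - y.trace • (y * y) + y.adjugate.trace • y = y.det • 1 := by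
  have h : y.adjugate = y * y - y.trace • y + y.adjugate.trace • 1 := by
    ext i j
    fin_cases i <;> fin_cases j <;>
      simp [Matrix.adjugate_fin_three, Matrix.mul_apply, Fin.sum_univ_three, Matrix.trace_fin_three]
        <;> ring
  rw [← Matrix.adjugate_mul]
  conv_rhs => rw [h]
  rw [add_mul, sub_mul, smul_mul_assoc, smul_mul_assoc, one_mul]

/-- The trace of the adjugate is the middle coefficient of the characteristic polynomial; in this
form it can be controlled through the trace of the inverse. -/
theorem adjugate_trace_eq {y : Matrix (Fin 3) (Fin 3) L} (hy : y.det ≠ 0) :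
    y.adjugate.trace = y.det * y⁻¹.trace := by
  rw [Matrix.inv_def, Ring.inverse_eq_inv', Matrix.trace_smul, smul_eq_mul, ← mul_assoc,
    mul_inv_cancel₀ hy, one_mul]

variable {k : Type*} [Field k] [Algebra k L] {D : Subalgebra k (Matrix (Fin 3) (Fin 3) L)}

/-- Trace zero gives `3 * c = 0`, so `s = 0`, `δ = c ^ 3` and `(y - x) ^ 3 = y ^ 3 - c ^ 3 = 0`,
which forces `y = x` since nonzero elements of `D` have nonzero determinant. Characteristic three,
where `c` may be nonzero, is included. This disposes of scalar elements in `exists_mul_eq_mul`. -/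
theorem eq_smul_one_of_pow_three (hdet : ∀ A ∈ D, A ≠ 0 → A.det ≠ 0)
    {x y : Matrix (Fin 3) (Fin 3) L} (hx : x ∈ D) (hy : y ∈ D) {c : L} (hxc : x = c • 1)
    (ht : x.trace = 0) {s δ : L}
    (hs : s = x.adjugate.trace) (hδ : δ = x.det) (hy3 : y * y * y + s • y = δ • 1) : y = x := by
  by_contra h
  have h0 := hdet (y - x) (D.sub_mem hy hx) (sub_ne_zero.mpr h)
  have h3c : 3 * c = 0 := by
    rw [← ht, hxc, Matrix.trace_smul, Matrix.trace_one]
    simp [mul_comm]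
  have hs' : s = 3 * c * c := by
    rw [hs, hxc]
    simp [Matrix.adjugate_fin_three, Matrix.trace_fin_three]
    ring
  have hδ' : δ = c * c * c := by
    rw [hδ, hxc]
    simp [pow_three, mul_assoc]
  rw [hs', h3c, zero_mul, zero_smul, add_zero, hδ'] at hy3
  have h1 : (y - x) * (y - x) * (y - x) =
      y * y * y - (3 * c) • (y * y) + (3 * c * c) • y - (c * c * c) • 1 := by
    rw [hxc]
    simp only [sub_mul, mul_sub, smul_mul_assoc, mul_smul_comm, mul_one, one_mul]
    module
  rw [h3c, hy3, zero_mul, zero_smul, zero_smul, sub_zero, add_zero, sub_self] at h1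
  have h2 := congrArg Matrix.det h1
  rw [Matrix.det_mul, Matrix.det_mul, Matrix.det_zero] at h2
  exact mul_ne_zero (mul_ne_zero h0 h0) h0 h2

/-- Two elements of a division algebra of degree three with the same characteristic polynomial, and
trace zero, are conjugate. -/
theorem exists_mul_eq_mul (hdet : ∀ A ∈ D, A ≠ 0 → A.det ≠ 0)
    (hcent : ∀ A ∈ D, (∀ B ∈ D, A * B = B * A) → ∃ c : L, A = c • 1)
    {x y : Matrix (Fin 3) (Fin 3) L} (hx : x ∈ D) (hy : y ∈ D) {s : k}
    (hxt : x.trace = 0) (hyt : y.trace = 0) (hxs : x.adjugate.trace = algebraMap k L s)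
    (hys : y.adjugate.trace = algebraMap k L s) (hd : x.det = y.det) :
    ∃ z ∈ D, z ≠ 0 ∧ x * z = z * y := by
  have hx3 := pow_three_eq x
  have hy3 := pow_three_eq y
  rw [hxt, zero_smul, sub_zero] at hx3
  rw [hyt, zero_smul, sub_zero] at hy3
  rcases eq_or_ne x y with rfl | hxy
  · exact ⟨1, D.one_mem, one_ne_zero, by simp⟩
  have nx : ∃ w ∈ D, x * w - w * x ≠ 0 := by
    by_contra! h
    obtain ⟨c, hc⟩ := hcent x hx fun B hB => sub_eq_zero.mp (h B hB)
    exact hxy (eq_smul_one_of_pow_three hdet hx hy hc hxt (hys.trans hxs.symm) hd.symm hy3).symm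
  have ny : ∃ w ∈ D, w * y - y * w ≠ 0 := by
    by_contra! h
    obtain ⟨c, hc⟩ := hcent y hy fun B hB => (sub_eq_zero.mp (h B hB)).symm
    exact hxy (eq_smul_one_of_pow_three hdet hy hx hc hyt (hxs.trans hys.symm) hd hx3)
  obtain ⟨w₀, hw₀, hw₀'⟩ := nx
  obtain ⟨u₀, hu₀, hu₀'⟩ := ny
  -- This is the divided difference of `T ^ 3 + s T` with `x` acting on the left and `y` on the
  -- right: `x * Q w - Q w * y` telescopes to the difference of the two cubics, which equal the same
  -- scalar. Any nonzero value of `Q` conjugates `x` to `y`.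
  let Q : Matrix (Fin 3) (Fin 3) L → Matrix (Fin 3) (Fin 3) L :=
    fun w => x * x * w + x * w * y + w * (y * y) + s • w
  have hQ : ∀ w, x * Q w = Q w * y := fun w => by
    have h1 : x * Q w - Q w * y = (x * x * x + s • x) * w - w * (y * y * y + s • y) := by
      simp only [Q, mul_add, add_mul, mul_smul_comm, smul_mul_assoc, mul_assoc]
      abel
    rw [← algebraMap_smul L s x, ← algebraMap_smul L s y, ← hxs, hx3, hxs, ← hys, hy3, hd] at h1
    rw [← sub_eq_zero, h1]
    simp
  have hQD : ∀ w ∈ D, Q w ∈ D := fun w hw =>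
    D.add_mem (D.add_mem (D.add_mem (D.mul_mem (D.mul_mem hx hx) hw)
      (D.mul_mem (D.mul_mem hx hw) hy)) (D.mul_mem hw (D.mul_mem hy hy))) (D.smul_mem hw s)
  by_contra! h
  have hQ0 : ∀ w ∈ D, Q w = 0 := fun w hw => by
    by_contra hne
    exact h _ (hQD w hw) hne (hQ w)
  -- If `Q` vanished on `D`, then `Q (w * u₀) - Q w * u₀` would eliminate the term with `x * x`.
  -- Comparing the result at `w₀` with `w₀` times the result at 1 leaves a vanishing product of two
  -- nonzero commutators.
  have h1 : ∀ w ∈ D, x * w * (u₀ * y - y * u₀) + w * (u₀ * (y * y) - y * y * u₀) = 0 :=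
    fun w hw => by
      have h2 : x * w * (u₀ * y - y * u₀) + w * (u₀ * (y * y) - y * y * u₀) =
          Q (w * u₀) - Q w * u₀ := by
        simp only [Q, add_mul, mul_sub, smul_mul_assoc, mul_assoc]
        abel
      rw [h2, hQ0 _ (D.mul_mem hw hu₀), hQ0 w hw, zero_mul, sub_zero]
  have h2 : (x * w₀ - w₀ * x) * (u₀ * y - y * u₀) = 0 := by
    have h3 := h1 w₀ hw₀
    have h4 := congrArg (w₀ * ·) (h1 1 D.one_mem)
    simp only [mul_one, one_mul, mul_zero, mul_add, ← mul_assoc] at h3 h4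
    rw [sub_mul, sub_eq_zero]
    have h5 := h3.trans h4.symm
    simpa only [← mul_assoc] using add_right_cancel h5
  have h3 := congrArg Matrix.det h2
  rw [Matrix.det_mul, Matrix.det_zero] at h3
  exact (mul_ne_zero
    (hdet _ (D.sub_mem (D.mul_mem hx hw₀) (D.mul_mem hw₀ hx)) hw₀')
    (hdet _ (D.sub_mem (D.mul_mem hu₀ hy) (D.mul_mem hy hu₀)) hu₀')) h3

/-- Wang's theorem in degree three: an element of reduced norm one is a commutator. -/
theorem exists_eq_commutator (hdet : ∀ A ∈ D, A ≠ 0 → A.det ≠ 0)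
    (hinv : ∀ A ∈ D, A⁻¹ ∈ D) (htr : ∀ A ∈ D, ∃ t : k, A.trace = algebraMap k L t)
    (hnrd : ∀ A ∈ D, ∃ t : k, A.det = algebraMap k L t)
    (hcent : ∀ A ∈ D, (∀ B ∈ D, A * B = B * A) → ∃ c : L, A = c • 1)
    {d : Matrix (Fin 3) (Fin 3) L} (hd : d ∈ D) (hd1 : d.det = 1) (hds : ∀ c : L, d ≠ c • 1) :
    ∃ x ∈ D, ∃ y ∈ D, x ≠ 0 ∧ y ≠ 0 ∧ d * (y * x) = x * y := by
  have hd0 : d ≠ 0 := fun h => hds 0 (by rw [h, zero_smul])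
  obtain ⟨w, hw, hw'⟩ : ∃ w ∈ D, d * w - w * d ≠ 0 := by
    by_contra! h
    obtain ⟨c, hc⟩ := hcent d hd fun B hB => sub_eq_zero.mp (h B hB)
    exact hds c hc
  -- The aim is some `y` such that `y` and `d * y` have the same characteristic polynomial with
  -- trace zero; they are then conjugate, which exhibits `d` as a commutator. For `f` commuting with
  -- `d` the trace of `f * z` is zero, so `y = f * z` settles both traces, and the determinants
  -- agree because `d` has determinant one.
  set z := d * w - w * d with hz
  have hzD : z ∈ D := D.sub_mem (D.mul_mem hd hw) (D.mul_mem hw hd)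
  have hz1 := hdet z hzD hw'
  -- One linear condition on the span of `1` and `d`, two-dimensional as `d` is not scalar, has a
  -- nonzero solution.
  obtain ⟨h, hhD, hh0, hhd, hht⟩ : ∃ h ∈ D, h ≠ 0 ∧ h * d = d * h ∧ (z⁻¹ * h).trace = 0 := by
    obtain ⟨t₁, ht₁⟩ := htr _ (hinv z hzD)
    obtain ⟨t₂, ht₂⟩ := htr _ (D.mul_mem (hinv z hzD) hd)
    rcases eq_or_ne t₁ 0 with h0 | h0
    · exact ⟨1, D.one_mem, one_ne_zero, by simp, by simp [ht₁, h0]⟩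
    · refine ⟨t₂ • 1 - t₁ • d, D.sub_mem (D.smul_mem D.one_mem _) (D.smul_mem hd _), fun h => ?_,
        ?_, ?_⟩
      · refine hds (algebraMap k L (t₁⁻¹ * t₂)) ?_
        rw [sub_eq_zero] at h
        rw [algebraMap_smul, mul_smul, h, smul_smul, inv_mul_cancel₀ h0, one_smul]
      · simp [sub_mul, mul_sub]
      · rw [mul_sub, mul_smul_comm, mul_smul_comm, Matrix.trace_sub, Matrix.trace_smul,
          Matrix.trace_smul, mul_one, ht₁, ht₂, Algebra.smul_def, Algebra.smul_def, mul_comm,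
          sub_self]
  have hh1 := hdet h hhD hh0
  -- With `f = e * h⁻¹` one gets `(d * y)⁻¹ - y⁻¹ = z⁻¹ * f⁻¹ * e = z⁻¹ * h`, of trace zero by the
  -- choice of `h`; so the middle coefficients agree as well.
  set e := d⁻¹ - 1 with he
  have heD : e ∈ D := D.sub_mem (hinv d hd) D.one_mem
  have hdu : IsUnit d.det := by rw [hd1]; exact isUnit_one
  have he0 : e ≠ 0 := fun h => by
    refine hds 1 ?_
    have h1 := congrArg (d * ·) (sub_eq_zero.mp h)
    simp only [mul_one, Matrix.mul_nonsing_inv _ hdu] at h1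
    rw [one_smul, ← h1]
  have he1 := hdet e heD he0
  have hhu : IsUnit h.det := hh1.isUnit
  have heu : IsUnit e.det := he1.isUnit
  have hzu : IsUnit z.det := hz1.isUnit
  set f := e * h⁻¹ with hf
  have hfD : f ∈ D := D.mul_mem heD (hinv h hhD)
  have hdd : Commute d d⁻¹ := by
    rw [Commute, SemiconjBy, Matrix.mul_nonsing_inv _ hdu, Matrix.nonsing_inv_mul _ hdu]
  have hdh : Commute d h⁻¹ := by
    have h1 : h⁻¹ * (h * d) * h⁻¹ = h⁻¹ * (d * h) * h⁻¹ := by rw [hhd]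
    rw [← mul_assoc, Matrix.nonsing_inv_mul _ hhu, one_mul, mul_assoc, mul_assoc,
      Matrix.mul_nonsing_inv _ hhu, mul_one] at h1
    exact h1
  have hfd : d * f = f * d :=
    ((hdd.sub_right (Commute.one_right d)).mul_right hdh)
  set y := f * z with hy
  have hyD : y ∈ D := D.mul_mem hfD hzD
  have hfdet : f.det ≠ 0 := by
    rw [hf, Matrix.det_mul]
    exact mul_ne_zero he1 (Matrix.isUnit_nonsing_inv_det _ hhu).ne_zero
  have hydet : y.det ≠ 0 := by
    rw [hy, Matrix.det_mul]
    exact mul_ne_zero hfdet hz1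
  have hdydet : (d * y).det = y.det := by rw [Matrix.det_mul, hd1, one_mul]
  have htz : ∀ f : Matrix (Fin 3) (Fin 3) L, d * f = f * d → (f * z).trace = 0 := fun f hfd => by
    rw [hz, mul_sub, Matrix.trace_sub, ← mul_assoc, ← mul_assoc, Matrix.trace_mul_comm (f * w) d,
      ← mul_assoc, hfd, sub_self]
  have hyt : y.trace = 0 := htz f hfd
  have hdyt : (d * y).trace = 0 := by
    rw [hy, ← mul_assoc]
    exact htz _ (by rw [mul_assoc, hfd])
  have hsame : (d * y)⁻¹.trace = y⁻¹.trace := by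
    have h1 : f⁻¹ * e = h := by
      rw [hf, Matrix.mul_inv_rev, Matrix.nonsing_inv_nonsing_inv _ hhu, mul_assoc,
        Matrix.nonsing_inv_mul _ heu, mul_one]
    have h2 : (d * y)⁻¹ - y⁻¹ = z⁻¹ * h := by
      rw [Matrix.mul_inv_rev, hy, Matrix.mul_inv_rev, ← h1, he, mul_assoc, mul_sub, mul_sub,
        mul_one]
    rw [← sub_eq_zero, ← Matrix.trace_sub, h2, hht]
  obtain ⟨s, hs⟩ : ∃ s : k, y.adjugate.trace = algebraMap k L s := by
    obtain ⟨t, ht⟩ := htr _ (hinv y hyD)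
    obtain ⟨n, hn⟩ := hnrd y hyD
    exact ⟨n * t, by rw [adjugate_trace_eq hydet, ht, hn, map_mul]⟩
  obtain ⟨x, hxD, hx0, hx⟩ := exists_mul_eq_mul hdet hcent (D.mul_mem hd hyD) hyD hdyt hyt
    (s := s) (by
      rw [adjugate_trace_eq (by rw [hdydet]; exact hydet), hsame, hdydet, ← adjugate_trace_eq hydet,
        hs]) hs hdydet
  refine ⟨x, hxD, y, hyD, hx0, fun h => hydet (by rw [h, Matrix.det_zero]), ?_⟩
  rw [← mul_assoc, hx]

end Commutators


/-! ### Galois descent for vector spaces -/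

section Semilinear

variable {k L : Type*} [Field k] [Field L] [Algebra k L] [FiniteDimensional k L]

/-- A subspace that is stable under a semilinear action of the Galois group is spanned by fixed
vectors. -/
theorem le_span_fixed {V : Type*} [AddCommGroup V] [Module L V] (ρ : Gal(L/k) → V → V)
    (hmul : ∀ g h v, ρ (g * h) v = ρ g (ρ h v)) (hone : ∀ v, ρ 1 v = v)
    (hadd : ∀ g v w, ρ g (v + w) = ρ g v + ρ g w) (hsmul : ∀ g (c : L) v, ρ g (c • v) = g c • ρ g v)
    (W : Submodule L V) (hW : ∀ g, ∀ w ∈ W, ρ g w ∈ W) :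
    W ≤ Submodule.span L {w | w ∈ W ∧ ∀ g, ρ g w = w} := by
  classical
  intro w hw
  by_contra hws
  obtain ⟨f, hf, hf'⟩ := Submodule.exists_le_ker_of_notMem hws
  let r (g : Gal(L/k)) : V →+ V := AddMonoidHom.mk' (ρ g) (hadd g)
  -- The averaged vector `∑ g, ρ g (c • w)` is fixed, so `f` kills it. This is a relation between
  -- characters with coefficients `f (ρ g w)`; they all vanish, and the one at `g = 1` is `f w`.
  have h1 : ∀ c : L, ∑ g, f (ρ g w) * g c = 0 := fun c => by
    have h2 : ∑ g, ρ g (c • w) ∈ Submodule.span L {w | w ∈ W ∧ ∀ g, ρ g w = w} := by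
      refine Submodule.subset_span ⟨W.sum_mem fun g _ => hW g _ (W.smul_mem c hw), fun h => ?_⟩
      calc ρ h (∑ g, ρ g (c • w)) = ∑ g, r h (ρ g (c • w)) := map_sum (r h) _ _
        _ = ∑ g, ρ (h * g) (c • w) := by simp only [hmul]; rfl
        _ = _ := Fintype.sum_equiv (Equiv.mulLeft h) _ _ fun g => rfl
    have h3 : f (∑ g, ρ g (c • w)) = 0 := hf' h2
    rw [map_sum] at h3
    rw [← h3]
    refine Finset.sum_congr rfl fun g _ => ?_
    rw [hsmul, map_smul, smul_eq_mul, mul_comm]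
  have h4 := (linearIndependent_monoidHom L L).comp (fun g : Gal(L/k) => ((g : L ≃* L) : L →* L))
    fun g h e => AlgEquiv.ext fun x => DFunLike.congr_fun e x
  have h5 := Fintype.linearIndependent_iff.mp h4 (fun g => f (ρ g w)) (by
    ext c
    simp only [Finset.sum_apply, Pi.zero_apply]
    exact h1 c) 1
  rw [hone] at h5
  exact hf h5

end Semilinear

/-! ### The algebra of matrices invariant under the twisted action -/

section TwistedAlgebra

open Matrix

variable {k L : Type*} [Field k] [Field L] [Algebra k L] {n : Type*} [Fintype n] [DecidableEq n]

theorem map_algebraMap_galois (g : Gal(L/k)) (t : k) :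
    (algebraMap k (Matrix n n L) t).map g = algebraMap k (Matrix n n L) t := by
  rw [Matrix.algebraMap_eq_diagonal, Matrix.diagonal_map (map_zero g)]
  congr 1
  exact funext fun _ => g.commutes t

/-- The algebra of matrices that are invariant under the Galois action twisted by `a`. -/
def twistedAlgebra (a : Gal(L/k) → GL n L) : Subalgebra k (Matrix n n L) where
  carrier := {A | ∀ g, (a g : Matrix n n L) * A.map g = A * (a g : Matrix n n L)}
  mul_mem' {A B} hA hB g := by
    rw [Matrix.map_mul, ← mul_assoc, hA, mul_assoc, hB, mul_assoc]
  add_mem' {A B} hA hB g := by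
    rw [Matrix.map_add _ (map_add g), mul_add, add_mul, hA, hB]
  algebraMap_mem' t g := by
    rw [map_algebraMap_galois]
    exact (Algebra.commutes t _).symm

variable {a : Gal(L/k) → GL n L}

theorem map_eq_of_mem_twistedAlgebra {A : Matrix n n L} (hA : A ∈ twistedAlgebra a) (g : Gal(L/k)) :
    A.map g = ((a g)⁻¹ : GL n L) * A * (a g : Matrix n n L) := by
  rw [mul_assoc, ← hA g, ← mul_assoc, ← Units.val_mul, inv_mul_cancel, Units.val_one, one_mul]

theorem inv_mem_twistedAlgebra {A : Matrix n n L} (hA : A ∈ twistedAlgebra a) :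
    A⁻¹ ∈ twistedAlgebra a := by
  by_cases h : IsUnit A.det
  · intro g
    have h1 : A * ((a g : Matrix n n L) * A⁻¹.map g) = a g := by
      rw [← mul_assoc, ← hA g, mul_assoc, ← Matrix.map_mul, Matrix.mul_nonsing_inv _ h,
        Matrix.map_one _ (map_zero g) (map_one g), mul_one]
    rw [← h1, ← mul_assoc A⁻¹, Matrix.nonsing_inv_mul _ h, one_mul, h1]
  · rw [Matrix.nonsing_inv_apply_not_isUnit _ h]
    exact (twistedAlgebra a).zero_mem

theorem exists_trace_eq [IsGalois k L] {A : Matrix n n L} (hA : A ∈ twistedAlgebra a) :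
    ∃ t : k, A.trace = algebraMap k L t := by
  suffices h : A.trace ∈ Set.range (algebraMap k L) from h.imp fun _ => Eq.symm
  rw [InfiniteGalois.mem_range_algebraMap_iff_fixed]
  intro g
  have h1 : g A.trace = (A.map g).trace := by simp [Matrix.trace]
  rw [h1, map_eq_of_mem_twistedAlgebra hA, Matrix.trace_mul_comm, ← mul_assoc, ← Units.val_mul,
    mul_inv_cancel, Units.val_one, one_mul]

theorem exists_det_eq [IsGalois k L] {A : Matrix n n L} (hA : A ∈ twistedAlgebra a) :
    ∃ t : k, A.det = algebraMap k L t := by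
  suffices h : A.det ∈ Set.range (algebraMap k L) from h.imp fun _ => Eq.symm
  rw [InfiniteGalois.mem_range_algebraMap_iff_fixed]
  intro g
  have h1 : g A.det = (A.map g).det := RingHom.map_det (g : L →+* L) A
  rw [h1, map_eq_of_mem_twistedAlgebra hA, Matrix.det_mul, Matrix.det_mul, mul_right_comm,
    ← Matrix.det_mul, ← Units.val_mul, inv_mul_cancel, Units.val_one, Matrix.det_one, one_mul]

/-- `a` is a cocycle up to scalars. -/
def IsProjectiveCocycle (a : Gal(L/k) → GL n L) : Prop :=
  ∀ g h, ∃ c : L,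
    (a (g * h) : Matrix n n L) = c • ((a g : Matrix n n L) * (a h : Matrix n n L).map g)

/-- The scalar ambiguity of the cocycle cancels under conjugation, so matrices carry a genuine
semilinear action with fixed points `twistedAlgebra a`, and descent applies. -/
theorem IsProjectiveCocycle.le_span [FiniteDimensional k L] (ha : IsProjectiveCocycle a)
    (W : Submodule L (Matrix n n L))
    (hW : ∀ g : Gal(L/k), ∀ A ∈ W,
      (a g : Matrix n n L) * A.map g * ((a g)⁻¹ : GL n L) ∈ W) :
    W ≤ Submodule.span L {A | A ∈ W ∧ A ∈ twistedAlgebra a} := by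
  let ρ (g : Gal(L/k)) (A : Matrix n n L) : Matrix n n L :=
    (a g : Matrix n n L) * A.map g * ((a g)⁻¹ : GL n L)
  have hρ : ∀ g A B, ρ g A = B ↔ (a g : Matrix n n L) * A.map g = B * (a g : Matrix n n L) :=
    fun g A B => Units.mul_inv_eq_iff_eq_mul _
  have hmul : ∀ g h A, ρ (g * h) A = ρ g (ρ h A) := fun g h A => by
    obtain ⟨c, hc⟩ := ha g h
    have h1 := (hρ h A _).mp rfl
    have h2 := (hρ g (ρ h A) _).mp rfl
    rw [hρ, hc, mul_smul_comm, smul_mul_assoc, ← mul_assoc, ← h2]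
    have h3 : A.map (g * h : Gal(L/k)) = (A.map h).map g := rfl
    rw [h3, mul_assoc, mul_assoc, ← Matrix.map_mul, ← Matrix.map_mul, h1]
  -- The matrix `a 1` need not be the identity, but `ρ 1` is idempotent and injective.
  have hone : ∀ A, ρ 1 A = A := fun A => by
    have h1 := hmul 1 1 A
    rw [mul_one] at h1
    have hinj : Function.Injective (ρ 1) := fun A B hAB => by
      have h2 := (hρ 1 A _).mp hAB
      rw [← (hρ 1 B _).mp rfl] at h2
      exact (a 1).isUnit.mul_left_cancel h2
    exact (hinj h1).symm
  refine (le_span_fixed ρ hmul hone (fun g A B => ?_) (fun g c A => ?_) W hW).trans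
    (Submodule.span_mono fun A hA => ⟨hA.1, fun g => (hρ g A A).mp (hA.2 g)⟩)
  · simp only [ρ]
    rw [Matrix.map_add _ (map_add g), mul_add, add_mul]
  · simp only [ρ]
    rw [Matrix.map_smul' _ _ _ (map_mul g), mul_smul_comm, smul_mul_assoc]

/-- By descent the invariant matrices span all matrices over `L`, so `A` is central. -/
theorem IsProjectiveCocycle.exists_eq_smul_one [FiniteDimensional k L]
    (ha : IsProjectiveCocycle a)
    {A : Matrix n n L} (h : ∀ B ∈ twistedAlgebra a, A * B = B * A) : ∃ c : L, A = c • 1 := by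
  have h1 : ∀ B, A * B = B * A := fun B => by
    have hB := ha.le_span ⊤ (fun _ _ _ => Submodule.mem_top) (Submodule.mem_top (x := B))
    induction hB using Submodule.span_induction with
    | mem B hB => exact h B hB.2
    | zero => simp
    | add B C _ _ hB hC => rw [mul_add, add_mul, hB, hC]
    | smul c B _ hB => rw [mul_smul_comm, smul_mul_assoc, hB]
  obtain ⟨c, hc⟩ := Matrix.mem_range_scalar_of_commute_single fun i j _ => (h1 _).symm
  exact ⟨c, hc.symm.trans (Matrix.smul_one_eq_diagonal c).symm⟩

/-- If conjugation by `A` commutes with the twisted Galois action, then a multiple of `A` is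
invariant. -/
theorem IsProjectiveCocycle.exists_smul_mem [FiniteDimensional k L] (ha : IsProjectiveCocycle a)
    {A : Matrix n n L} (hA : A ≠ 0)
    (h : ∀ g, ∃ c : L, (a g : Matrix n n L) * A.map g = c • (A * (a g : Matrix n n L))) :
    ∃ c : L, c ≠ 0 ∧ c • A ∈ twistedAlgebra a := by
  -- The line through `A` is stable, hence spanned by its invariant elements, one of which must be
  -- nonzero.
  have h1 := ha.le_span (Submodule.span L {A}) fun g B hB => by
    obtain ⟨b, rfl⟩ := Submodule.mem_span_singleton.mp hB
    obtain ⟨c, hc⟩ := h g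
    refine Submodule.mem_span_singleton.mpr ⟨g b * c, ?_⟩
    rw [Matrix.map_smul' _ _ _ (map_mul g), mul_smul_comm, hc, smul_mul_assoc, smul_mul_assoc,
      mul_assoc, ← Units.val_mul, mul_inv_cancel, Units.val_one, mul_one, smul_smul]
  by_contra! h2
  have h3 : {B | B ∈ Submodule.span L {A} ∧ B ∈ twistedAlgebra a} ⊆ {0} := by
    rintro B ⟨hB, hB'⟩
    obtain ⟨b, rfl⟩ := Submodule.mem_span_singleton.mp hB
    rcases eq_or_ne b 0 with rfl | hb
    · simp
    · exact absurd hB' (h2 b hb)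
  have h4 := h1.trans (Submodule.span_mono h3) (Submodule.mem_span_singleton_self A)
  rw [Submodule.span_zero_singleton] at h4
  exact hA h4

end TwistedAlgebra

/-! ### Invariant lines and zero divisors trivialize the cocycle -/

section Division

open Matrix

variable {k L : Type*} [Field k] [Field L] [Algebra k L] [FiniteDimensional k L]
  {n : Type*} [Fintype n] [DecidableEq n] {a : Gal(L/k) → GL n L}

/-- If the twisted Galois action has a stable line, then the cocycle is trivial up to scalars. -/
theorem IsProjectiveCocycle.exists_mul_map_eq_of_line (ha : IsProjectiveCocycle a)
    {v : n → L} (hv : v ≠ 0)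
    (h : ∀ g : Gal(L/k), ∃ c : L, (a g : Matrix n n L) *ᵥ (g ∘ v) = c • v) :
    ∃ B : GL n L, ∀ g : Gal(L/k), ∃ c : L,
      (a g : Matrix n n L) * (B : Matrix n n L).map g = c • (B : Matrix n n L) := by
  choose c hc using h
  have hav : ∀ g (w : n → L), w ≠ 0 → (a g : Matrix n n L) *ᵥ (g ∘ w) ≠ 0 := fun g w hw h0 => by
    refine hw ?_
    have h1 : (a g : Matrix n n L) *ᵥ (g ∘ w) = (a g : Matrix n n L) *ᵥ 0 := by
      rw [h0, Matrix.mulVec_zero]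
    have h2 := Matrix.mulVec_injective_of_isUnit (a g).isUnit h1
    ext i
    exact g.map_eq_zero_iff.mp (congrFun h2 i)
  have hc0 : ∀ g, c g ≠ 0 := fun g h0 => hav g v hv (by rw [hc, h0, zero_smul])
  -- Rescaling by `c g` makes `v` fixed. A priori `ρ (g * h)` and `ρ g ∘ ρ h` agree up to a scalar;
  -- comparing them at `v` shows they are equal. So the action on vectors is genuine, and a basis of
  -- fixed vectors gives the columns of `B`.
  let ρ (g : Gal(L/k)) (w : n → L) : n → L := (c g)⁻¹ • ((a g : Matrix n n L) *ᵥ (g ∘ w))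
  have hρv : ∀ g, ρ g v = v := fun g => by
    simp only [ρ]
    rw [hc, smul_smul, inv_mul_cancel₀ (hc0 g), one_smul]
  have hsmul : ∀ g (b : L) w, ρ g (b • w) = g b • ρ g w := fun g b w => by
    have h1 : g ∘ (b • w) = g b • (g ∘ w) := funext fun i => map_mul g _ _
    simp only [ρ]
    rw [h1, Matrix.mulVec_smul, smul_comm]
  have hmul : ∀ g h w, ρ (g * h) w = ρ g (ρ h w) := by
    intro g h
    obtain ⟨m, hm⟩ := ha g h
    have h1 : ∀ w, ρ (g * h) w = ((c (g * h))⁻¹ * m) •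
        ((a g : Matrix n n L) *ᵥ (g ∘ ((a h : Matrix n n L) *ᵥ (h ∘ w)))) := fun w => by
      have h2 : g ∘ ((a h : Matrix n n L) *ᵥ (h ∘ w)) =
          (a h : Matrix n n L).map g *ᵥ ((g * h : Gal(L/k)) ∘ w) :=
        funext fun i => RingHom.map_mulVec (g : L →+* L) _ _ i
      simp only [ρ]
      rw [hm, h2, Matrix.smul_mulVec, smul_smul, Matrix.mulVec_mulVec]
    have h2 : ∀ w, ρ g (ρ h w) = ((c g)⁻¹ * g (c h)⁻¹) •
        ((a g : Matrix n n L) *ᵥ (g ∘ ((a h : Matrix n n L) *ᵥ (h ∘ w)))) := fun w => by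
      rw [show ρ h w = (c h)⁻¹ • _ from rfl, hsmul]
      simp only [ρ]
      rw [smul_smul, mul_comm]
    have h3 : (c (g * h))⁻¹ * m = (c g)⁻¹ * g (c h)⁻¹ := by
      have h4 := (h1 v).symm.trans ((hρv _).trans (((hρv g).symm.trans
        (congrArg (ρ g) (hρv h).symm)).trans (h2 v)))
      exact smul_left_injective L (hav g _ (hav h v hv)) h4
    intro w
    rw [h1, h2, h3]
  have hone : ∀ w, ρ 1 w = w := fun w => by
    have hinj : Function.Injective (ρ 1) := fun x y hxy => by
      have h1 := smul_right_injective (n → L) (inv_ne_zero (hc0 1)) hxy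
      exact Matrix.mulVec_injective_of_isUnit (a 1).isUnit h1
    refine (hinj ?_).symm
    rw [← hmul, mul_one]
  have hspan := le_span_fixed ρ hmul hone (fun g x y => by
    have h1 : g ∘ (x + y) = g ∘ x + g ∘ y := funext fun i => map_add g _ _
    simp only [ρ]
    rw [h1, Matrix.mulVec_add, smul_add]) hsmul ⊤ (fun _ _ _ => Submodule.mem_top)
  let b₀ := Module.Basis.ofSpan hspan
  let b := b₀.reindex (b₀.indexEquiv (Pi.basisFun L n))
  have hb : ∀ i g, ρ g (b i) = b i := fun i g => by
    have h1 : b i ∈ Set.range b₀ := ⟨_, (b₀.reindex_apply _ i).symm⟩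
    exact (Module.Basis.ofSpan_subset hspan h1).2 g
  have hB : IsUnit ((Pi.basisFun L n).toMatrix b) := by
    have := (Pi.basisFun L n).invertibleToMatrix b
    exact isUnit_of_invertible _
  refine ⟨hB.unit, fun g => ⟨c g, ?_⟩⟩
  ext i j
  have h1 := congrArg (c g • ·) (hb j g)
  simp only [ρ] at h1
  rw [smul_smul, mul_inv_cancel₀ (hc0 g), one_smul] at h1
  exact congrFun h1 i

/-- A singular invariant matrix in degree three trivializes the cocycle up to scalars. -/
theorem IsProjectiveCocycle.exists_mul_map_eq {a : Gal(L/k) → GL (Fin 3) L}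
    (ha : IsProjectiveCocycle a) {A : Matrix (Fin 3) (Fin 3) L} (hA : A ∈ twistedAlgebra a)
    (hA0 : A ≠ 0) (hdet : A.det = 0) :
    ∃ B : GL (Fin 3) L, ∀ g : Gal(L/k), ∃ c : L,
      (a g : Matrix (Fin 3) (Fin 3) L) * (B : Matrix (Fin 3) (Fin 3) L).map g =
        c • (B : Matrix (Fin 3) (Fin 3) L) := by
  have hcomm : ∀ g w, A *ᵥ ((a g : Matrix (Fin 3) (Fin 3) L) *ᵥ (g ∘ w)) =
      (a g : Matrix (Fin 3) (Fin 3) L) *ᵥ (g ∘ (A *ᵥ w)) := fun g w => by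
    have h2 : g ∘ (A *ᵥ w) = A.map g *ᵥ (g ∘ w) :=
      funext fun i => RingHom.map_mulVec (g : L →+* L) _ _ i
    rw [h2, Matrix.mulVec_mulVec, Matrix.mulVec_mulVec, hA g]
  have hker : ∀ g, ∀ w ∈ LinearMap.ker A.mulVecLin,
      (a g : Matrix (Fin 3) (Fin 3) L) *ᵥ (g ∘ w) ∈ LinearMap.ker A.mulVecLin := fun g w hw => by
    rw [LinearMap.mem_ker, Matrix.mulVecLin_apply] at hw ⊢
    rw [hcomm, hw]
    rw [show g ∘ (0 : Fin 3 → L) = 0 from funext fun _ => map_zero g, Matrix.mulVec_zero]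
  have hrange : ∀ g, ∀ w ∈ LinearMap.range A.mulVecLin,
      (a g : Matrix (Fin 3) (Fin 3) L) *ᵥ (g ∘ w) ∈ LinearMap.range A.mulVecLin := by
    rintro g _ ⟨w, rfl⟩
    exact ⟨_, hcomm g w⟩
  have key : ∀ W : Submodule L (Fin 3 → L), Module.finrank L W = 1 →
      (∀ g, ∀ w ∈ W, (a g : Matrix (Fin 3) (Fin 3) L) *ᵥ (g ∘ w) ∈ W) →
      ∃ B : GL (Fin 3) L, ∀ g : Gal(L/k), ∃ c : L,
        (a g : Matrix (Fin 3) (Fin 3) L) * (B : Matrix (Fin 3) (Fin 3) L).map g =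
          c • (B : Matrix (Fin 3) (Fin 3) L) := fun W hW hst => by
    obtain ⟨v, hv, hvW⟩ := finrank_eq_one_iff'.mp hW
    refine ha.exists_mul_map_eq_of_line (v := v) (fun h => hv (Subtype.ext h)) fun g => ?_
    obtain ⟨c, hc⟩ := hvW ⟨_, hst g v v.2⟩
    exact ⟨c, (congrArg Subtype.val hc).symm⟩
  have hsum := LinearMap.finrank_range_add_finrank_ker A.mulVecLin
  rw [Module.finrank_fin_fun] at hsum
  have h1 : Module.finrank L (LinearMap.ker A.mulVecLin) ≠ 0 := by
    obtain ⟨v, hv, hv'⟩ := Matrix.exists_mulVec_eq_zero_iff.mpr hdet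
    intro h
    rw [Submodule.finrank_eq_zero] at h
    have h2 : v ∈ LinearMap.ker A.mulVecLin := hv'
    rw [h] at h2
    exact hv h2
  have h2 : Module.finrank L (LinearMap.range A.mulVecLin) ≠ 0 := by
    intro h
    rw [Submodule.finrank_eq_zero, LinearMap.range_eq_bot] at h
    refine hA0 (Matrix.ext_of_mulVec_single fun i => ?_)
    rw [Matrix.zero_mulVec]
    exact congrArg (fun f => f (Pi.single i 1)) h
  -- Kernel and image are stable and nonzero, and their dimensions add up to three, so one of them
  -- is a line.
  rcases (by omega : Module.finrank L (LinearMap.ker A.mulVecLin) = 1 ∨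
    Module.finrank L (LinearMap.range A.mulVecLin) = 1) with h | h
  · exact key _ h hker
  · exact key _ h hrange

end Division


/-! ### Automorphisms of the surface and invariant matrices -/

section Representatives

variable {k L : Type u} [Field k] [Field L] [Algebra k L] {S : Over (SpecOf k)}

theorem hom_left_inv_left {C : Type*} [Category C] {B : C} {X Y : Over B} (e : X ≅ Y) :
    e.hom.left ≫ e.inv.left = 𝟙 _ := by
  rw [← Over.comp_left, e.hom_inv_id, Over.id_left]

instance isIso_hom_left {C : Type*} [Category C] {B : C} {X Y : Over B} (e : X ≅ Y) :
    IsIso e.hom.left :=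
  ⟨e.inv.left, hom_left_inv_left e, hom_left_inv_left e.symm⟩

instance isIso_matrixMap {ι : Type} [Nonempty ι] [Fintype ι] [DecidableEq ι] (A : GL ι L) :
    IsIso (matrixMap A) :=
  ⟨matrixMap A⁻¹, by rw [matrixMap_mul, inv_mul_cancel, matrixMap_one],
    by rw [matrixMap_mul, mul_inv_cancel, matrixMap_one]⟩

/-- The automorphism of the projective plane given by a matrix. -/
def planeIso (A : GL (Fin 3) L) : projPlane L ≅ projPlane L :=
  Over.isoMk (asIso (matrixMap A)) (matrixMap_hom A)

theorem planeIso_hom_left (A : GL (Fin 3) L) : (planeIso A).hom.left = matrixMap A := rfl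

theorem galoisProj_one (ι : Type) [Nonempty ι] : galoisProj ι (1 : Gal(L/k)) = 𝟙 _ := by
  have h : projBase ι (RingHom.id L) = 𝟙 _ := by
    refine proj_hom_ext_generic ?_
    rw [genericPoint, point_projBase, RingHom.comp_id]
    exact (Category.comp_id _).symm
  refine Eq.trans ?_ h
  refine congrArg (projBase ι) (RingHom.ext fun x => ?_)
  change (1 : Gal(L/k))⁻¹ x = x
  rw [inv_one]
  rfl

instance isIso_galoisProj (ι : Type) [Nonempty ι] (g : Gal(L/k)) : IsIso (galoisProj ι g) :=
  ⟨galoisProj ι g⁻¹, by rw [← galoisProj_mul, inv_mul_cancel, galoisProj_one],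
    by rw [← galoisProj_mul, mul_inv_cancel, galoisProj_one]⟩

namespace Splitting

variable (s : Splitting S L)

theorem galoisAct_hom (g : Gal(L/k)) :
    galoisAct S g ≫ s.φ.hom.left =
      s.φ.hom.left ≫ galoisProj (Fin 3) g ≫ matrixMap (s.mat g) := by
  rw [← s.mat_spec]
  have h := hom_left_inv_left s.φ
  rw [← Category.assoc s.φ.hom.left]
  exact ((congrArg (· ≫ _) h).trans (Category.id_comp _)).symm

/-- The action on `S_L` is multiplicative in `g`; transported to the plane this gives `[A_{gh}] =
[A_g A_h^g]`, and a matrix is determined by its map up to a scalar. -/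
theorem isProjectiveCocycle : IsProjectiveCocycle s.mat := by
  intro g h
  have h1 : s.φ.hom.left ≫ galoisProj (Fin 3) (g * h) ≫ matrixMap (s.mat (g * h)) =
      s.φ.hom.left ≫ galoisProj (Fin 3) (g * h) ≫
        matrixMap (s.mat g * Matrix.GeneralLinearGroup.map (g : L →+* L) (s.mat h)) := by
    rw [← galoisAct_hom, galoisAct_mul, Category.assoc, galoisAct_hom, ← Category.assoc,
      galoisAct_hom, galoisProj_mul, ← matrixMap_mul]
    simp only [Category.assoc]
    rw [← Category.assoc (matrixMap (s.mat h)), matrixMap_galoisProj, Category.assoc]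
  rw [cancel_epi, cancel_epi] at h1
  exact matrixMap_eq_iff.mp h1.symm

theorem isAffineRep_iff {α : Aut S} {A : GL (Fin 3) L} : s.IsAffineRep α A ↔
    ((baseChange k L).map α.hom).left ≫ s.φ.hom.left = s.φ.hom.left ≫ matrixMap A ∧
      (A : Matrix (Fin 3) (Fin 3) L) ∈ twistedAlgebra s.mat := by
  refine and_congr ?_ ?_
  · rw [← cancel_epi s.φ.hom.left]
    have h := hom_left_inv_left s.φ
    rw [← Category.assoc]
    exact (congrArg (· = _) ((congrArg (· ≫ _) h).trans (Category.id_comp _))).to_iff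
  · refine forall_congr' fun g => ?_
    rw [mul_assoc, eq_inv_mul_iff_mul_eq, Units.ext_iff]
    rfl

variable {s}

theorem IsAffineRep.mul {α β : Aut S} {A B : GL (Fin 3) L} (hA : s.IsAffineRep α A)
    (hB : s.IsAffineRep β B) : s.IsAffineRep (α * β) (A * B) := by
  rw [isAffineRep_iff] at hA hB ⊢
  refine ⟨?_, by rw [Units.val_mul]; exact mul_mem hA.2 hB.2⟩
  have h1 : ((baseChange k L).map (α * β).hom).left =
      ((baseChange k L).map β.hom).left ≫ ((baseChange k L).map α.hom).left := by
    rw [← Over.comp_left, ← Functor.map_comp]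
    rfl
  rw [h1, Category.assoc, hA.1, ← Category.assoc, hB.1, Category.assoc, matrixMap_mul]

theorem IsAffineRep.inv {α : Aut S} {A : GL (Fin 3) L} (hA : s.IsAffineRep α A) :
    s.IsAffineRep α⁻¹ A⁻¹ := by
  rw [isAffineRep_iff] at hA ⊢
  refine ⟨?_, ?_⟩
  · have h1 : ((baseChange k L).map (α⁻¹ : Aut S).hom).left ≫
        ((baseChange k L).map α.hom).left = 𝟙 _ := by
      rw [← Over.comp_left, ← Functor.map_comp]
      have : (α⁻¹ : Aut S).hom ≫ α.hom = 𝟙 S := α.inv_hom_id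
      rw [this, CategoryTheory.Functor.map_id, Over.id_left]
    rw [← cancel_mono (matrixMap A), Category.assoc, ← hA.1, ← Category.assoc, h1,
      Category.id_comp, Category.assoc, matrixMap_mul, mul_inv_cancel, matrixMap_one,
      Category.comp_id]
  · rw [Matrix.coe_units_inv]
    exact inv_mem_twistedAlgebra hA.2

theorem IsAffineRep.ext {α β : Aut S} {A B : GL (Fin 3) L} (hA : s.IsAffineRep α A)
    (hB : s.IsAffineRep β B) {c : L} (h : (B : Matrix (Fin 3) (Fin 3) L) = c • (A : Matrix _ _ L)) :
    α = β := by
  rw [isAffineRep_iff] at hA hB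
  have h1 : matrixMap A = matrixMap B := matrixMap_eq_iff.mpr ⟨c, h⟩
  refine Iso.ext (baseChange_map_injective (L := L) (Over.OverMorphism.ext ?_))
  exact (cancel_mono s.φ.hom.left).mp (hA.1.trans ((congrArg (_ ≫ ·) h1).trans hB.1.symm))

variable (s)

/-- Linearity of plane automorphisms yields some matrix. As `α` is defined over `k`, it commutes
with the Galois action, so this matrix is invariant up to scalars and a multiple of it is invariant.
-/
theorem exists_isAffineRep [FiniteDimensional k L] (α : Aut S) : ∃ A, s.IsAffineRep α A := by
  let r (α : Aut S) : projPlane L ⟶ projPlane L :=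
    s.φ.inv ≫ (baseChange k L).map α.hom ≫ s.φ.hom
  have hr : ∀ α : Aut S, r α ≫ r α⁻¹ = 𝟙 _ := fun α => by
    have : α.hom ≫ (α⁻¹ : Aut S).hom = 𝟙 S := α.hom_inv_id
    simp only [r, Category.assoc, Iso.hom_inv_id_assoc]
    rw [← Functor.map_comp_assoc, this, CategoryTheory.Functor.map_id, Category.id_comp, Iso.inv_hom_id]
  obtain ⟨A, hA⟩ := exists_eq_matrixMap (r α).left (r α⁻¹).left
    (by rw [← Over.comp_left, hr, Over.id_left]) (Over.w (r α)) (Over.w (r α⁻¹))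
  have hA' : ((baseChange k L).map α.hom).left ≫ s.φ.hom.left = s.φ.hom.left ≫ matrixMap A := by
    rw [← hA]
    change _ = (s.φ.hom ≫ s.φ.inv ≫ (baseChange k L).map α.hom ≫ s.φ.hom).left
    rw [Iso.hom_inv_id_assoc]
    rfl
  have hcomm : ∀ g : Gal(L/k), ∃ c : L, ((s.mat g : Matrix (Fin 3) (Fin 3) L) *
      (A : Matrix (Fin 3) (Fin 3) L).map g) =
        c • ((A : Matrix (Fin 3) (Fin 3) L) * (s.mat g : Matrix (Fin 3) (Fin 3) L)) := fun g => by
    have h1 := congrArg (· ≫ s.φ.hom.left) (baseChange_map_galoisAct α.hom g)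
    simp only [Category.assoc] at h1
    rw [galoisAct_hom, hA', ← Category.assoc, hA', ← Category.assoc (galoisAct S g),
      galoisAct_hom] at h1
    simp only [Category.assoc] at h1
    rw [cancel_epi, matrixMap_mul, ← Category.assoc, matrixMap_galoisProj, Category.assoc,
      cancel_epi, matrixMap_mul] at h1
    exact matrixMap_eq_iff.mp h1.symm
  obtain ⟨c, hc, hcA⟩ := s.isProjectiveCocycle.exists_smul_mem A.ne_zero hcomm
  have hdet : ((c • (A : Matrix (Fin 3) (Fin 3) L))).det ≠ 0 := by
    rw [Matrix.det_smul]
    exact mul_ne_zero (pow_ne_zero _ hc) (Matrix.isUnits_det_units A).ne_zero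
  refine ⟨Matrix.GeneralLinearGroup.mkOfDetNeZero _ hdet, s.isAffineRep_iff.mpr ⟨?_, hcA⟩⟩
  rw [hA']
  exact congrArg (_ ≫ ·) (matrixMap_eq_iff.mpr ⟨c, rfl⟩)

/-- Invariance of `A` says that `[A]`, carried over to `S_L`, commutes with the Galois action; hence
it descends. -/
theorem exists_aut_isAffineRep [FiniteDimensional k L] [IsGalois k L] {A : GL (Fin 3) L}
    (hA : (A : Matrix (Fin 3) (Fin 3) L) ∈ twistedAlgebra s.mat) :
    ∃ α : Aut S, s.IsAffineRep α A := by
  have h1 : (s.φ ≪≫ planeIso A ≪≫ s.φ.symm).hom.left ≫ s.φ.hom.left =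
      s.φ.hom.left ≫ matrixMap A := by
    rw [← Over.comp_left, Iso.trans_hom, Iso.trans_hom, Iso.symm_hom, Category.assoc,
      Category.assoc, Iso.inv_hom_id, Category.comp_id, Over.comp_left, planeIso_hom_left]
  obtain ⟨α, hα⟩ := exists_iso_baseChange_map_eq (s.φ ≪≫ planeIso A ≪≫ s.φ.symm) fun g => by
    rw [← cancel_mono s.φ.hom.left, Category.assoc, Category.assoc, galoisAct_hom, h1,
      ← Category.assoc, galoisAct_hom]
    refine Eq.trans ?_ (Category.assoc _ _ _)
    refine Eq.trans ?_ (congrArg (· ≫ _) h1.symm)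
    simp only [Category.assoc]
    rw [matrixMap_mul, ← Category.assoc (matrixMap A), matrixMap_galoisProj, Category.assoc,
      matrixMap_mul]
    exact congrArg (fun t => _ ≫ _ ≫ matrixMap t) (Units.ext (hA g).symm)
  exact ⟨α, s.isAffineRep_iff.mpr ⟨by rw [hα, h1], hA⟩⟩

variable (k L) in
/-- The base change of the projective plane. -/
def planeBaseChange : projPlane L ≅ (baseChange k L).obj (projPlane k) :=
  Over.isoMk (isPullback_projBase (ι := Fin 3) (algebraMap k L)).isoPullback
    (isPullback_projBase (ι := Fin 3) (algebraMap k L)).isoPullback_hom_snd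

theorem galoisProj_planeBaseChange (g : Gal(L/k)) :
    galoisProj (Fin 3) g ≫ (planeBaseChange k L).hom.left =
      (planeBaseChange k L).hom.left ≫ galoisAct (projPlane k) g := by
  have h1 : (planeBaseChange k L).hom.left ≫
      Limits.pullback.fst (projPlane k).hom (specMap k L) = projBase (Fin 3) (algebraMap k L) :=
    (isPullback_projBase (ι := Fin 3) (algebraMap k L)).isoPullback_hom_fst
  have h2 : (planeBaseChange k L).hom.left ≫
      Limits.pullback.snd (projPlane k).hom (specMap k L) = (projPlane L).hom :=
    (isPullback_projBase (ι := Fin 3) (algebraMap k L)).isoPullback_hom_snd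
  apply Limits.pullback.hom_ext
  · refine (Category.assoc _ _ _).trans (Eq.trans ?_ (Category.assoc _ _ _).symm)
    rw [galoisAct_fst, h1]
    refine (projBase_comp _ _).trans (congrArg (projBase _) (RingHom.ext fun x => ?_))
    exact (g⁻¹).commutes x
  · refine (Category.assoc _ _ _).trans (Eq.trans ?_ (Category.assoc _ _ _).symm)
    rw [galoisAct_snd, h2, ← Category.assoc, h2]
    exact galoisProj_hom g

/-- `B⁻¹ A_g` is proportional to `(B⁻¹)^g`, so composing `φ` with `[B⁻¹]` turns the twisted action
into the standard one, and the isomorphism descends to `k`. -/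
theorem isTrivial_of_exists [FiniteDimensional k L] [IsGalois k L] {B : GL (Fin 3) L}
    (hB : ∀ g : Gal(L/k), ∃ c : L,
      (s.mat g : Matrix (Fin 3) (Fin 3) L) * (B : Matrix (Fin 3) (Fin 3) L).map g =
        c • (B : Matrix (Fin 3) (Fin 3) L)) : IsTrivial S := by
  obtain ⟨f, -⟩ := exists_iso_baseChange_map_eq (s.φ ≪≫ planeIso B⁻¹ ≪≫ planeBaseChange k L)
    fun g => by
      have h1 : (s.φ ≪≫ planeIso B⁻¹ ≪≫ planeBaseChange k L).hom.left =
          s.φ.hom.left ≫ matrixMap B⁻¹ ≫ (planeBaseChange k L).hom.left := rfl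
      have h2 : matrixMap (B⁻¹ * s.mat g) =
          matrixMap (Matrix.GeneralLinearGroup.map (g : L →+* L) B⁻¹) := by
        obtain ⟨c, hc⟩ := hB g
        refine Eq.symm (matrixMap_eq_iff.mpr ⟨c, ?_⟩)
        have h3 : (B : Matrix (Fin 3) (Fin 3) L).map g *
            (Matrix.GeneralLinearGroup.map (g : L →+* L) B⁻¹ : GL (Fin 3) L) = 1 := by
          have h4 := congrArg (Units.val : GL (Fin 3) L → _)
            (map_mul (Matrix.GeneralLinearGroup.map (n := Fin 3) (g : L →+* L)) B B⁻¹)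
          rw [mul_inv_cancel, map_one] at h4
          exact h4.symm
        calc ((B⁻¹ * s.mat g : GL (Fin 3) L) : Matrix (Fin 3) (Fin 3) L)
            = (B⁻¹ : GL (Fin 3) L) * (s.mat g * ((B : Matrix (Fin 3) (Fin 3) L).map g *
                (Matrix.GeneralLinearGroup.map (g : L →+* L) B⁻¹ : GL (Fin 3) L))) := by
              rw [h3, mul_one, Units.val_mul]
          _ = _ := by
              rw [← mul_assoc (s.mat g : Matrix (Fin 3) (Fin 3) L), hc, smul_mul_assoc,
                mul_smul_comm, ← mul_assoc, ← Units.val_mul, inv_mul_cancel, Units.val_one, one_mul]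
      rw [h1, ← Category.assoc, galoisAct_hom]
      simp only [Category.assoc]
      rw [← galoisProj_planeBaseChange, ← Category.assoc (matrixMap (s.mat g)), matrixMap_mul, h2,
        ← Category.assoc (matrixMap B⁻¹), matrixMap_galoisProj, Category.assoc]
  exact ⟨f⟩

/-- If `S` is non-trivial, then the algebra of invariant matrices is a division algebra. -/
theorem det_ne_zero [FiniteDimensional k L] [IsGalois k L] (hS : ¬ IsTrivial S)
    {A : Matrix (Fin 3) (Fin 3) L} (hA : A ∈ twistedAlgebra s.mat) (hA0 : A ≠ 0) : A.det ≠ 0 :=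
  fun h => hS <|
    let ⟨_, hB⟩ := s.isProjectiveCocycle.exists_mul_map_eq hA hA0 h
    s.isTrivial_of_exists hB

end Splitting

end Representatives


/-! ### Extension and comparison of splittings -/

section SplittingBaseChange

open Limits

variable {k L E : Type u} [Field k] [Field L] [Field E] [Algebra k L] [Algebra k E] [Algebra L E]
  [IsScalarTower k L E] {S : Over (SpecOf k)}

variable (k L E) in
theorem specMap_comp : specMap L E ≫ specMap k L = specMap k E := by
  rw [← Spec.map_comp, ← CommRingCat.ofHom_comp, ← IsScalarTower.algebraMap_eq]

variable (L E) in
/-- The projection `X_E ⟶ X_L`. -/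
def baseChangeProj (X : Over (SpecOf k)) :
    ((baseChange k E).obj X).left ⟶ ((baseChange k L).obj X).left :=
  pullback.lift (pullback.fst X.hom (specMap k E)) (pullback.snd X.hom (specMap k E) ≫ specMap L E)
    (by rw [Category.assoc, specMap_comp, pullback.condition])

theorem baseChangeProj_fst (X : Over (SpecOf k)) :
    baseChangeProj L E X ≫ pullback.fst X.hom (specMap k L) = pullback.fst X.hom (specMap k E) :=
  pullback.lift_fst ..

theorem baseChangeProj_snd (X : Over (SpecOf k)) :
    baseChangeProj L E X ≫ pullback.snd X.hom (specMap k L) =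
      pullback.snd X.hom (specMap k E) ≫ specMap L E :=
  pullback.lift_snd ..

theorem isPullback_baseChangeProj (X : Over (SpecOf k)) :
    IsPullback (baseChangeProj L E X) ((baseChange k E).obj X).hom ((baseChange k L).obj X).hom
      (specMap L E) := by
  have h1 : IsPullback (pullback.fst X.hom (specMap k L)) (pullback.snd X.hom (specMap k L))
    X.hom (specMap k L) := IsPullback.of_hasPullback _ _
  have h2 : IsPullback (pullback.fst X.hom (specMap k E)) (pullback.snd X.hom (specMap k E))
    X.hom (specMap k E) := IsPullback.of_hasPullback _ _
  have h3 : IsPullback (baseChangeProj L E X ≫ pullback.fst X.hom (specMap k L))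
      (pullback.snd X.hom (specMap k E)) X.hom (specMap L E ≫ specMap k L) := by
    rw [baseChangeProj_fst, specMap_comp]
    exact h2
  exact IsPullback.of_right h3 (baseChangeProj_snd X) h1

theorem baseChange_map_baseChangeProj {X Y : Over (SpecOf k)} (f : X ⟶ Y) :
    ((baseChange k E).map f).left ≫ baseChangeProj L E Y =
      baseChangeProj L E X ≫ ((baseChange k L).map f).left := by
  apply pullback.hom_ext
  · refine (Category.assoc _ _ _).trans (Eq.trans ?_ (Category.assoc _ _ _).symm)
    rw [baseChangeProj_fst, baseChange_map_fst (L := L), ← Category.assoc (baseChangeProj L E X),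
      baseChangeProj_fst]
    exact baseChange_map_fst f
  · have h1 : ((baseChange k L).map f).left ≫ pullback.snd Y.hom (specMap k L) =
      pullback.snd X.hom (specMap k L) := Over.w ((baseChange k L).map f)
    have h2 : ((baseChange k E).map f).left ≫ pullback.snd Y.hom (specMap k E) =
      pullback.snd X.hom (specMap k E) := Over.w ((baseChange k E).map f)
    refine (Category.assoc _ _ _).trans (Eq.trans ?_ (Category.assoc _ _ _).symm)
    rw [baseChangeProj_snd, h1, baseChangeProj_snd, ← h2]
    exact (Category.assoc _ _ _).symm

theorem galoisAct_baseChangeProj [Normal k L] (X : Over (SpecOf k)) (g : Gal(E/k)) :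
    galoisAct X g ≫ baseChangeProj L E X =
      baseChangeProj L E X ≫ galoisAct X (g.restrictNormal L) := by
  apply pullback.hom_ext
  · refine (Category.assoc _ _ _).trans (Eq.trans ?_ (Category.assoc _ _ _).symm)
    rw [galoisAct_fst, baseChangeProj_fst]
    exact galoisAct_fst X g
  · refine (Category.assoc _ _ _).trans (Eq.trans ?_ (Category.assoc _ _ _).symm)
    rw [galoisAct_snd, baseChangeProj_snd, ← Category.assoc, ← Category.assoc, baseChangeProj_snd]
    refine (congrArg (· ≫ _) (galoisAct_snd X g)).trans ?_
    rw [Category.assoc, Category.assoc, ← Spec.map_comp, ← Spec.map_comp, ← CommRingCat.ofHom_comp,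
      ← CommRingCat.ofHom_comp]
    congr 3
    ext x
    have h : (g.restrictNormal L)⁻¹ = (g⁻¹).restrictNormal L :=
      (map_inv (AlgEquiv.restrictNormalHom L) g).symm
    change g⁻¹ (algebraMap L E x) = algebraMap L E ((g.restrictNormal L)⁻¹ x)
    rw [h, AlgEquiv.restrictNormal_commutes]

variable (L E) in
/-- The projection `ℙ²_E ⟶ ℙ²_L`. -/
def planeProj : (projPlane E).left ⟶ (projPlane L).left := projBase (Fin 3) (algebraMap L E)

variable (L E) in
theorem isPullback_planeProj :
    IsPullback (planeProj L E) (projPlane E).hom (projPlane L).hom (specMap L E) :=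
  isPullback_projBase _

theorem matrixMap_planeProj (A : GL (Fin 3) L) :
    matrixMap (Matrix.GeneralLinearGroup.map (algebraMap L E) A) ≫ planeProj L E =
      planeProj L E ≫ matrixMap A :=
  projLin_projBase _ A

theorem galoisProj_planeProj [Normal k L] (g : Gal(E/k)) :
    galoisProj (Fin 3) g ≫ planeProj L E =
      planeProj L E ≫ galoisProj (Fin 3) (g.restrictNormal L) := by
  refine (projBase_comp _ _).trans (Eq.trans ?_ (projBase_comp _ _).symm)
  congr 1
  ext x
  have h : (g.restrictNormal L)⁻¹ = (g⁻¹).restrictNormal L :=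
    (map_inv (AlgEquiv.restrictNormalHom L) g).symm
  change g⁻¹ (algebraMap L E x) = algebraMap L E ((g.restrictNormal L)⁻¹ x)
  rw [h, AlgEquiv.restrictNormal_commutes]

variable (E) in
theorem exists_plane_iso (φ : (baseChange k L).obj S ≅ projPlane L) :
    ∃ ψ : (baseChange k E).obj S ≅ projPlane E,
      ψ.hom.left ≫ planeProj L E = baseChangeProj L E S ≫ φ.hom.left := by
  have h1 : IsPullback φ.hom.left ((baseChange k L).obj S).hom (projPlane L).hom (𝟙 _) :=
    IsPullback.of_horiz_isIso ⟨(Over.w φ.hom).trans (Category.comp_id _).symm⟩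
  have h2 := (isPullback_baseChangeProj (L := L) (E := E) S).paste_horiz h1
  rw [Category.comp_id] at h2
  have h3 := isPullback_planeProj L E
  exact ⟨Over.isoMk (IsPullback.isoIsPullback _ _ h2 h3)
    (IsPullback.isoIsPullback_hom_snd _ _ h2 h3), IsPullback.isoIsPullback_hom_fst _ _ h2 h3⟩

namespace Splitting

/-- The base change of a splitting. -/
theorem exists_baseChange [Normal k L] (s : Splitting S L) : ∃ s' : Splitting S E,
    ∀ (α : Aut S) (A : GL (Fin 3) L), s.IsAffineRep α A →
      s'.IsAffineRep α (Matrix.GeneralLinearGroup.map (algebraMap L E) A) := by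
  obtain ⟨ψ, hψ⟩ := exists_plane_iso E s.φ
  have hP := isPullback_planeProj L E
  have h1 : ψ.hom.left ≫ (projPlane E).hom = ((baseChange k E).obj S).hom := Over.w ψ.hom
  have hact : ∀ g : Gal(E/k), galoisAct S g ≫ ψ.hom.left = ψ.hom.left ≫ galoisProj (Fin 3) g ≫
      matrixMap (Matrix.GeneralLinearGroup.map (algebraMap L E) (s.mat (g.restrictNormal L))) :=
    fun g => by
      refine hP.hom_ext ?_ ?_
      · simp only [Category.assoc]
        rw [hψ, ← Category.assoc, galoisAct_baseChangeProj, Category.assoc, galoisAct_hom,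
          ← Category.assoc, ← hψ, matrixMap_planeProj]
        simp only [Category.assoc]
        rw [← Category.assoc (galoisProj _ _), galoisProj_planeProj, Category.assoc]
      · simp only [Category.assoc]
        rw [h1, matrixMap_hom, galoisProj_hom, ← Category.assoc, h1]
        exact galoisAct_snd S g
  refine ⟨⟨ψ, fun g => Matrix.GeneralLinearGroup.map (algebraMap L E) (s.mat (g.restrictNormal L)),
    fun g => ?_⟩, fun α A hA => ?_⟩
  · rw [hact, ← Category.assoc]
    exact (congrArg (· ≫ _) (hom_left_inv_left ψ.symm)).trans (Category.id_comp _)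
  · rw [isAffineRep_iff] at hA ⊢
    refine ⟨?_, fun g => ?_⟩
    · change _ ≫ ψ.hom.left = ψ.hom.left ≫ _
      refine hP.hom_ext ?_ ?_
      · simp only [Category.assoc]
        rw [matrixMap_planeProj, ← Category.assoc ψ.hom.left, hψ, Category.assoc, ← hA.1,
          ← Category.assoc, ← Category.assoc]
        exact congrArg (· ≫ _) (baseChange_map_baseChangeProj (L := L) (E := E) α.hom)
      · simp only [Category.assoc]
        rw [h1, matrixMap_hom, h1]
        exact Over.w ((baseChange k E).map α.hom)
    · have h1 := congrArg (fun M => M.map (algebraMap L E)) (hA.2 (g.restrictNormal L))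
      simp only [Matrix.map_mul] at h1
      refine Eq.trans ?_ h1
      refine congrArg (_ * ·) (Matrix.ext fun i j => ?_)
      exact (AlgEquiv.restrictNormal_commutes g L _).symm

/-- Affine representatives for two splittings over the same extension have determinants that differ
by a cube. -/
theorem exists_det_eq_mul [IsGalois k E] (s s' : Splitting S E) {α : Aut S} {A A' : GL (Fin 3) E}
    (hA : s.IsAffineRep α A) (hA' : s'.IsAffineRep α A') :
    ∃ c : k, (A' : Matrix (Fin 3) (Fin 3) E).det =
      algebraMap k E c ^ 3 * (A : Matrix (Fin 3) (Fin 3) E).det := by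
  have hw : ∀ e : projPlane E ≅ projPlane E, ∃ B, e.hom.left = matrixMap B := fun e =>
    exists_eq_matrixMap e.hom.left e.inv.left (hom_left_inv_left e) (Over.w e.hom) (Over.w e.inv)
  -- `B` compares the two splittings: `A'` is the conjugate of `A` by `B` times a scalar `l`, so the
  -- determinants differ by `l ^ 3`. It remains to see that `l` lies in `k`.
  obtain ⟨B, hB⟩ := hw (s.φ.symm ≪≫ s'.φ)
  have hB' : s'.φ.hom.left = s.φ.hom.left ≫ matrixMap B := by
    rw [← hB, ← Over.comp_left]
    simp
  rw [isAffineRep_iff] at hA hA'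
  have h1 : matrixMap (B * A) = matrixMap (A' * B) := by
    rw [← cancel_epi s.φ.hom.left, ← matrixMap_mul, ← matrixMap_mul, ← Category.assoc, ← hA.1,
      Category.assoc, ← hB', hA'.1, hB', Category.assoc]
  obtain ⟨l, hl⟩ := matrixMap_eq_iff.mp h1
  have hBdet := (Matrix.isUnits_det_units B).ne_zero
  have hdet : (A' : Matrix (Fin 3) (Fin 3) E).det =
      l ^ 3 * (A : Matrix (Fin 3) (Fin 3) E).det := by
    have h2 := congrArg Matrix.det hl
    rw [Units.val_mul, Units.val_mul, Matrix.det_smul, Matrix.det_mul, Matrix.det_mul,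
      Fintype.card_fin] at h2
    refine mul_right_cancel₀ hBdet (h2.trans ?_)
    ring
  have hl0 : l ≠ 0 := fun h => (Matrix.isUnits_det_units A').ne_zero (by
    rw [hdet, h, zero_pow three_ne_zero, zero_mul])
  suffices h : l ∈ Set.range (algebraMap k E) by
    obtain ⟨c, hc⟩ := h
    exact ⟨c, by rw [hc, hdet]⟩
  rw [InfiniteGalois.mem_range_algebraMap_iff_fixed]
  intro g
  -- The two cocycles are related through `B` up to a scalar `m`. Computing `s'.mat g * (A'.map g *
  -- Bg)` by Galois conjugating `hl`, or by the invariance of `A'`, gives `g l * m = l * m`.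
  have h2 : matrixMap (B * s.mat g) =
      matrixMap (s'.mat g * Matrix.GeneralLinearGroup.map (g : E →+* E) B) := by
    have h3 := s'.galoisAct_hom g
    rw [hB', ← Category.assoc, galoisAct_hom] at h3
    simp only [Category.assoc] at h3
    rw [cancel_epi, ← Category.assoc (matrixMap B), matrixMap_galoisProj, Category.assoc,
      cancel_epi, matrixMap_mul, matrixMap_mul] at h3
    exact h3
  obtain ⟨m, hm⟩ := matrixMap_eq_iff.mp h2
  simp only [Units.val_mul] at hl hm
  set Bg : Matrix (Fin 3) (Fin 3) E :=
    ((Matrix.GeneralLinearGroup.map (n := Fin 3) (g : E →+* E) B : GL (Fin 3) E) :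
      Matrix (Fin 3) (Fin 3) E) with hBg
  have hlg : (A' : Matrix (Fin 3) (Fin 3) E).map g * Bg =
      g l • (Bg * (A : Matrix (Fin 3) (Fin 3) E).map g) := by
    have h3 := congrArg (fun M => M.map g) hl
    simp only [Matrix.map_mul, Matrix.map_smul' _ _ _ (map_mul g)] at h3
    exact h3
  have h4 : (s'.mat g : Matrix (Fin 3) (Fin 3) E) *
      ((A' : Matrix (Fin 3) (Fin 3) E).map g * Bg) =
        (g l * m) • ((B : Matrix (Fin 3) (Fin 3) E) * A * s.mat g) := by
    rw [hlg, mul_smul_comm, ← mul_assoc, hm, smul_mul_assoc, smul_smul, mul_assoc, hA.2 g,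
      ← mul_assoc]
  have h5 : (s'.mat g : Matrix (Fin 3) (Fin 3) E) *
      ((A' : Matrix (Fin 3) (Fin 3) E).map g * Bg) =
        (l * m) • ((B : Matrix (Fin 3) (Fin 3) E) * A * s.mat g) := by
    rw [← mul_assoc, hA'.2 g, mul_assoc, hm, mul_smul_comm, ← mul_assoc, hl, smul_mul_assoc,
      smul_smul, mul_comm]
  have hne : (B : Matrix (Fin 3) (Fin 3) E) * A * s.mat g ≠ 0 := (B * A * s.mat g).ne_zero
  have hm0 : m ≠ 0 := by
    rintro rfl
    rw [zero_smul] at hm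
    exact (s'.mat g * Matrix.GeneralLinearGroup.map (g : E →+* E) B).ne_zero hm
  exact mul_right_cancel₀ hm0 (smul_left_injective E hne (h4.symm.trans h5))

end Splitting

end SplittingBaseChange


/-! ### The determinant homomorphism and its kernel -/

section DeterminantMap

variable {k L : Type u} [Field k] [Field L] [Algebra k L] {S : Over (SpecOf k)}

namespace Splitting

variable {s : Splitting S L}

theorem IsAffineRep.exists_det_eq [IsGalois k L] {α : Aut S} {A : GL (Fin 3) L}
    (hA : s.IsAffineRep α A) :
    ∃ d : kˣ, algebraMap k L (d : k) = (A : Matrix (Fin 3) (Fin 3) L).det := by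
  obtain ⟨t, ht⟩ := SeveriBrauer.exists_det_eq (s.isAffineRep_iff.mp hA).2
  have h0 : t ≠ 0 := by
    rintro rfl
    rw [map_zero] at ht
    exact (Matrix.isUnits_det_units A).ne_zero ht
  exact ⟨Units.mk0 t h0, ht.symm⟩

theorem IsAffineRep.smul {α : Aut S} {A B : GL (Fin 3) L} (hA : s.IsAffineRep α A) {c : k}
    (hB : (B : Matrix (Fin 3) (Fin 3) L) = c • (A : Matrix (Fin 3) (Fin 3) L)) :
    s.IsAffineRep α B := by
  rw [isAffineRep_iff] at hA ⊢
  refine ⟨hA.1.trans (congrArg (_ ≫ ·) (matrixMap_eq_iff.mpr ⟨algebraMap k L c, ?_⟩)), ?_⟩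
  · rw [hB, algebraMap_smul]
  · rw [hB]
    exact Subalgebra.smul_mem _ hA.2 c

theorem isAffineRep_one (s : Splitting S L) : s.IsAffineRep 1 1 := by
  rw [isAffineRep_iff]
  refine ⟨?_, one_mem _⟩
  have h : ((baseChange k L).map (1 : Aut S).hom).left = 𝟙 _ := by
    change ((baseChange k L).map (𝟙 S)).left = _
    rw [CategoryTheory.Functor.map_id, Over.id_left]
  rw [h, matrixMap_one, Category.id_comp]
  exact (Category.comp_id _).symm

/-- Automorphisms with an affine representative whose determinant is a cube are products of
commutators. -/
theorem IsAffineRep.mem_commutator [FiniteDimensional k L] [IsGalois k L] (hS : ¬ IsTrivial S)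
    {α : Aut S} {A : GL (Fin 3) L} (hA : s.IsAffineRep α A) {c : kˣ}
    (hd : (A : Matrix (Fin 3) (Fin 3) L).det = algebraMap k L c ^ 3) : α ∈ commutator (Aut S) := by
  -- Dividing by `c` gives a representative of determinant one.
  set d : Matrix (Fin 3) (Fin 3) L := (c⁻¹ : kˣ).val • (A : Matrix (Fin 3) (Fin 3) L) with hdA
  have hc0 : algebraMap k L c ≠ 0 := (map_ne_zero _).mpr c.ne_zero
  have hd1 : d.det = 1 := by
    rw [hdA, ← algebraMap_smul L, Matrix.det_smul, hd, Fintype.card_fin, ← mul_pow, ← map_mul,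
      Units.inv_mul, map_one, one_pow]
  have hu : IsUnit d := (Matrix.isUnit_iff_isUnit_det _).mpr (by rw [hd1]; exact isUnit_one)
  have hD : s.IsAffineRep α hu.unit := hA.smul hdA
  have hdD : d ∈ twistedAlgebra s.mat := (s.isAffineRep_iff.mp hD).2
  -- Scalars are excluded from `exists_eq_commutator`, but they represent the identity.
  by_cases hds : ∃ l : L, d = l • 1
  · obtain ⟨l, hl⟩ := hds
    have h1 : (1 : Aut S) = α := s.isAffineRep_one.ext hD hl
    rw [← h1]
    exact one_mem _
  push Not at hds
  obtain ⟨x, hx, y, hy, hx0, hy0, hxy⟩ := exists_eq_commutator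
    (fun A hA hA0 => s.det_ne_zero hS hA hA0) (fun A hA => inv_mem_twistedAlgebra hA)
    (fun A hA => exists_trace_eq hA) (fun A hA => SeveriBrauer.exists_det_eq hA)
    (fun A _ h => s.isProjectiveCocycle.exists_eq_smul_one h) hdD hd1 hds
  have hxu : IsUnit x := (Matrix.isUnit_iff_isUnit_det _).mpr (s.det_ne_zero hS hx hx0).isUnit
  have hyu : IsUnit y := (Matrix.isUnit_iff_isUnit_det _).mpr (s.det_ne_zero hS hy hy0).isUnit
  obtain ⟨ξ, hξ⟩ := s.exists_aut_isAffineRep (A := hxu.unit) hx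
  obtain ⟨η, hη⟩ := s.exists_aut_isAffineRep (A := hyu.unit) hy
  have h1 : α * (η * ξ) = ξ * η := (hD.mul (hη.mul hξ)).ext (hξ.mul hη) (c := 1) (by
    rw [one_smul]
    exact hxy.symm)
  have h2 := congrArg Abelianization.of h1
  rw [map_mul, map_mul, map_mul, mul_comm (Abelianization.of η), mul_eq_right] at h2
  exact (QuotientGroup.eq_one_iff α).mp h2

end Splitting

theorem mk_eq_mk_of_eq {d d' : kˣ} {c : k} (h : (d' : k) = c ^ 3 * d) :
    (QuotientGroup.mk d : UnitsModCubes k) = QuotientGroup.mk d' := by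
  have hc : c ≠ 0 := by
    rintro rfl
    rw [zero_pow three_ne_zero, zero_mul] at h
    exact d'.ne_zero h
  rw [QuotientGroup.eq]
  refine ⟨Units.mk0 c hc, Units.ext ?_⟩
  rw [powMonoidHom_apply, Units.val_mul, Units.val_pow_eq_pow_val, Units.val_mk0, h, mul_comm,
    mul_assoc, Units.mul_inv, mul_one]

/-- Both splittings are extended to the algebraic closure, which is Galois over the perfect field
`k`. There the determinants differ by the cube of an element of `k`. -/
theorem IsDetClass.unique [PerfectField k] {α : Aut S} {c c' : UnitsModCubes k}
    (h : IsDetClass S α c) (h' : IsDetClass S α c') : c = c' := by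
  obtain ⟨L, _, _, _, _, s, A, d, hA, hd, rfl⟩ := h
  obtain ⟨L', _, _, _, _, s', A', d', hA', hd', rfl⟩ := h'
  let i : L →ₐ[k] AlgebraicClosure k := IsAlgClosed.lift
  let i' : L' →ₐ[k] AlgebraicClosure k := IsAlgClosed.lift
  let _ : Algebra L (AlgebraicClosure k) := i.toRingHom.toAlgebra
  let _ : Algebra L' (AlgebraicClosure k) := i'.toRingHom.toAlgebra
  have : IsScalarTower k L (AlgebraicClosure k) :=
    IsScalarTower.of_algebraMap_eq fun x => (i.commutes x).symm
  have : IsScalarTower k L' (AlgebraicClosure k) :=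
    IsScalarTower.of_algebraMap_eq fun x => (i'.commutes x).symm
  obtain ⟨t, ht⟩ := s.exists_baseChange (E := AlgebraicClosure k)
  obtain ⟨t', ht'⟩ := s'.exists_baseChange (E := AlgebraicClosure k)
  obtain ⟨c, hc⟩ := t.exists_det_eq_mul t' (ht α A hA) (ht' α A' hA')
  refine mk_eq_mk_of_eq (c := c) ((algebraMap k (AlgebraicClosure k)).injective ?_)
  have h1 : algebraMap k (AlgebraicClosure k) d = ((Matrix.GeneralLinearGroup.map (n := Fin 3)
      (algebraMap L (AlgebraicClosure k)) A : GL (Fin 3) _) : Matrix (Fin 3) (Fin 3) _).det := by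
    rw [IsScalarTower.algebraMap_apply k L, hd]
    exact RingHom.map_det _ _
  have h2 : algebraMap k (AlgebraicClosure k) d' = ((Matrix.GeneralLinearGroup.map (n := Fin 3)
      (algebraMap L' (AlgebraicClosure k)) A' : GL (Fin 3) _) : Matrix (Fin 3) (Fin 3) _).det := by
    rw [IsScalarTower.algebraMap_apply k L', hd']
    exact RingHom.map_det _ _
  rw [h2, hc, map_mul, map_pow, h1]

/-- The determinant homomorphism exists and is the abelianization, once `S` has a splitting over a
finite Galois extension. -/
theorem Splitting.exists_det [PerfectField k] [FiniteDimensional k L] [IsGalois k L]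
    (s : Splitting S L) (hS : ¬ IsTrivial S) :
    ∃ det : Aut S →* UnitsModCubes k,
      (∀ (α : Aut S) (c : UnitsModCubes k), IsDetClass S α c ↔ det α = c) ∧
      IsAbelianization (H := det.range) det.rangeRestrict := by
  choose A hA using s.exists_isAffineRep
  choose d hd using fun α => (hA α).exists_det_eq
  have hcl : ∀ α, IsDetClass S α (QuotientGroup.mk (d α)) := fun α =>
    ⟨L, _, _, inferInstance, inferInstance, s, A α, d α, hA α, hd α, rfl⟩
  -- No coherent choice of representatives is needed: `A α * A β` represents `α * β`, and the class
  -- does not depend on the representative.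
  let det : Aut S →* UnitsModCubes k := MonoidHom.mk' (fun α => QuotientGroup.mk (d α))
    fun α β => (hcl (α * β)).unique ⟨L, _, _, inferInstance, inferInstance, s, A α * A β, d α * d β,
      (hA α).mul (hA β), by
        rw [Units.val_mul, map_mul, hd, hd, Units.val_mul, Matrix.det_mul], rfl⟩
  refine ⟨det, fun α c => ⟨fun h => (hcl α).unique h, fun h => h ▸ hcl α⟩, ?_, ?_⟩
  · rw [injective_iff_map_eq_one]
    intro x hx
    obtain ⟨α, rfl⟩ := QuotientGroup.mk_surjective x
    have h1 : det α = 1 := congrArg Subtype.val hx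
    obtain ⟨c, hc⟩ := (QuotientGroup.eq_one_iff _).mp h1
    refine (QuotientGroup.eq_one_iff α).mpr ((hA α).mem_commutator hS (c := c) ?_)
    rw [← hd, ← hc, powMonoidHom_apply, Units.val_pow_eq_pow_val, map_pow]
  · intro y
    obtain ⟨α, hα⟩ := det.rangeRestrict_surjective y
    exact ⟨Abelianization.of α, hα⟩

end DeterminantMap


/-! ### Existence of a splitting over a finite Galois extension -/

section FiniteSplitting

open Limits Opposite

variable (k K : Type u) [Field k] [Field K] [Algebra k K]

/-- The diagram of finite Galois extensions of `k` inside `K`. -/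
def galoisDiagram : FiniteGaloisIntermediateField k K ⥤ CommRingCat.{u} where
  obj E := CommRingCat.of E
  map {E F} h := CommRingCat.ofHom
    (IntermediateField.inclusion (show E.toIntermediateField ≤ F.toIntermediateField from leOfHom h)
      : E →+* F)
  map_id _ := rfl
  map_comp _ _ := rfl

/-- The field `K` as a cocone over its finite Galois subextensions. -/
def galoisCocone : Cocone (galoisDiagram k K) where
  pt := CommRingCat.of K
  ι := { app := fun E => CommRingCat.ofHom (algebraMap E K) }

/-- A Galois extension is the union of its finite Galois subextensions. -/
def isColimitGaloisCocone [IsGalois k K] : IsColimit (galoisCocone k K) :=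
  have : ReflectsColimit (galoisDiagram k K) (CategoryTheory.forget CommRingCat) :=
    reflectsColimit_of_reflectsIsomorphisms _ _
  isColimitOfReflects (CategoryTheory.forget CommRingCat) <|
    Types.FilteredColimit.isColimitOf' _ _
      (fun (x : K) => ⟨FiniteGaloisIntermediateField.adjoin k {x},
        (⟨x, FiniteGaloisIntermediateField.subset_adjoin k {x} rfl⟩ :
          FiniteGaloisIntermediateField.adjoin k {x}), rfl⟩)
      (fun E _ _ h => ⟨E, 𝟙 E, Subtype.ext h⟩)

/-- The spectra of the finite Galois subextensions of `K`. -/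
abbrev galoisSpecDiagram : (FiniteGaloisIntermediateField k K)ᵒᵖ ⥤ Scheme.{u} :=
  (galoisDiagram k K).op ⋙ Scheme.Spec

/-- The structure morphisms to `Spec k`. -/
def galoisSpecStr : galoisSpecDiagram k K ⟶ (Functor.const _).obj (SpecOf k) where
  app E := specMap k E.unop
  naturality E F f := by
    refine (Spec.map_comp _ _).symm.trans ?_
    rfl

/-- The spectra of the finite Galois subextensions of `K`, as schemes over `k`. -/
abbrev galoisOverDiagram : (FiniteGaloisIntermediateField k K)ᵒᵖ ⥤ Over (SpecOf k) :=
  Over.lift (galoisSpecDiagram k K) (galoisSpecStr k K)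

/-- The spectrum of `K` as a cone over the spectra of its finite Galois subextensions. -/
def galoisOverCone : Cone (galoisOverDiagram k K) :=
  Over.liftCone (galoisSpecDiagram k K) (galoisSpecStr k K)
    (Scheme.Spec.mapCone (galoisCocone k K).op) (specMap k K)
    fun _ => (Spec.map_comp _ _).symm

def isLimitGaloisOverCone [IsGalois k K] : IsLimit (galoisOverCone k K) :=
  Over.isLimitLiftCone _ _ _ _ _ (isLimitOfPreserves Scheme.Spec (isColimitGaloisCocone k K).op)

theorem isAffineHom_left {X : Scheme.{u}} {Y Z : Over X} (f : Y ⟶ Z) (hY : IsAffineHom Y.hom)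
    (hZ : IsAffineHom Z.hom) : IsAffineHom f.left := by
  have : IsAffineHom (f.left ≫ Z.hom) := by rwa [Over.w f]
  exact IsAffineHom.of_comp _ Z.hom

theorem compactSpace_left {X : Scheme.{u}} [CompactSpace X] (Y : Over X) (hY : IsAffineHom Y.hom) :
    CompactSpace Y.left :=
  QuasiCompact.compactSpace_of_compactSpace Y.hom

theorem quasiSeparatedSpace_left {X : Scheme.{u}} [QuasiSeparatedSpace X] (Y : Over X)
    (hY : IsAffineHom Y.hom) : QuasiSeparatedSpace Y.left :=
  quasiSeparatedSpace_of_quasiSeparated Y.hom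

variable {k K} {P S : Over (SpecOf k)}

theorem isAffineHom_pullback_snd {X Y Z : Scheme.{u}} (f : X ⟶ Z) (g : Y ⟶ Z) [IsAffineHom f] :
    IsAffineHom (pullback.snd f g) :=
  MorphismProperty.of_isPullback (P := @IsAffineHom) (IsPullback.of_hasPullback f g) inferInstance

/-- `K` is the union of its finite Galois subextensions `E`, so `P_K` is the limit of the `P_E`
along affine maps, and a morphism to a scheme locally of finite presentation factors through a
finite stage. -/
theorem exists_pullback_hom [IsGalois k K] [CompactSpace P.left] [QuasiSeparatedSpace P.left]
    [LocallyOfFinitePresentation S.hom]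
    (a : pullback (specMap k K) P.hom ⟶ S.left) (ha : a ≫ S.hom = pullback.snd _ _ ≫ P.hom) :
    ∃ (E : FiniteGaloisIntermediateField k K) (g : pullback (specMap k E) P.hom ⟶ S.left),
      pullback.lift (pullback.fst (specMap k K) P.hom ≫ specMap E K) (pullback.snd _ _)
        (by rw [Category.assoc, specMap_comp, pullback.condition]) ≫ g = a ∧
      g ≫ S.hom = pullback.snd _ _ ≫ P.hom := by
  let D : (FiniteGaloisIntermediateField k K)ᵒᵖ ⥤ Scheme.{u} :=
    galoisOverDiagram k K ⋙ Over.pullback P.hom ⋙ Over.forget P.left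
  let t : D ⟶ (Functor.const _).obj (SpecOf k) :=
    { app := fun E => ((Over.pullback P.hom).obj ((galoisOverDiagram k K).obj E)).hom ≫ P.hom
      naturality := fun E F f => by
        refine (Category.assoc _ _ _).symm.trans (Eq.trans ?_ (Category.comp_id _).symm)
        exact congrArg (· ≫ P.hom) (Over.w ((Over.pullback P.hom).map _)) }
  let c : Cone D := (Over.pullback P.hom ⋙ Over.forget P.left).mapCone (galoisOverCone k K)
  have hc : IsLimit c := isLimitOfPreserves _ (isLimitGaloisOverCone k K)
  have haff : ∀ E, IsAffineHom ((Over.pullback P.hom).obj ((galoisOverDiagram k K).obj E)).hom :=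
    fun E => isAffineHom_pullback_snd (specMap k E.unop) P.hom
  have hD : ∀ {E F} (f : E ⟶ F), IsAffineHom (D.map f) := fun f =>
    isAffineHom_left _ (haff _) (haff _)
  have hcpt : ∀ E, CompactSpace (D.obj E) := fun E => compactSpace_left _ (haff E)
  have hqs : ∀ E, QuasiSeparatedSpace (D.obj E) := fun E => quasiSeparatedSpace_left _ (haff E)
  obtain ⟨E, g, hg, hg'⟩ := Scheme.exists_π_app_comp_eq_of_locallyOfFinitePresentation D t S.hom c
    hc a (by
      ext E : 2
      refine Eq.trans ?_ ha.symm
      refine (Category.assoc _ _ _).symm.trans ?_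
      exact congrArg (· ≫ P.hom) (Over.w ((Over.pullback P.hom).map _)))
  exact ⟨E.unop, g, hg, hg'⟩

theorem flat_surjective_quasiCompact_baseChangeProj (L E : Type u) [Field L] [Field E]
    [Algebra k L] [Algebra k E] [Algebra L E] [IsScalarTower k L E] (X : Over (SpecOf k)) :
    (@Surjective ⊓ @Flat ⊓ @QuasiCompact : MorphismProperty Scheme.{u})
      (baseChangeProj L E X) := by
  have h := isPullback_baseChangeProj (L := L) (E := E) X
  have h1 := flat_and_surjective_specMap (k := L) (L := E)
  exact ⟨⟨MorphismProperty.of_isPullback h.flip h1.2, MorphismProperty.of_isPullback h.flip h1.1⟩,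
    MorphismProperty.of_isPullback (P := @QuasiCompact) h.flip inferInstance⟩

/-- An isomorphism over a Galois extension is defined over a finite Galois subextension. -/
theorem exists_baseChange_iso [IsGalois k K] [CompactSpace P.left] [QuasiSeparatedSpace P.left]
    [LocallyOfFinitePresentation S.hom] (e : (baseChange k K).obj P ≅ (baseChange k K).obj S) :
    ∃ E : FiniteGaloisIntermediateField k K,
      Nonempty ((baseChange k E).obj P ≅ (baseChange k E).obj S) := by
  have hew : e.hom.left ≫ pullback.snd S.hom (specMap k K) = pullback.snd P.hom (specMap k K) :=
    Over.w e.hom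
  obtain ⟨E, g, hg, hgw⟩ := exists_pullback_hom (P := P) (S := S)
    ((pullbackSymmetry (specMap k K) P.hom).hom ≫ e.hom.left ≫ pullback.fst S.hom (specMap k K))
    (by
      simp only [Category.assoc]
      rw [pullback.condition, ← Category.assoc e.hom.left, hew, ← pullback.condition,
        pullbackSymmetry_hom_comp_fst_assoc])
  refine ⟨E, ?_⟩
  let m : (baseChange k E).obj P ⟶ (baseChange k E).obj S := Over.homMk
    (pullback.lift ((pullbackSymmetry P.hom (specMap k E)).hom ≫ g)
      (pullback.snd P.hom (specMap k E)) (by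
        rw [Category.assoc, hgw, pullbackSymmetry_hom_comp_snd_assoc, pullback.condition]))
    (pullback.lift_snd ..)
  have hm1 : m.left ≫ pullback.fst S.hom (specMap k E) =
      (pullbackSymmetry P.hom (specMap k E)).hom ≫ g := pullback.lift_fst ..
  have hm2 : m.left ≫ pullback.snd S.hom (specMap k E) = pullback.snd P.hom (specMap k E) :=
    pullback.lift_snd ..
  have hcomm : e.hom.left ≫ baseChangeProj E K S = baseChangeProj E K P ≫ m.left := by
    apply pullback.hom_ext
    · rw [Category.assoc, baseChangeProj_fst, Category.assoc]
      refine Eq.trans ?_ (congrArg (_ ≫ ·) hm1.symm)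
      have h1 : baseChangeProj E K P ≫ (pullbackSymmetry P.hom (specMap k E)).hom =
          (pullbackSymmetry P.hom (specMap k K)).hom ≫
            pullback.lift (pullback.fst (specMap k K) P.hom ≫ specMap E K) (pullback.snd _ _)
              (by rw [Category.assoc, specMap_comp, pullback.condition]) := by
        apply pullback.hom_ext
        · simp only [Category.assoc, pullbackSymmetry_hom_comp_fst, pullback.lift_fst,
            pullbackSymmetry_hom_comp_fst_assoc]
          exact baseChangeProj_snd P
        · simp only [Category.assoc, pullbackSymmetry_hom_comp_snd, pullback.lift_snd]
          exact baseChangeProj_fst P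
      have h2 : (pullbackSymmetry P.hom (specMap k K)).hom ≫
          (pullbackSymmetry (specMap k K) P.hom).hom = 𝟙 _ := by
        apply pullback.hom_ext <;> simp
      rw [← Category.assoc (baseChangeProj E K P), h1, Category.assoc, hg, ← Category.assoc, h2]
      exact (Category.id_comp _).symm
    · rw [Category.assoc, baseChangeProj_snd, Category.assoc]
      refine Eq.trans ?_ (congrArg (_ ≫ ·) hm2.symm)
      rw [baseChangeProj_snd, ← Category.assoc]
      exact congrArg (· ≫ _) hew
  have h1 := (isPullback_baseChangeProj (L := E) (E := K) S).flip
  have h2 := (isPullback_baseChangeProj (L := E) (E := K) P).flip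
  rw [← Over.w e.hom, ← Over.w m] at h2
  have h3 := IsPullback.of_right h2 hcomm h1
  -- Only the morphism `e.hom` was brought down to `E`; that it is an isomorphism is tested after
  -- the faithfully flat, quasi-compact base change from `E` to `K`.
  have : IsIso m.left := (MorphismProperty.isomorphisms Scheme).of_isPullback_of_descendsAlong h3
    (flat_surjective_quasiCompact_baseChangeProj E K S) (inferInstanceAs (IsIso e.hom.left))
  exact ⟨Over.isoMk (asIso m.left) (Over.w m)⟩

instance compactSpace_projSpace (R : Type u) [CommRing R] (ι : Type) [Finite ι] :
    CompactSpace (projSpace R ι).left :=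
  have : Finite (chartCover R ι).I₀ := inferInstanceAs (Finite ι)
  have : ∀ i, CompactSpace ((chartCover R ι).X i) := fun (i : ι) =>
    inferInstanceAs (CompactSpace (Spec (CommRingCat.of
      (HomogeneousLocalization.Away (polyGrading R ι) (X i : MvPolynomial ι R)))))
  (chartCover R ι).compactSpace

instance quasiSeparatedSpace_projSpace (R : Type u) [CommRing R] (ι : Type) :
    QuasiSeparatedSpace (projSpace R ι).left :=
  inferInstanceAs (QuasiSeparatedSpace (Proj (polyGrading R ι)))

/-- `φ ∘ g ∘ φ⁻¹` and the standard action of `g` lie over the same automorphism of `Spec L`, so they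
differ by an automorphism of the plane over `L`, which is a matrix. -/
theorem exists_splitting_of_iso {L : Type u} [Field L] [Algebra k L]
    (φ : (baseChange k L).obj S ≅ projPlane L) : Nonempty (Splitting S L) := by
  have h : ∀ g : Gal(L/k), ∃ A, φ.inv.left ≫ galoisAct S g ≫ φ.hom.left =
      galoisProj (Fin 3) g ≫ matrixMap A := fun g => by
    let f (g : Gal(L/k)) : (projPlane L).left ⟶ (projPlane L).left :=
      φ.inv.left ≫ galoisAct S g ≫ φ.hom.left
    have hf : ∀ g h, f g ≫ f h = f (h * g) := fun g h => by
      simp only [f, Category.assoc]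
      rw [galoisAct_mul, ← Category.assoc φ.hom.left, hom_left_inv_left]
      simp only [Category.assoc]
      exact congrArg (fun t => _ ≫ _ ≫ t) (Category.id_comp _)
    have hf1 : f 1 = 𝟙 _ := by
      simp only [f]
      rw [galoisAct_one]
      exact (congrArg (_ ≫ ·) (Category.id_comp _)).trans (hom_left_inv_left φ.symm)
    have hfw : ∀ g, f g ≫ (projPlane L).hom = (projPlane L).hom ≫
        Spec.map (CommRingCat.ofHom ((g⁻¹ : Gal(L/k)) : L →+* L)) := fun g => by
      have h1 : φ.hom.left ≫ (projPlane L).hom = ((baseChange k L).obj S).hom := Over.w φ.hom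
      have h2 : φ.inv.left ≫ ((baseChange k L).obj S).hom = (projPlane L).hom := Over.w φ.inv
      simp only [f, Category.assoc]
      rw [h1, ← h2, Category.assoc]
      exact congrArg (_ ≫ ·) (galoisAct_snd S g)
    have hG : ∀ g : Gal(L/k), Spec.map (CommRingCat.ofHom ((g⁻¹ : Gal(L/k)) : L →+* L)) ≫
        Spec.map (CommRingCat.ofHom ((g⁻¹⁻¹ : Gal(L/k)) : L →+* L)) = 𝟙 _ := fun g => by
      rw [← Spec.map_comp, ← CommRingCat.ofHom_comp]
      refine Eq.trans (congrArg Spec.map (CommRingCat.hom_ext (RingHom.ext fun x => ?_)))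
        (Spec.map_id _)
      exact g⁻¹.apply_symm_apply x
    have hG' : ∀ g : Gal(L/k), Spec.map (CommRingCat.ofHom ((g⁻¹⁻¹ : Gal(L/k)) : L →+* L)) ≫
        Spec.map (CommRingCat.ofHom ((g⁻¹ : Gal(L/k)) : L →+* L)) = 𝟙 _ := fun g => by
      have h3 := hG g⁻¹
      rwa [inv_inv] at h3 ⊢
    obtain ⟨A, hA⟩ := exists_eq_matrixMap (galoisProj (Fin 3) g⁻¹ ≫ f g)
      (f g⁻¹ ≫ galoisProj (Fin 3) g)
      (by
        rw [Category.assoc, ← Category.assoc (f g), hf, inv_mul_cancel, hf1, Category.id_comp,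
          ← galoisProj_mul, mul_inv_cancel, galoisProj_one])
      (by
        rw [Category.assoc, hfw, ← Category.assoc, galoisProj_hom, Category.assoc, hG',
          Category.comp_id])
      (by
        rw [Category.assoc, galoisProj_hom, ← Category.assoc, hfw, Category.assoc, hG',
          Category.comp_id])
    refine ⟨A, ?_⟩
    rw [← hA, ← Category.assoc (galoisProj _ g), ← galoisProj_mul, inv_mul_cancel, galoisProj_one, Category.id_comp]
  choose A hA using h
  exact ⟨⟨φ, A, hA⟩⟩

/-- A Severi-Brauer surface over a perfect field has a splitting over a finite Galois extension. -/
theorem IsSeveriBrauerSurface.exists_splitting [PerfectField k] (hS : IsSeveriBrauerSurface S) :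
    ∃ E : FiniteGaloisIntermediateField k (AlgebraicClosure k), Nonempty (Splitting S E) := by
  obtain ⟨ψ⟩ := hS.geometrically_plane
  have := hS.smooth
  have := SmoothOfRelativeDimension.smooth 2 S.hom
  have : LocallyOfFinitePresentation S.hom := inferInstance
  obtain ⟨E, ⟨e⟩⟩ := exists_baseChange_iso (P := projPlane k)
    ((Splitting.planeBaseChange k (AlgebraicClosure k)).symm ≪≫ ψ.symm)
  exact ⟨E, exists_splitting_of_iso (e.symm ≪≫ (Splitting.planeBaseChange k E).symm)⟩

end FiniteSplitting

end

end SeveriBrauer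

theorem mainTheorem6 (k : Type u) [Field k] [PerfectField k]
    (S : Over (SeveriBrauer.SpecOf k))
    (hS : SeveriBrauer.IsSeveriBrauerSurface S) (hnt : ¬ SeveriBrauer.IsTrivial S) :
    ∃ det : Aut S →* SeveriBrauer.UnitsModCubes k,
      (∀ (α : Aut S) (c : SeveriBrauer.UnitsModCubes k),
        SeveriBrauer.IsDetClass S α c ↔ det α = c) ∧
      SeveriBrauer.IsAbelianization (H := det.range) det.rangeRestrict := by
  obtain ⟨_, ⟨s⟩⟩ := hS.exists_splitting
  exact s.exists_det hnt
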